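/- **Setting.** A *type-theoretic fibration category* is a category $\mathcal C$ with a terminal object $1$ and a class of maps called fibrations, closed under composition and containing all isomorphisms and all maps to $1$, such that pullbacks of fibrations exist and are fibrations; for every fibration $f:Y\to Z$ and fibration $g:X\to Y$ the dependent product $\Pi_f g\to Z$ exists (maps $W\to\Pi_f g$ over $Z$ correspond naturally to maps $W\times_Z Y\to X$ over $Y$, for all $W\to Z$) and is a fibration; and every map factors as an acyclic cofibration (a map with the left lifting property against all fibrations) followed by a fibration. In any category with fibrations, a path object of $B$ is a factorization $B\to PB\to B\times B$ of the diagonal as an acyclic cofibration followed by a fibration; maps $f,g:A\to B$ are homotopic if $(f,g)$ lifts to some $PB$, and this defines homotopy equivalences. $\mathcal C$ satisfies *function extensionality* if $\Pi_f g\to Z$ is a homotopy equivalence whenever $f$ is a fibration and $g$ is a fibration and a homotopy equivalence. $\mathcal C^Z$ denotes the full subcategory of $\mathcal C/Z$ on the fibrations with codomain $Z$; a map in it is a fibration if it is one in $\mathcal C$. Let $I_0$ be a well-founded poset. An *inverse category* $I$ in $\mathcal C$ on $I_0$ consists of objects $I(x)$ ($x\in I_0$), spans $I(x)\leftarrow I(x,y)\to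 I(y)$ for $y<x$ with left leg a fibration, and associative composition maps $I(x,y)\times_{I(y)}I(y,z)\to I(x,z)$ over $I(x)$ and $I(z)$. An *$X$-indexed $I$-diagram* $A$ consists of spans $X\leftarrow A_x\to I(x)$ with left leg a fibration, and associative actions $A_x\times_{I(x)}I(x,y)\to A_y$ over $X$ and $I(y)$ for $y<x$; maps of $X$-indexed diagrams are families $A_x\to A'_x$ over $X$ and $I(x)$ commuting with the actions. Diagrams can be reindexed along $p:Z\to X$ by pullback. For an $X$-indexed $A$ and a $Y$-indexed $B$, the hom-object $\mathcal C^I(A,B)\to X\times Y$, if it exists, represents $(p,q:Z\to X\times Y)\mapsto\mathrm{Hom}(p^*A,q^*B)$. For $x\in I_0$ let $\partial xI$ be the restriction of $I$ to $\{y\mid y<x\}$, and $I(x,-)$ the $I(x)$-indexed $\partial xI$-diagram $y\mapsto I(x,y)$. The matching object of an $X$-indexed diagram $A$ is $M_xA=\mathcal C^{\partial xI}(I(x,-),A|_{\partial xI})\to I(x)\times X$; there is an induced map $A_x\to M_xA$. $A$ is *Reedy fibrant* if each $M_xA$ exists and each $A_x\to M_xA$ is a fibration; a map $A\to B$ is a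 *Reedy fibration* if each pullback $M_xA\times_{M_xB}B_x$ exists and $A_x\to M_xA\times_{M_xB}B_x$ is a fibration. The category of Reedy fibrant $X$-indexed $I$-diagrams, with Reedy fibrations as its fibrations, is $\mathcal C^{I,X}_f$. $I$ is *fibrant* if each $I(x)$ is fibrant and each $I(x,-)$ is Reedy fibrant. For a well-founded poset $J$ and a category $\mathcal D$ with fibrations, Reedy fibrant ordinary diagrams $J^{op}\to\mathcal D$ and Reedy fibrations are defined in the same way with the ordinary matching objects $\lim_{i<j}A_i$, and a Reedy acyclic cofibration is a map with the left lifting property against Reedy fibrations between Reedy fibrant diagrams. $\mathcal D$ *has Reedy $J^{op}$-limits* if every Reedy fibrant diagram $J^{op}\to\mathcal D$ has a limit, which is fibrant, and if, between Reedy fibrant diagrams, the induced map on limits is a fibration, homotopy equivalence, or acyclic cofibration whenever the map of diagrams is a Reedy fibration, a levelwise homotopy equivalence, or a Reedy acyclic cofibration, respectively. **Statement.** Let $\mathcal C$ be a type-theoretic fibration category satisfying function extensionality, $I_0$ a well-founded poset, and $I$ a fibrant inverse category in $\mathcal C$ on $I_0$. Assume that $I_0$ is admissible: for every $x\in I_0$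 and every object $Z$ of $\mathcal C$, the category $\mathcal C^Z$ has Reedy $\{y\mid y<x\}^{op}$-limits. 1. Let $X,Y$ be objects of $\mathcal C$ such that $\mathcal C^{X\times Y}$ has Reedy $I_0^{op}$-limits. Let $A$ be a Reedy fibrant $X$-indexed $I$-diagram, $B,B'$ Reedy fibrant $Y$-indexed $I$-diagrams, and $g:B\to B'$ a map which is a homotopy equivalence in $\mathcal C^{I,Y}_f$, or merely such that each $g_x:B_x\to B'_x$ is a homotopy equivalence in $\mathcal C$. Then the hom-objects $\mathcal C^I(A,B)$ and $\mathcal C^I(A,B')$ exist, they are fibrations over $X\times Y$, and the map $\mathcal C^I(A,B)\to\mathcal C^I(A,B')$ induced by $g$ is a homotopy equivalence, both in $\mathcal C^{X\times Y}$ and in $\mathcal C$. 2. For every $x\in I_0$ the matching functor $M_x:\mathcal C^{\partial xI,1}_f\to\mathcal C^{I(x)\times 1}\cong\mathcal C^{I(x)}$, $A\mapsto\mathcal C^{\partial xI}(I(x,-),A)$, exists, and it is a strong fibration functor: it preserves fibrations, pullbacks of fibrations, the terminal object, and homotopy equivalences. Its composite with the forgetful functor $\mathcal C^{I(x)\times1}\to\mathcal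 C$ also preserves fibrations, pullbacks of fibrations, and homotopy equivalences. -/

import Mathlib

open CategoryTheory CategoryTheory.Limits HomotopicalAlgebra Opposite

universe w v u

attribute [instance 2000] CategoryTheory.CategoryStruct.toQuiver

attribute [local simp] pullback.lift_fst pullback.lift_snd pullback.lift_fst_assoc
  pullback.lift_snd_assoc

/-! ## Homotopy theory defined by a class of fibrations -/

section Generic

variable {D : Type u} [Category.{v} D] [CategoryWithFibrations D]

/-- An acyclic cofibration is a map with the left lifting property against all fibrations. -/
def IsAcyclicCofibration {A B : D} (i : A ⟶ B) : Prop :=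
  (fibrations D).llp i

/-- `B` is fibrant if `B ⟶ 1` is a fibration. -/
def IsFibrantObj (B : D) : Prop :=
  ∃ (T : D) (hT : IsTerminal T), Fibration (hT.from B)

/-- A path object of `B`: a factorization `B ⟶ P ⟶ B × B` of the diagonal as an acyclic
cofibration followed by a fibration. -/
structure PathObj (B : D) where
  obj : D
  refl : B ⟶ obj
  src : obj ⟶ B
  tgt : obj ⟶ B
  refl_src : refl ≫ src = 𝟙 B
  refl_tgt : refl ≫ tgt = 𝟙 B
  acyclic : IsAcyclicCofibration refl
  fib : ∃ (c : BinaryFan B B) (hc : IsLimit c), Fibration (hc.lift (BinaryFan.mk src tgt))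

/-- (Right) homotopy of maps. -/
def Homotopic {A B : D} (f g : A ⟶ B) : Prop :=
  ∃ (P : PathObj B) (H : A ⟶ P.obj), H ≫ P.src = f ∧ H ≫ P.tgt = g

/-- Homotopy equivalences. -/
def IsHomotopyEquiv {A B : D} (f : A ⟶ B) : Prop :=
  ∃ g : B ⟶ A, Homotopic (f ≫ g) (𝟙 A) ∧ Homotopic (g ≫ f) (𝟙 B)

end Generic

/-- A functor between categories with fibrations which preserves fibrations, pullbacks of
fibrations (along arbitrary maps), and homotopy equivalences. -/
structure PreservesFibrationStructure {D : Type*} [Category* D] [CategoryWithFibrations D]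
    {E : Type*} [Category* E] [CategoryWithFibrations E] (F : D ⥤ E) : Prop where
  fibration : ∀ {A B : D} (f : A ⟶ B), Fibration f → Fibration (F.map f)
  pullback : ∀ {P A B E' : D} {t : P ⟶ E'} {l : P ⟶ A} {p : E' ⟶ B} {f : A ⟶ B},
    Fibration p → IsPullback t l p f →
      IsPullback (F.map t) (F.map l) (F.map p) (F.map f)
  homotopyEquiv : ∀ {A B : D} (f : A ⟶ B), IsHomotopyEquiv f → IsHomotopyEquiv (F.map f)

/-- A strong fibration functor moreover preserves terminal objects. -/
structure IsStrongFibrationFunctor {D : Type*} [Category* D] [CategoryWithFibrations D]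
    {E : Type*} [Category* E] [CategoryWithFibrations E] (F : D ⥤ E) : Prop extends
    PreservesFibrationStructure F where
  terminal : ∀ T : D, Nonempty (IsTerminal T) → Nonempty (IsTerminal (F.obj T))

/-! ## Type-theoretic fibration categories -/

/-- The limit-theoretic axioms: a terminal object, a subcategory of fibrations containing all
isomorphisms and all maps to the terminal object, with pullbacks of fibrations. -/
class HasFibrationPullbacks (C : Type u) [Category.{v} C] [CategoryWithFibrations C] :
    Prop where
  hasTerminal : HasTerminal C
  fibration_of_isIso : ∀ {X Y : C} (f : X ⟶ Y), IsIso f → Fibration f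
  fibration_comp : ∀ {X Y Z : C} (f : X ⟶ Y) (g : Y ⟶ Z),
    Fibration f → Fibration g → Fibration (f ≫ g)
  fibration_terminal : ∀ {X T : C} (f : X ⟶ T), Nonempty (IsTerminal T) → Fibration f
  hasPullback : ∀ {X Y Z : C} (f : X ⟶ Z) (g : Y ⟶ Z), Fibration g → HasPullback f g
  fibration_pullback : ∀ {P X Y Z : C} {t : P ⟶ Y} {l : P ⟶ X} {g : Y ⟶ Z} {f : X ⟶ Z},
    IsPullback t l g f → Fibration g → Fibration l

lemma over_hom_comp {C : Type u} [Category.{v} C] {S T : C} {Z W : Over S} (f : W ⟶ Z) (k : S ⟶ T) :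
    W.hom ≫ k = f.left ≫ Z.hom ≫ k := by
  rw [← Category.assoc, Over.w]

section Pullbacks

variable {C : Type u} [Category.{v} C] [CategoryWithFibrations C] [HasFibrationPullbacks C]

instance hasTerminal_of_hasFibrationPullbacks : HasTerminal C :=
  HasFibrationPullbacks.hasTerminal

instance hasPullback_of_fibration_right {X Y Z : C} (f : X ⟶ Z) (g : Y ⟶ Z) [h : Fibration g] :
    HasPullback f g :=
  HasFibrationPullbacks.hasPullback f g h

instance hasPullback_of_fibration_left {X Y Z : C} (f : X ⟶ Z) (g : Y ⟶ Z) [h : Fibration f] :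
    HasPullback f g :=
  haveI := HasFibrationPullbacks.hasPullback g f h
  hasPullback_symmetry g f

instance fibration_pullback_fst {X Y Z : C} (f : X ⟶ Z) (g : Y ⟶ Z) [h : Fibration g] :
    Fibration (pullback.fst f g) :=
  HasFibrationPullbacks.fibration_pullback (IsPullback.of_hasPullback f g).flip h

instance hasBinaryProducts_of_hasFibrationPullbacks : HasBinaryProducts C := by
  have key : ∀ X Y : C, HasLimit (pair X Y) := fun X Y =>
    have : Fibration (terminal.from X) :=
      HasFibrationPullbacks.fibration_terminal _ ⟨terminalIsTerminal⟩
    ⟨⟨⟨_, isProductOfIsTerminalIsPullback _ _ _ _ terminalIsTerminal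
      (pullbackIsPullback (terminal.from X) (terminal.from Y))⟩⟩⟩
  exact hasBinaryProducts_of_hasLimit_pair C

end Pullbacks

/-- `P ⟶ Z` is the dependent product of `g : X ⟶ Y` along the fibration `f : Y ⟶ Z`: maps
`W ⟶ P` over `Z` correspond naturally to maps `W ×_Z Y ⟶ X` over `Y`, for all `W ⟶ Z`. -/
abbrev DepProd {C : Type u} [Category.{v} C] [CategoryWithFibrations C]
    [HasFibrationPullbacks C] {X Y Z : C} (f : Y ⟶ Z) [Fibration f] (g : X ⟶ Y)
    (P : Over Z) : Type _ :=
  ((Over.pullback f).op ⋙ yoneda.obj (Over.mk g)).RepresentableBy P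

/-- Type-theoretic fibration categories. -/
class IsTypeTheoreticFibrationCategory (C : Type u) [Category.{v} C]
    [CategoryWithFibrations C] : Prop extends HasFibrationPullbacks C where
  depProd : ∀ {X Y Z : C} (f : Y ⟶ Z) [Fibration f] (g : X ⟶ Y), Fibration g →
    ∃ P : Over Z, Fibration P.hom ∧ Nonempty (DepProd f g P)
  factorization : ∀ {X Y : C} (f : X ⟶ Y),
    ∃ (W : C) (i : X ⟶ W) (p : W ⟶ Y), IsAcyclicCofibration i ∧ Fibration p ∧ i ≫ p = f

/-- Function extensionality: dependent products along fibrations preserve acyclic fibrations. -/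
def FunctionExtensionality (C : Type u) [Category.{v} C] [CategoryWithFibrations C]
    [HasFibrationPullbacks C] : Prop :=
  ∀ {X Y Z : C} (f : Y ⟶ Z) [Fibration f] (g : X ⟶ Y), Fibration g → IsHomotopyEquiv g →
    ∀ P : Over Z, DepProd f g P → IsHomotopyEquiv P.hom

/-- The self-indexing: `FibOver Z` is the category of fibrations with codomain `Z`, a full
subcategory of `Over Z`. -/
abbrev FibOver {C : Type u} [Category.{v} C] [CategoryWithFibrations C] (Z : C) :=
  ((fibrations C).overObj (X := Z)).FullSubcategory

/-- Fibrations in `FibOver Z` are the maps which are fibrations in the ambient category. -/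
instance {C : Type u} [Category.{v} C] [CategoryWithFibrations C] (Z : C) :
    CategoryWithFibrations (FibOver Z) :=
  ⟨fun _ _ f => Fibration f.hom.left⟩

/-- The functor `FibOver Z ⥤ C` forgetting the map to `Z`. -/
abbrev FibOver.total {C : Type u} [Category.{v} C] [CategoryWithFibrations C] (Z : C) :
    FibOver Z ⥤ C :=
  ObjectProperty.ι _ ⋙ Over.forget Z

/-! ## Reedy limits of diagrams on the opposite of a well-founded poset -/

section Reedy

variable {J : Type w} [PartialOrder J] {D : Type u} [Category.{v} D]

/-- The inclusion of the elements strictly below `j`. -/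
def strictIncl (j : J) : (Set.Iio j)ᵒᵖ ⥤ Jᵒᵖ :=
  (show Monotone (fun i : Set.Iio j => i.1) from fun _ _ h => h).functor.op

/-- The cone exhibiting the map from `A_j` to the matching object `lim_{i < j} A_i`. -/
def matchingCone (A : Jᵒᵖ ⥤ D) (j : J) : Cone (strictIncl j ⋙ A) where
  pt := A.obj (op j)
  π :=
    { app := fun i => A.map (homOfLE (le_of_lt i.unop.2)).op
      naturality := fun i k f => by
        dsimp [strictIncl]
        rw [Category.id_comp, ← A.map_comp]
        rfl }

/-- The map from `A_j` to the matching object. -/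
noncomputable def toMatchingLimit (A : Jᵒᵖ ⥤ D) (j : J) [HasLimit (strictIncl j ⋙ A)] :
    A.obj (op j) ⟶ limit (strictIncl j ⋙ A) :=
  limit.lift (strictIncl j ⋙ A) (matchingCone A j)

/-- The map of matching objects induced by a map of diagrams. -/
noncomputable def matchingLimitMap {A B : Jᵒᵖ ⥤ D} (f : A ⟶ B) (j : J)
    [HasLimit (strictIncl j ⋙ A)] [HasLimit (strictIncl j ⋙ B)] :
    limit (strictIncl j ⋙ A) ⟶ limit (strictIncl j ⋙ B) :=
  limMap (Functor.whiskerLeft (strictIncl j) f)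

lemma toMatchingLimit_naturality {A B : Jᵒᵖ ⥤ D} (f : A ⟶ B) (j : J)
    [HasLimit (strictIncl j ⋙ A)] [HasLimit (strictIncl j ⋙ B)] :
    toMatchingLimit A j ≫ matchingLimitMap f j = f.app (op j) ≫ toMatchingLimit B j := by
  apply limit.hom_ext
  intro k
  have h₁ := limit.lift_π (matchingCone A j) k
  have h₂ := limit.lift_π (matchingCone B j) k
  have h₃ := limMap_π (Functor.whiskerLeft (strictIncl j) f) k
  rw [toMatchingLimit, toMatchingLimit, matchingLimitMap]
  erw [Category.assoc, Category.assoc, h₃, reassoc_of% h₁, h₂]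
  exact f.naturality _

variable [CategoryWithFibrations D]

/-- Reedy fibrant diagrams: each matching object `M_j A` exists and `A_j ⟶ M_j A` is a
fibration. -/
def IsReedyFibrantDiagram (A : Jᵒᵖ ⥤ D) : Prop :=
  ∀ j : J, ∃ _ : HasLimit (strictIncl j ⋙ A), Fibration (toMatchingLimit A j)

/-- Reedy fibrations: the matching objects and the pullback `M_j A ×_{M_j B} B_j` exist, and
`A_j ⟶ M_j A ×_{M_j B} B_j` is a fibration. -/
def IsReedyFibrationOfDiagrams {A B : Jᵒᵖ ⥤ D} (f : A ⟶ B) : Prop :=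
  ∀ j : J, ∃ (_ : HasLimit (strictIncl j ⋙ A)) (_ : HasLimit (strictIncl j ⋙ B))
    (_ : HasPullback (matchingLimitMap f j) (toMatchingLimit B j)),
    Fibration (pullback.lift (toMatchingLimit A j) (f.app (op j))
      (toMatchingLimit_naturality f j))

/-- Reedy acyclic cofibrations: the left lifting property against all Reedy fibrations between
Reedy fibrant diagrams. -/
def IsReedyAcyclicCofibration {A B : Jᵒᵖ ⥤ D} (f : A ⟶ B) : Prop :=
  ∀ (E F : Jᵒᵖ ⥤ D) (p : E ⟶ F), IsReedyFibrantDiagram E → IsReedyFibrantDiagram F →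
    IsReedyFibrationOfDiagrams p → HasLiftingProperty f p

variable (J D) in
/-- The category `D` has Reedy `Jᵒᵖ`-limits. -/
structure HasReedyLimits : Prop where
  hasLimit : ∀ A : Jᵒᵖ ⥤ D, IsReedyFibrantDiagram A →
    ∃ _ : HasLimit A, IsFibrantObj (limit A)
  fibration : ∀ {A B : Jᵒᵖ ⥤ D} (f : A ⟶ B) [HasLimit A] [HasLimit B],
    IsReedyFibrantDiagram A → IsReedyFibrantDiagram B →
      IsReedyFibrationOfDiagrams f → Fibration (limMap f)
  homotopyEquiv : ∀ {A B : Jᵒᵖ ⥤ D} (f : A ⟶ B) [HasLimit A] [HasLimit B],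
    IsReedyFibrantDiagram A → IsReedyFibrantDiagram B →
      (∀ j : J, IsHomotopyEquiv (f.app (op j))) → IsHomotopyEquiv (limMap f)
  acyclicCofibration : ∀ {A B : Jᵒᵖ ⥤ D} (f : A ⟶ B) [HasLimit A] [HasLimit B],
    IsReedyFibrantDiagram A → IsReedyFibrantDiagram B →
      IsReedyAcyclicCofibration f → IsAcyclicCofibration (limMap f)

end Reedy

/-! ## Internal inverse categories -/

/-- An inverse category internal to `C`, on the poset of objects `I₀` (well-foundedness of the
order is assumed separately).  The spans are `obj x ← hom x y → obj y` for `y < x`. -/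
structure InverseCat (C : Type u) [Category.{v} C] [CategoryWithFibrations C]
    [HasFibrationPullbacks C] (I₀ : Type w) [PartialOrder I₀] where
  obj : I₀ → C
  hom : ∀ {x y : I₀}, y < x → C
  src : ∀ {x y : I₀} (h : y < x), hom h ⟶ obj x
  tgt : ∀ {x y : I₀} (h : y < x), hom h ⟶ obj y
  [fib_src : ∀ {x y : I₀} (h : y < x), Fibration (src h)]
  comp : ∀ {x y z : I₀} (h : y < x) (k : z < y),
    pullback (tgt h) (src k) ⟶ hom (k.trans h)
  comp_src : ∀ {x y z : I₀} (h : y < x) (k : z < y),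
    comp h k ≫ src (k.trans h) = pullback.fst (tgt h) (src k) ≫ src h
  comp_tgt : ∀ {x y z : I₀} (h : y < x) (k : z < y),
    comp h k ≫ tgt (k.trans h) = pullback.snd (tgt h) (src k) ≫ tgt k
  /-- Associativity, on generalized elements of the triple pullback. -/
  assoc : ∀ {x y z t : I₀} (h : y < x) (k : z < y) (l : t < z) {Z : C}
    (a : Z ⟶ hom h) (b : Z ⟶ hom k) (c : Z ⟶ hom l)
    (e₁ : a ≫ tgt h = b ≫ src k) (e₂ : b ≫ tgt k = c ≫ src l),
    pullback.lift (pullback.lift a b e₁ ≫ comp h k) c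
        (by rw [Category.assoc, comp_tgt, pullback.lift_snd_assoc, e₂]) ≫ comp (k.trans h) l =
      pullback.lift a (pullback.lift b c e₂ ≫ comp k l)
        (by rw [Category.assoc, comp_src, pullback.lift_fst_assoc, e₁]) ≫ comp h (l.trans k)

attribute [instance] InverseCat.fib_src

section Diagrams

variable {C : Type u} [Category.{v} C] [CategoryWithFibrations C] [HasFibrationPullbacks C]
  {I₀ : Type w} [PartialOrder I₀]

/-- The full inverse subcategory determined by a subset of the objects. -/
noncomputable def InverseCat.full (I : InverseCat C I₀) (S : Set I₀) : InverseCat C S where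
  obj x := I.obj x.1
  hom {x y} h := I.hom (x := x.1) (y := y.1) h
  src {x y} h := I.src (x := x.1) (y := y.1) h
  tgt {x y} h := I.tgt (x := x.1) (y := y.1) h
  fib_src {x y} h := I.fib_src (x := x.1) (y := y.1) h
  comp {x y z} h k := I.comp (x := x.1) (y := y.1) (z := z.1) h k
  comp_src {x y z} h k := I.comp_src (x := x.1) (y := y.1) (z := z.1) h k
  comp_tgt {x y z} h k := I.comp_tgt (x := x.1) (y := y.1) (z := z.1) h k
  assoc {x y z t} h k l :=
    I.assoc (x := x.1) (y := y.1) (z := z.1) (t := t.1) h k l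

/-- The full inverse subcategory on the objects strictly below `x`. -/
noncomputable abbrev InverseCat.below (I : InverseCat C I₀) (x : I₀) : InverseCat C (Set.Iio x) :=
  I.full (Set.Iio x)

/-- `X`-indexed `I`-diagrams: spans `X ← obj x → I.obj x` whose left leg is a fibration, with
associative actions `obj x ×_{I(x)} I(x,y) ⟶ obj y` over `X` and `I(y)`. -/
structure Diag (I : InverseCat C I₀) (X : C) where
  obj : I₀ → C
  base : ∀ x, obj x ⟶ X
  anchor : ∀ x, obj x ⟶ I.obj x
  [fib_base : ∀ x, Fibration (base x)]
  act : ∀ {x y : I₀} (h : y < x), pullback (anchor x) (I.src h) ⟶ obj y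
  act_base : ∀ {x y : I₀} (h : y < x),
    act h ≫ base y = pullback.fst (anchor x) (I.src h) ≫ base x
  act_anchor : ∀ {x y : I₀} (h : y < x),
    act h ≫ anchor y = pullback.snd (anchor x) (I.src h) ≫ I.tgt h
  /-- Associativity, on generalized elements of the triple pullback. -/
  act_assoc : ∀ {x y z : I₀} (h : y < x) (k : z < y) {Z : C}
    (a : Z ⟶ obj x) (b : Z ⟶ I.hom h) (c : Z ⟶ I.hom k)
    (e₁ : a ≫ anchor x = b ≫ I.src h) (e₂ : b ≫ I.tgt h = c ≫ I.src k),
    pullback.lift (pullback.lift a b e₁ ≫ act h) c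
        (by rw [Category.assoc, act_anchor, pullback.lift_snd_assoc, e₂]) ≫ act k =
      pullback.lift a (pullback.lift b c e₂ ≫ I.comp h k)
        (by rw [Category.assoc, I.comp_src, pullback.lift_fst_assoc, e₁]) ≫ act (k.trans h)

attribute [instance] Diag.fib_base

namespace Diag

variable {I : InverseCat C I₀} {X Y : C}

/-- Maps of diagrams: maps of spans commuting with the actions. -/
@[ext]
structure Hom (A B : Diag I X) where
  app : ∀ x, A.obj x ⟶ B.obj x
  app_base : ∀ x, app x ≫ B.base x = A.base x
  app_anchor : ∀ x, app x ≫ B.anchor x = A.anchor x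
  act_app : ∀ {x y : I₀} (h : y < x),
    A.act h ≫ app y =
      pullback.lift (pullback.fst (A.anchor x) (I.src h) ≫ app x)
        (pullback.snd (A.anchor x) (I.src h))
        (by rw [Category.assoc, app_anchor, pullback.condition]) ≫ B.act h

/-- The action on generalized elements. -/
noncomputable def actOn (A : Diag I X) {x y : I₀} (h : y < x) {Z : C} (a : Z ⟶ A.obj x) (b : Z ⟶ I.hom h)
    (e : a ≫ A.anchor x = b ≫ I.src h) : Z ⟶ A.obj y :=
  pullback.lift a b e ≫ A.act h

lemma comp_actOn (A : Diag I X) {x y : I₀} (h : y < x) {Z Z' : C} (f : Z' ⟶ Z)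
    (a : Z ⟶ A.obj x) (b : Z ⟶ I.hom h) (e : a ≫ A.anchor x = b ≫ I.src h) :
    f ≫ A.actOn h a b e =
      A.actOn h (f ≫ a) (f ≫ b) (by rw [Category.assoc, Category.assoc, e]) := by
  unfold actOn
  rw [← Category.assoc]
  congr 1
  ext <;> simp

lemma actOn_base (A : Diag I X) {x y : I₀} (h : y < x) {Z : C}
    (a : Z ⟶ A.obj x) (b : Z ⟶ I.hom h) (e : a ≫ A.anchor x = b ≫ I.src h) :
    A.actOn h a b e ≫ A.base y = a ≫ A.base x := by
  rw [actOn, Category.assoc, act_base, pullback.lift_fst_assoc]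

lemma actOn_anchor (A : Diag I X) {x y : I₀} (h : y < x) {Z : C}
    (a : Z ⟶ A.obj x) (b : Z ⟶ I.hom h) (e : a ≫ A.anchor x = b ≫ I.src h) :
    A.actOn h a b e ≫ A.anchor y = b ≫ I.tgt h := by
  rw [actOn, Category.assoc, act_anchor, pullback.lift_snd_assoc]

lemma actOn_app {A B : Diag I X} (f : Hom A B) {x y : I₀} (h : y < x) {Z : C}
    (a : Z ⟶ A.obj x) (b : Z ⟶ I.hom h) (e : a ≫ A.anchor x = b ≫ I.src h) :
    A.actOn h a b e ≫ f.app y =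
      B.actOn h (a ≫ f.app x) b (by rw [Category.assoc, f.app_anchor, e]) := by
  rw [actOn, actOn, Category.assoc, f.act_app, ← Category.assoc]
  congr 1
  ext <;> simp

/-- A family of maps commuting with the actions on generalized elements. -/
lemma act_app_of_actOn {A B : Diag I X} (app : ∀ x, A.obj x ⟶ B.obj x)
    (ha : ∀ x, app x ≫ B.anchor x = A.anchor x)
    (H : ∀ {x y : I₀} (h : y < x) {Z : C} (a : Z ⟶ A.obj x) (b : Z ⟶ I.hom h)
      (e : a ≫ A.anchor x = b ≫ I.src h),
      A.actOn h a b e ≫ app y =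
        B.actOn h (a ≫ app x) b (by rw [Category.assoc, ha, e]))
    {x y : I₀} (h : y < x) :
    A.act h ≫ app y =
      pullback.lift (pullback.fst (A.anchor x) (I.src h) ≫ app x)
        (pullback.snd (A.anchor x) (I.src h))
        (by rw [Category.assoc, ha, pullback.condition]) ≫ B.act h := by
  have := H h (pullback.fst (A.anchor x) (I.src h)) (pullback.snd (A.anchor x) (I.src h))
    pullback.condition
  rw [← actOn, ← this, actOn]
  congr 1
  have : pullback.lift (pullback.fst (A.anchor x) (I.src h)) (pullback.snd _ _)
      pullback.condition = 𝟙 _ := by ext <;> simp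
  rw [this, Category.id_comp]

/-- The identity map. -/
def Hom.id (A : Diag I X) : Hom A A where
  app x := 𝟙 (A.obj x)
  app_base x := Category.id_comp _
  app_anchor x := Category.id_comp _
  act_app := act_app_of_actOn (fun x => 𝟙 (A.obj x)) (fun x => Category.id_comp _)
    (fun h Z a b e => by simp)

/-- Composition of maps. -/
def Hom.comp {A B E : Diag I X} (f : Hom A B) (g : Hom B E) : Hom A E where
  app x := f.app x ≫ g.app x
  app_base x := by rw [Category.assoc, g.app_base, f.app_base]
  app_anchor x := by rw [Category.assoc, g.app_anchor, f.app_anchor]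
  act_app := act_app_of_actOn (fun x => f.app x ≫ g.app x)
    (fun x => by rw [Category.assoc, g.app_anchor, f.app_anchor])
    (fun h Z a b e => by
      rw [← Category.assoc, actOn_app, actOn_app]
      simp only [Category.assoc])

instance : Category (Diag I X) where
  Hom := Hom
  id := Hom.id
  comp := Hom.comp
  id_comp f := by apply Hom.ext; funext x; exact Category.id_comp _
  comp_id f := by apply Hom.ext; funext x; exact Category.comp_id _
  assoc f g h := by apply Hom.ext; funext x; exact Category.assoc _ _ _

@[ext]
lemma hom_ext {A B : Diag I X} {f g : A ⟶ B} (h : ∀ x, f.app x = g.app x) : f = g :=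
  Hom.ext (funext h)

@[simp]
lemma id_app (A : Diag I X) (x : I₀) : Hom.app (𝟙 A) x = 𝟙 (A.obj x) := rfl

@[simp]
lemma comp_app {A B E : Diag I X} (f : A ⟶ B) (g : B ⟶ E) (x : I₀) :
    Hom.app (f ≫ g) x = f.app x ≫ g.app x := rfl

/-- Restriction to a full subcategory. -/
noncomputable def restrict (A : Diag I X) (S : Set I₀) : Diag (I.full S) X where
  obj x := A.obj x.1
  base x := A.base x.1
  anchor x := A.anchor x.1
  fib_base x := A.fib_base x.1
  act {x y} h := A.act (x := x.1) (y := y.1) h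
  act_base {x y} h := A.act_base (x := x.1) (y := y.1) h
  act_anchor {x y} h := A.act_anchor (x := x.1) (y := y.1) h
  act_assoc {x y z} h k := A.act_assoc (x := x.1) (y := y.1) (z := z.1) h k

/-- Restriction of maps. -/
noncomputable def restrictMap {A B : Diag I X} (f : A ⟶ B) (S : Set I₀) : A.restrict S ⟶ B.restrict S :=
  { app := fun x => f.app x.1
    app_base := fun x => f.app_base x.1
    app_anchor := fun x => f.app_anchor x.1
    act_app := fun {x y} h => f.act_app (x := x.1) (y := y.1) h }

/-- Reindexing along `p : Y ⟶ X`, by pullback of `A.obj x ⟶ X`. -/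
noncomputable def reindex (p : Y ⟶ X) (A : Diag I X) : Diag I Y where
  obj x := pullback p (A.base x)
  base x := pullback.fst p (A.base x)
  anchor x := pullback.snd p (A.base x) ≫ A.anchor x
  act {x y} h := pullback.lift (pullback.fst _ _ ≫ pullback.fst _ _)
    (A.actOn h (pullback.fst _ _ ≫ pullback.snd _ _) (pullback.snd _ _)
      (by rw [Category.assoc, pullback.condition]))
    (by rw [actOn_base, Category.assoc, Category.assoc, pullback.condition])
  act_base h := by rw [pullback.lift_fst]
  act_anchor h := by rw [pullback.lift_snd_assoc, actOn_anchor]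
  act_assoc {x y z} h k Z a b c e₁ e₂ := by
    have key := A.act_assoc h k (a ≫ pullback.snd _ _) b c (by simpa using e₁) e₂
    ext
    · simp
    · simp only [Category.assoc, pullback.lift_snd, comp_actOn, pullback.lift_fst_assoc]
      simpa only [actOn] using key

/-- The projection `p^* A ⟶ A`. -/
noncomputable def reindexSnd (p : Y ⟶ X) (A : Diag I X) (x : I₀) :
    (A.reindex p).obj x ⟶ A.obj x :=
  pullback.snd p (A.base x)

lemma reindex_condition (p : Y ⟶ X) (A : Diag I X) (x : I₀) :
    (A.reindex p).base x ≫ p = A.reindexSnd p x ≫ A.base x :=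
  pullback.condition

lemma reindex_anchor (p : Y ⟶ X) (A : Diag I X) (x : I₀) :
    (A.reindex p).anchor x = A.reindexSnd p x ≫ A.anchor x := rfl

/-- Maps into `p^* A`. -/
noncomputable def reindexLift (p : Y ⟶ X) (A : Diag I X) {x : I₀} {Z : C} (a : Z ⟶ Y)
    (b : Z ⟶ A.obj x) (e : a ≫ p = b ≫ A.base x) : Z ⟶ (A.reindex p).obj x :=
  pullback.lift a b e

lemma reindexLift_base (p : Y ⟶ X) (A : Diag I X) {x : I₀} {Z : C} (a : Z ⟶ Y)
    (b : Z ⟶ A.obj x) (e : a ≫ p = b ≫ A.base x) :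
    A.reindexLift p a b e ≫ (A.reindex p).base x = a :=
  pullback.lift_fst _ _ _

lemma reindexLift_snd (p : Y ⟶ X) (A : Diag I X) {x : I₀} {Z : C} (a : Z ⟶ Y)
    (b : Z ⟶ A.obj x) (e : a ≫ p = b ≫ A.base x) :
    A.reindexLift p a b e ≫ A.reindexSnd p x = b :=
  pullback.lift_snd _ _ _

lemma reindex_obj_ext (p : Y ⟶ X) (A : Diag I X) {x : I₀} {Z : C}
    {a b : Z ⟶ (A.reindex p).obj x}
    (h₁ : a ≫ (A.reindex p).base x = b ≫ (A.reindex p).base x)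
    (h₂ : a ≫ A.reindexSnd p x = b ≫ A.reindexSnd p x) : a = b :=
  pullback.hom_ext h₁ h₂

lemma reindex_actOn_snd (p : Y ⟶ X) (A : Diag I X) {x y : I₀} (h : y < x) {Z : C}
    (a : Z ⟶ (A.reindex p).obj x) (b : Z ⟶ I.hom h)
    (e : a ≫ (A.reindex p).anchor x = b ≫ I.src h) :
    (A.reindex p).actOn h a b e ≫ A.reindexSnd p y =
      A.actOn h (a ≫ A.reindexSnd p x) b (by rw [Category.assoc, ← reindex_anchor, e]) := by
  unfold actOn reindexSnd reindex
  dsimp only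
  rw [Category.assoc, pullback.lift_snd, comp_actOn, actOn]
  congr 1
  ext
  · simp only [pullback.lift_fst]
    exact pullback.lift_fst_assoc _ _ _ _
  · simp only [pullback.lift_snd]
    exact pullback.lift_snd _ _ _

/-- The reindexing of a map `p^* A ⟶ q^* B` along `f`, as a map `p'^* A ⟶ q'^* B` where
`p' = f ≫ p` and `q' = f ≫ q`. -/
noncomputable def pull {A : Diag I X} {B : Diag I Y} {Z W : C} {p : Z ⟶ X} {q : Z ⟶ Y}
    (φ : A.reindex p ⟶ B.reindex q) (f : W ⟶ Z) {p' : W ⟶ X} {q' : W ⟶ Y}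
    (hp : p' = f ≫ p) (hq : q' = f ≫ q) : A.reindex p' ⟶ B.reindex q' :=
  have h₁ : ∀ x, ((A.reindex p').base x ≫ f) ≫ p = A.reindexSnd p' x ≫ A.base x := fun x => by
    rw [Category.assoc, ← hp, reindex_condition]
  have h₂ : ∀ x, (A.reindex p').base x ≫ q' =
      (A.reindexLift p ((A.reindex p').base x ≫ f) (A.reindexSnd p' x) (h₁ x) ≫
        φ.app x ≫ B.reindexSnd q x) ≫ B.base x := fun x => by
    rw [Category.assoc, Category.assoc, ← reindex_condition, reassoc_of% φ.app_base x,
      ← Category.assoc, reindexLift_base, Category.assoc, hq]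
  have h₃ : ∀ x, B.reindexLift q' ((A.reindex p').base x)
      (A.reindexLift p ((A.reindex p').base x ≫ f) (A.reindexSnd p' x) (h₁ x) ≫
        φ.app x ≫ B.reindexSnd q x) (h₂ x) ≫ (B.reindex q').anchor x =
      (A.reindex p').anchor x := fun x => by
    rw [reindex_anchor, ← Category.assoc, reindexLift_snd, Category.assoc, Category.assoc,
      ← reindex_anchor, φ.app_anchor, reindex_anchor, ← Category.assoc, reindexLift_snd,
      reindex_anchor]
  { app := fun x => B.reindexLift q' ((A.reindex p').base x)
      (A.reindexLift p ((A.reindex p').base x ≫ f) (A.reindexSnd p' x) (h₁ x) ≫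
        φ.app x ≫ B.reindexSnd q x) (h₂ x)
    app_base := fun x => reindexLift_base _ _ _ _ _
    app_anchor := h₃
    act_app := act_app_of_actOn _ h₃ (fun {x y} h Z a b e => by
      apply reindex_obj_ext
      · rw [Category.assoc, reindexLift_base, actOn_base, actOn_base, Category.assoc,
          reindexLift_base]
      · rw [Category.assoc, reindexLift_snd, reindex_actOn_snd, ← Category.assoc]
        have key : (A.reindex p').actOn h a b e ≫
            A.reindexLift p ((A.reindex p').base y ≫ f) (A.reindexSnd p' y) (h₁ y) =
            (A.reindex p).actOn h
              (a ≫ A.reindexLift p ((A.reindex p').base x ≫ f) (A.reindexSnd p' x) (h₁ x)) b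
              (by
                rw [reindex_anchor, Category.assoc, ← Category.assoc (A.reindexLift _ _ _ _),
                  reindexLift_snd, ← reindex_anchor, e]) := by
          apply reindex_obj_ext
          · rw [Category.assoc, reindexLift_base, ← Category.assoc, actOn_base, actOn_base,
              Category.assoc, Category.assoc, reindexLift_base]
          · rw [Category.assoc, reindexLift_snd, reindex_actOn_snd, reindex_actOn_snd]
            congr 1
            rw [Category.assoc, reindexLift_snd]
        rw [key, ← Category.assoc, actOn_app, reindex_actOn_snd]
        congr 1
        rw [Category.assoc, Category.assoc, Category.assoc, reindexLift_snd]) }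

lemma pull_app_snd {A : Diag I X} {B : Diag I Y} {Z W : C} {p : Z ⟶ X} {q : Z ⟶ Y}
    (φ : A.reindex p ⟶ B.reindex q) (f : W ⟶ Z) {p' : W ⟶ X} {q' : W ⟶ Y}
    (hp : p' = f ≫ p) (hq : q' = f ≫ q) (x : I₀) :
    (pull φ f hp hq).app x ≫ B.reindexSnd q' x =
      A.reindexLift p ((A.reindex p').base x ≫ f) (A.reindexSnd p' x)
        (by rw [Category.assoc, ← hp, reindex_condition]) ≫ φ.app x ≫ B.reindexSnd q x :=
  reindexLift_snd _ _ _ _ _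

lemma reindex_hom_ext {A : Diag I X} {B : Diag I Y} {Z : C} {p : Z ⟶ X} {q : Z ⟶ Y}
    {φ ψ : A.reindex p ⟶ B.reindex q}
    (h : ∀ x, φ.app x ≫ B.reindexSnd q x = ψ.app x ≫ B.reindexSnd q x) : φ = ψ := by
  apply hom_ext
  intro x
  apply reindex_obj_ext
  · rw [φ.app_base, ψ.app_base]
  · exact h x

lemma pull_id {A : Diag I X} {B : Diag I Y} {Z : C} {p : Z ⟶ X} {q : Z ⟶ Y}
    (φ : A.reindex p ⟶ B.reindex q) {f : Z ⟶ Z} (hf : f = 𝟙 Z) (hp : p = f ≫ p)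
    (hq : q = f ≫ q) : pull φ f hp hq = φ := by
  refine reindex_hom_ext fun x => ?_
  rw [pull_app_snd, ← Category.assoc]
  congr 1
  refine Eq.trans ?_ (Category.id_comp _)
  congr 1
  apply reindex_obj_ext
  · rw [reindexLift_base, Category.id_comp, hf, Category.comp_id]
  · rw [reindexLift_snd, Category.id_comp]

lemma pull_pull {A : Diag I X} {B : Diag I Y} {Z W V : C} {p : Z ⟶ X} {q : Z ⟶ Y}
    (φ : A.reindex p ⟶ B.reindex q) (f : W ⟶ Z) {p' : W ⟶ X} {q' : W ⟶ Y}
    (hp : p' = f ≫ p) (hq : q' = f ≫ q) (g : V ⟶ W) {p'' : V ⟶ X} {q'' : V ⟶ Y}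
    (hp' : p'' = g ≫ p') (hq' : q'' = g ≫ q') {k : V ⟶ Z} (hk : k = g ≫ f)
    (hp'' : p'' = k ≫ p) (hq'' : q'' = k ≫ q) :
    pull φ k hp'' hq'' = pull (pull φ f hp hq) g hp' hq' := by
  subst hk
  refine reindex_hom_ext fun x => ?_
  rw [pull_app_snd, pull_app_snd, pull_app_snd, ← Category.assoc (A.reindexLift p' _ _ _)]
  congr 1
  apply reindex_obj_ext
  · rw [reindexLift_base, Category.assoc, reindexLift_base, ← Category.assoc (A.reindexLift _ _ _ _),
      reindexLift_base, Category.assoc]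
  · rw [reindexLift_snd, Category.assoc, reindexLift_snd, reindexLift_snd]

/-- The presheaf `((p, q) : Z ⟶ X × Y) ↦ Hom (p^* A, q^* B)` on `C / (X × Y)`. -/
noncomputable def homPresheaf (A : Diag I X) (B : Diag I Y) :
    (Over (X ⨯ Y))ᵒᵖ ⥤ Type (max w v) where
  obj Z := A.reindex (Z.unop.hom ≫ prod.fst) ⟶ B.reindex (Z.unop.hom ≫ prod.snd)
  map f := TypeCat.ofHom fun φ => pull φ f.unop.left
    (over_hom_comp f.unop _) (over_hom_comp f.unop _)
  map_id Z := ConcreteCategory.hom_ext _ _ fun φ =>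
    pull_id φ rfl (over_hom_comp (𝟙 Z.unop) _) (over_hom_comp (𝟙 Z.unop) _)
  map_comp f g := ConcreteCategory.hom_ext _ _ fun φ =>
    pull_pull φ _ (over_hom_comp f.unop _) (over_hom_comp f.unop _) _
      (over_hom_comp g.unop _) (over_hom_comp g.unop _) rfl
      (over_hom_comp (g.unop ≫ f.unop) _) (over_hom_comp (g.unop ≫ f.unop) _)

/-- `H ⟶ X × Y` is the hom-object of `A` and `B` if it represents `homPresheaf A B`. -/
abbrev HomObj (A : Diag I X) (B : Diag I Y) (H : Over (X ⨯ Y)) : Type _ :=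
  (homPresheaf A B).RepresentableBy H

/-- Functoriality of reindexing on maps of diagrams. -/
noncomputable def reindexMap (q : X ⟶ Y) {B B' : Diag I Y} (g : B ⟶ B') :
    B.reindex q ⟶ B'.reindex q :=
  have h₁ : ∀ x, (B.reindex q).base x ≫ q = (B.reindexSnd q x ≫ g.app x) ≫ B'.base x :=
    fun x => by rw [Category.assoc, g.app_base, reindex_condition]
  have h₂ : ∀ x, B'.reindexLift q ((B.reindex q).base x) (B.reindexSnd q x ≫ g.app x) (h₁ x) ≫
      (B'.reindex q).anchor x = (B.reindex q).anchor x := fun x => by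
    rw [reindex_anchor, ← Category.assoc, reindexLift_snd, Category.assoc, g.app_anchor,
      reindex_anchor]
  { app := fun x => B'.reindexLift q ((B.reindex q).base x) (B.reindexSnd q x ≫ g.app x) (h₁ x)
    app_base := fun x => reindexLift_base _ _ _ _ _
    app_anchor := h₂
    act_app := act_app_of_actOn _ h₂ (fun {x y} h Z a b e => by
      apply reindex_obj_ext
      · rw [Category.assoc, reindexLift_base, actOn_base, actOn_base, Category.assoc,
          reindexLift_base]
      · rw [Category.assoc, reindexLift_snd, ← Category.assoc, reindex_actOn_snd,
          reindex_actOn_snd, actOn_app]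
        congr 1
        rw [Category.assoc, Category.assoc, reindexLift_snd]) }

/-- The map of hom-objects `Hom (A, B) ⟶ Hom (A, B')` over `X × Y` induced by `g : B ⟶ B'`:
it represents postcomposition with `g`. -/
noncomputable def homObjMap {A : Diag I X} {B B' : Diag I Y} (g : B ⟶ B') {H H' : Over (X ⨯ Y)}
    (r : HomObj A B H) (r' : HomObj A B' H') : H ⟶ H' :=
  r'.homEquiv.symm
    ((r.homEquiv (𝟙 H) : A.reindex (H.hom ≫ prod.fst) ⟶ B.reindex (H.hom ≫ prod.snd)) ≫
      reindexMap (H.hom ≫ prod.snd) g)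

end Diag

/-- The diagram `I(x, -)` on the objects strictly below `x`, indexed by `I(x)`. -/
noncomputable def InverseCat.rep (I : InverseCat C I₀) (x : I₀) :
    Diag (I.below x) (I.obj x) where
  obj y := I.hom y.2
  base y := I.src y.2
  anchor y := I.tgt y.2
  fib_base y := I.fib_src y.2
  act {y z} h := I.comp y.2 (show z.1 < y.1 from h)
  act_base {y z} h := I.comp_src y.2 (show z.1 < y.1 from h)
  act_anchor {y z} h := I.comp_tgt y.2 (show z.1 < y.1 from h)
  act_assoc {y z t} h k := I.assoc y.2 (show z.1 < y.1 from h) (show t.1 < z.1 from k)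

namespace Diag

variable {I : InverseCat C I₀} {X : C}

/-- The matching object of `A` at `x`: a hom-object from `I(x, -)` to the restriction of `A` to
the objects strictly below `x`. -/
abbrev MatchingObj (A : Diag I X) (x : I₀) (M : Over (I.obj x ⨯ X)) : Type _ :=
  HomObj (I.rep x) (A.restrict (Set.Iio x)) M

/-- The `y`-component `A_x ×_{I(x)} I(x,y) ⟶ A_y` of the action, for `y < x`. -/
noncomputable def actHomApp (A : Diag I X) (x : I₀) {p : A.obj x ⟶ I.obj x}
    (hp : p = A.anchor x) (y : Set.Iio x) :
    ((I.rep x).reindex p).obj y ⟶ (A.restrict (Set.Iio x)).obj y :=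
  A.actOn (Set.mem_Iio.1 y.2) (((I.rep x).reindex p).base y) ((I.rep x).reindexSnd p y)
    (by rw [← hp]; exact reindex_condition p (I.rep x) y)

lemma actHomApp_base (A : Diag I X) (x : I₀) {p : A.obj x ⟶ I.obj x}
    (hp : p = A.anchor x) (y : Set.Iio x) :
    A.actHomApp x hp y ≫ (A.restrict (Set.Iio x)).base y =
      ((I.rep x).reindex p).base y ≫ A.base x :=
  A.actOn_base _ _ _ _

lemma actHomApp_anchor (A : Diag I X) (x : I₀) {p : A.obj x ⟶ I.obj x}
    (hp : p = A.anchor x) (y : Set.Iio x) :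
    A.actHomApp x hp y ≫ (A.restrict (Set.Iio x)).anchor y =
      ((I.rep x).reindex p).anchor y :=
  A.actOn_anchor _ _ _ _

lemma actOn_congr (A : Diag I X) {x y : I₀} (h : y < x) {Z : C} {a a' : Z ⟶ A.obj x}
    {b b' : Z ⟶ I.hom h} (e : a ≫ A.anchor x = b ≫ I.src h) (ha : a = a') (hb : b = b') :
    A.actOn h a b e = A.actOn h a' b' (by rw [← ha, ← hb, e]) := by
  subst ha hb; rfl

lemma actHomApp_act (A : Diag I X) (x : I₀) {p : A.obj x ⟶ I.obj x}
    (hp : p = A.anchor x) {y z : Set.Iio x} (h : z < y) {Z : C}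
    (a : Z ⟶ ((I.rep x).reindex p).obj y) (b : Z ⟶ (I.below x).hom h)
    (e : a ≫ ((I.rep x).reindex p).anchor y = b ≫ (I.below x).src h) :
    ((I.rep x).reindex p).actOn h a b e ≫ A.actHomApp x hp z =
      (A.restrict (Set.Iio x)).actOn h (a ≫ A.actHomApp x hp y) b
        (by rw [Category.assoc, actHomApp_anchor, e]) := by
  have hc : a ≫ ((I.rep x).reindex p).base y ≫ A.anchor x =
      a ≫ (I.rep x).reindexSnd p y ≫ I.src (Set.mem_Iio.1 y.2) := by
    rw [← hp]; exact congrArg (a ≫ ·) (reindex_condition p (I.rep x) y)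
  have key := A.act_assoc (Set.mem_Iio.1 y.2) (show z.1 < y.1 from h)
    (a ≫ ((I.rep x).reindex p).base y) (a ≫ (I.rep x).reindexSnd p y) b
    (by rw [Category.assoc]; exact hc.trans (Category.assoc _ _ _).symm)
    ((Category.assoc _ _ _).trans e)
  refine ((A.comp_actOn _ _ _ _ _).trans ?_).trans (key.symm.trans ?_)
  · exact A.actOn_congr _ _ (actOn_base _ _ _ _ _) (reindex_actOn_snd _ _ _ _ _ _)
  · exact (A.actOn_congr (show z.1 < y.1 from h) _ (A.comp_actOn _ _ _ _ _) rfl).symm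

/-- The actions assembled into a map from the reindexing of `I(x, -)` along `A_x ⟶ I(x)` to the
reindexing of `A` along `A_x ⟶ X`. -/
noncomputable def actHom (A : Diag I X) (x : I₀) {p : A.obj x ⟶ I.obj x} {q : A.obj x ⟶ X}
    (hp : p = A.anchor x) (hq : q = A.base x) :
    (I.rep x).reindex p ⟶ (A.restrict (Set.Iio x)).reindex q :=
  have h₂ : ∀ y : Set.Iio x, ((I.rep x).reindex p).base y ≫ q =
      A.actHomApp x hp y ≫ (A.restrict (Set.Iio x)).base y :=
    fun y => by rw [actHomApp_base, hq]
  have h₃ : ∀ y : Set.Iio x, (A.restrict (Set.Iio x)).reindexLift q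
      (((I.rep x).reindex p).base y) (A.actHomApp x hp y) (h₂ y) ≫
        ((A.restrict (Set.Iio x)).reindex q).anchor y = ((I.rep x).reindex p).anchor y :=
    fun y => by
      rw [reindex_anchor, ← Category.assoc, reindexLift_snd, actHomApp_anchor]
  { app := fun y => (A.restrict (Set.Iio x)).reindexLift q (((I.rep x).reindex p).base y)
      (A.actHomApp x hp y) (h₂ y)
    app_base := fun y => reindexLift_base _ _ _ _ _
    app_anchor := h₃
    act_app := act_app_of_actOn _ h₃ (fun {y z} h Z a b e => by
      apply reindex_obj_ext
      · rw [Category.assoc, reindexLift_base, actOn_base, actOn_base, Category.assoc,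
          reindexLift_base]
      · rw [Category.assoc, reindexLift_snd, reindex_actOn_snd, actHomApp_act]
        congr 1
        rw [Category.assoc, reindexLift_snd]) }

/-- The canonical map `A_x ⟶ M_x A`. -/
noncomputable def toMatching (A : Diag I X) (x : I₀) {M : Over (I.obj x ⨯ X)}
    (r : MatchingObj A x M) : A.obj x ⟶ M.left :=
  let φ : (homPresheaf (I.rep x) (A.restrict (Set.Iio x))).obj
      (op (Over.mk (prod.lift (A.anchor x) (A.base x)))) :=
    A.actHom x (prod.lift_fst (A.anchor x) (A.base x)) (prod.lift_snd (A.anchor x) (A.base x))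
  (r.homEquiv.symm φ).left

/-- Reedy fibrant diagrams. -/
def IsReedyFibrant (A : Diag I X) : Prop :=
  ∀ x : I₀, ∃ (M : Over (I.obj x ⨯ X)) (r : MatchingObj A x M), Fibration (A.toMatching x r)

/-- The map of matching objects `M_x A ⟶ M_x B`. -/
noncomputable def matchingMap {A B : Diag I X} (f : A ⟶ B) (x : I₀)
    {M N : Over (I.obj x ⨯ X)} (r : MatchingObj A x M) (s : MatchingObj B x N) :
    M.left ⟶ N.left :=
  (homObjMap (restrictMap f (Set.Iio x)) r s).left

/-- Reedy fibrations: the matching objects and the pullback `M_x A ×_{M_x B} B_x` exist, and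
`A_x ⟶ M_x A ×_{M_x B} B_x` is a fibration. -/
def IsReedyFibration {A B : Diag I X} (f : A ⟶ B) : Prop :=
  ∀ x : I₀, ∃ (M N : Over (I.obj x ⨯ X)) (r : MatchingObj A x M) (s : MatchingObj B x N)
    (P : C) (l : P ⟶ M.left) (t : P ⟶ B.obj x)
    (_ : IsPullback l t (matchingMap f x r s) (B.toMatching x s)) (k : A.obj x ⟶ P),
    k ≫ l = A.toMatching x r ∧ k ≫ t = f.app x ∧ Fibration k

end Diag

/-- An inverse category is fibrant if each `I(x)` is fibrant and each `I(x, -)` is Reedy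
fibrant. -/
def InverseCat.IsFibrant (I : InverseCat C I₀) : Prop :=
  ∀ x : I₀, IsFibrantObj (I.obj x) ∧ (I.rep x).IsReedyFibrant

/-- The category of Reedy fibrant `X`-indexed `I`-diagrams. -/
abbrev ReedyFib (I : InverseCat C I₀) (X : C) :=
  ObjectProperty.FullSubcategory (fun A : Diag I X => A.IsReedyFibrant)

/-- Its fibrations are the Reedy fibrations. -/
instance (I : InverseCat C I₀) (X : C) : CategoryWithFibrations (ReedyFib I X) :=
  ⟨fun _ _ f => Diag.IsReedyFibration f.hom⟩

/-- The poset of objects is admissible: the self-indexing has Reedy limits of shape the opposite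
of each strict initial segment (over every base object `Z`). -/
def InverseCat.IsAdmissible (_ : InverseCat C I₀) : Prop :=
  ∀ (x : I₀) (Z : C), HasReedyLimits (Set.Iio x) (FibOver Z)

/-- `M` is (a choice of) the matching functor at `x`, sending a Reedy fibrant diagram `A` on the
objects strictly below `x` to the hom-object `M_x A = Hom (I(x, -), A) ⟶ I(x) × 1`. -/
def InverseCat.IsMatchingFunctor (I : InverseCat C I₀) (x : I₀)
    (M : ReedyFib (I.below x) (⊤_ C) ⥤ FibOver (I.obj x ⨯ ⊤_ C)) : Prop :=
  ∃ r : ∀ A, Diag.HomObj (I.rep x) A.obj (M.obj A).obj,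
    ∀ {A B : ReedyFib (I.below x) (⊤_ C)} (f : A ⟶ B),
      (M.map f).hom = Diag.homObjMap f.hom (r A) (r B)

end Diagrams

attribute [local simp] prod.lift_fst prod.lift_snd prod.lift_fst_assoc prod.lift_snd_assoc
attribute [instance 2000] IsTypeTheoreticFibrationCategory.toHasFibrationPullbacks

/-! ## Homotopy theory in a fibration category -/

section Acyclic

variable {D : Type u} [Category.{v} D] [CategoryWithFibrations D]

/-! A map of diagrams `p^*A ⟶ q^*B` can be built one object at a time. Once its components at all `y
< z` are known, the action on `A_z` turns them into a family `I(z, -) ⟶ B`, that is, a map from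
`p^*A_z` to the matching object `M_z B`, and a component at `z` compatible with them is exactly a
lift of that map along `B_z ⟶ M_z B` (`Fam.exists_extend`). Hence the object of families on `{y | y
≤ z}` lies over the object of families on `{y | y < z}` as the dependent product of a base change of
`B_z ⟶ M_z B` (`FamRep.exists_rep_of_isRelPi`), and the projection is a fibration when `B` is Reedy
fibrant. A family on `{y | y < z}` is in turn a compatible system of families on the sets `{t | t ≤
y}` with `y < z`, so the object of such families is the limit of a Reedy fibrant diagram, and
admissibility provides it. Well-founded induction yields all stages (`exists_stage`), and one more
Reedy limit yields the hom-object. Matching objects are the special case `A = I(x, -)`; to treat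
everything uniformly, partial maps (`Fam`) and their representing objects (`FamRep`) are defined for
an arbitrary set of objects and are compared with hom-objects afterwards. Reedy limits are taken
among fibrations over `X ⨯ Y` while a hom-object must represent maps from every object over `X ⨯ Y`;
`FibOver.isLimit_over` bridges this gap.

The effect of `g : B ⟶ B'` is controlled by the gap maps `B_z ⟶ M_z B ×_{M_z B'} B'_z`. The gap map
between two stages is again a relative dependent product, of the gap map of `g`
(`IsRelPi.exists_gap`). So Reedy fibrations induce fibrations, and function extensionality with
right properness carries homotopy equivalences through the induction. If `g` is a levelwise homotopy
equivalence, its gap maps are homotopy equivalences by a further induction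
(`hasGap_of_isHomotopyEquiv`).

A homotopy equivalence of Reedy fibrant diagrams is levelwise one because evaluation at `x`, valued
in objects over `I(x) × Y`, has a right adjoint, the cofree diagram, which takes fibrations to Reedy
fibrations. Evaluation therefore preserves acyclic cofibrations (`isAcyclicCofibration_app`), and
with them homotopies. Finally, pullbacks of Reedy fibrations are computed levelwise and the terminal
diagram is `z ↦ I(z) × Y`, so that matching functors preserve both. -/

lemma IsAcyclicCofibration.exists_lift {A B X Y : D} {i : A ⟶ B} (hi : IsAcyclicCofibration i)
    {p : X ⟶ Y} (hp : Fibration p) (f : A ⟶ X) (g : B ⟶ Y) (sq : f ≫ p = i ≫ g) :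
    ∃ l : B ⟶ X, i ≫ l = f ∧ l ≫ p = g := by
  have := hi p hp.mem
  have s : CommSq f i p g := ⟨sq⟩
  exact ⟨s.lift, s.fac_left, s.fac_right⟩

lemma IsAcyclicCofibration.of_exists_lift {A B : D} {i : A ⟶ B}
    (H : ∀ {X Y : D} (p : X ⟶ Y), Fibration p → ∀ (f : A ⟶ X) (g : B ⟶ Y), f ≫ p = i ≫ g →
      ∃ l : B ⟶ X, i ≫ l = f ∧ l ≫ p = g) : IsAcyclicCofibration i := fun _ _ p hp =>
  ⟨fun {f g} sq => by
    obtain ⟨l, h₁, h₂⟩ := H p ⟨hp⟩ f g sq.w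
    exact ⟨⟨⟨l, h₁, h₂⟩⟩⟩⟩

lemma IsAcyclicCofibration.comp {A B E : D} {i : A ⟶ B} {j : B ⟶ E}
    (hi : IsAcyclicCofibration i) (hj : IsAcyclicCofibration j) :
    IsAcyclicCofibration (i ≫ j) :=
  .of_exists_lift fun p hp f g sq => by
    obtain ⟨l, h₁, h₂⟩ := hi.exists_lift hp f (j ≫ g) (by rw [sq, Category.assoc])
    obtain ⟨m, h₃, h₄⟩ := hj.exists_lift hp l g h₂
    exact ⟨m, by rw [Category.assoc, h₃, h₁], h₄⟩

end Acyclic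

/-- Categories with fibrations in which maps factor as acyclic cofibrations followed by
fibrations, and acyclic cofibrations are stable under pullback along fibrations. -/
class FibrationCategory (D : Type u) [Category.{v} D] [CategoryWithFibrations D] : Prop
    extends HasFibrationPullbacks D where
  factorization : ∀ {X Y : D} (f : X ⟶ Y),
    ∃ (W : D) (i : X ⟶ W) (p : W ⟶ Y), IsAcyclicCofibration i ∧ Fibration p ∧ i ≫ p = f
  acyclicCofibration_pullback : ∀ {P X Y Z : D} {t : P ⟶ Y} {l : P ⟶ X} {g : Y ⟶ Z} {f : X ⟶ Z},
    IsPullback t l g f → Fibration g → IsAcyclicCofibration f → IsAcyclicCofibration t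

/-! ### Closure properties of fibrations. -/

section Pullbacks

variable {D : Type u} [Category.{v} D] [CategoryWithFibrations D] [HasFibrationPullbacks D]

lemma fibration_of_iso {X Y : D} (f : X ⟶ Y) [IsIso f] : Fibration f :=
  HasFibrationPullbacks.fibration_of_isIso f inferInstance

lemma fibration_comp {X Y Z : D} {f : X ⟶ Y} {g : Y ⟶ Z} (hf : Fibration f) (hg : Fibration g) :
    Fibration (f ≫ g) :=
  HasFibrationPullbacks.fibration_comp f g hf hg

lemma fibration_to_terminal (X : D) : Fibration (terminal.from X) :=
  HasFibrationPullbacks.fibration_terminal _ ⟨terminalIsTerminal⟩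

lemma fibration_of_isPullback {P X Y Z : D} {t : P ⟶ Y} {l : P ⟶ X} {g : Y ⟶ Z} {f : X ⟶ Z}
    (h : IsPullback t l g f) (hg : Fibration g) : Fibration l :=
  HasFibrationPullbacks.fibration_pullback h hg

instance fibration_pullback_snd {X Y Z : D} (f : X ⟶ Z) (g : Y ⟶ Z) [h : Fibration f] :
    Fibration (pullback.snd f g) :=
  fibration_of_isPullback (IsPullback.of_hasPullback f g) h

lemma fibration_of_arrow_iso {X Y X' Y' : D} {f : X ⟶ Y} {f' : X' ⟶ Y'} (hf : Fibration f)
    (a : X' ⟶ X) (b : Y' ⟶ Y) [IsIso a] [IsIso b] (h : a ≫ f = f' ≫ b) : Fibration f' := by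
  have : f' = a ≫ f ≫ inv b := by rw [← Category.assoc, h, Category.assoc, IsIso.hom_inv_id,
    Category.comp_id]
  rw [this]
  exact fibration_comp (fibration_of_iso a) (fibration_comp hf (fibration_of_iso _))

instance fibration_prod_fst (X Y : D) : Fibration (prod.fst : X ⨯ Y ⟶ X) := by
  have h : IsPullback (prod.snd : X ⨯ Y ⟶ Y) prod.fst (terminal.from Y) (terminal.from X) :=
    ⟨⟨Subsingleton.elim _ _⟩, ⟨PullbackCone.IsLimit.mk _ (fun s => prod.lift s.snd s.fst)
      (by simp) (by simp) (fun s m h₁ h₂ => by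
        apply Limits.prod.hom_ext <;> simp [h₁, h₂])⟩⟩
  exact fibration_of_isPullback h (fibration_to_terminal Y)

instance fibration_prod_snd (X Y : D) : Fibration (prod.snd : X ⨯ Y ⟶ Y) := by
  have h : IsPullback (prod.fst : X ⨯ Y ⟶ X) prod.snd (terminal.from X) (terminal.from Y) :=
    ⟨⟨Subsingleton.elim _ _⟩, ⟨PullbackCone.IsLimit.mk _ (fun s => prod.lift s.fst s.snd)
      (by simp) (by simp) (fun s m h₁ h₂ => by
        apply Limits.prod.hom_ext <;> simp [h₁, h₂])⟩⟩
  exact fibration_of_isPullback h (fibration_to_terminal X)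

lemma fibration_lift_fst {P X Y : D} {a : P ⟶ X} {b : P ⟶ Y} (h : Fibration (prod.lift a b)) :
    Fibration a := by
  rw [← prod.lift_fst a b]
  exact fibration_comp h inferInstance

lemma fibration_lift_snd {P X Y : D} {a : P ⟶ X} {b : P ⟶ Y} (h : Fibration (prod.lift a b)) :
    Fibration b := by
  rw [← prod.lift_snd a b]
  exact fibration_comp h inferInstance

end Pullbacks

/-! ### Homotopies, acyclic fibrations and right properness. -/

section Homotopy

set_option linter.unusedSectionVars false

variable {D : Type u} [Category.{v} D] [CategoryWithFibrations D] [FibrationCategory D]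

lemma exists_pathObj (B : D) : Nonempty (PathObj B) := by
  obtain ⟨P, i, p, hi, hp, e⟩ := FibrationCategory.factorization (prod.lift (𝟙 B) (𝟙 B))
  refine ⟨⟨P, i, p ≫ prod.fst, p ≫ prod.snd, by rw [reassoc_of% e, prod.lift_fst],
    by rw [reassoc_of% e, prod.lift_snd], hi, ⟨_, prodIsProd B B, ?_⟩⟩⟩
  have : (prodIsProd B B).lift (BinaryFan.mk (p ≫ prod.fst) (p ≫ prod.snd)) = p :=
    BinaryFan.IsLimit.hom_ext (prodIsProd B B) ((prodIsProd B B).fac _ ⟨WalkingPair.left⟩)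
      ((prodIsProd B B).fac _ ⟨WalkingPair.right⟩)
  rw [this]
  exact hp

/-- A path object only supplies some product cone; the comparison isomorphism moves its fibration to
the chosen product. -/
lemma PathObj.fibration_lift {B : D} (P : PathObj B) : Fibration (prod.lift P.src P.tgt) := by
  obtain ⟨c, hc, h⟩ := P.fib
  have e₁ : hc.lift (BinaryFan.mk P.src P.tgt) ≫ c.fst = P.src := hc.fac _ ⟨WalkingPair.left⟩
  have e₂ : hc.lift (BinaryFan.mk P.src P.tgt) ≫ c.snd = P.tgt := hc.fac _ ⟨WalkingPair.right⟩
  let φ := hc.conePointUniqueUpToIso (prodIsProd B B)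
  have h₁ : φ.hom ≫ prod.fst = c.fst :=
    hc.conePointUniqueUpToIso_hom_comp (prodIsProd B B) ⟨WalkingPair.left⟩
  have h₂ : φ.hom ≫ prod.snd = c.snd :=
    hc.conePointUniqueUpToIso_hom_comp (prodIsProd B B) ⟨WalkingPair.right⟩
  have : prod.lift P.src P.tgt = hc.lift (BinaryFan.mk P.src P.tgt) ≫ φ.hom := by
    apply Limits.prod.hom_ext
    · rw [prod.lift_fst, Category.assoc, h₁]; exact e₁.symm
    · rw [prod.lift_snd, Category.assoc, h₂]; exact e₂.symm
  rw [this]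
  exact fibration_comp h (fibration_of_iso _)

lemma PathObj.fibration_src {B : D} (P : PathObj B) : Fibration P.src :=
  fibration_lift_fst P.fibration_lift

lemma PathObj.fibration_tgt {B : D} (P : PathObj B) : Fibration P.tgt :=
  fibration_lift_snd P.fibration_lift

/-- Maps which agree after restriction along an acyclic cofibration are homotopic. -/
lemma IsAcyclicCofibration.homotopic {Q P B : D} {i : Q ⟶ P} (hi : IsAcyclicCofibration i)
    {a b : P ⟶ B} (h : i ≫ a = i ≫ b) : Homotopic a b := by
  obtain ⟨R⟩ := exists_pathObj B
  obtain ⟨l, -, h₂⟩ := hi.exists_lift R.fibration_lift (i ≫ a ≫ R.refl) (prod.lift a b) (by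
    apply Limits.prod.hom_ext
    · simp [R.refl_src]
    · simp [R.refl_tgt, h])
  refine ⟨R, l, ?_, ?_⟩
  · rw [← prod.lift_fst R.src R.tgt, ← Category.assoc, h₂, prod.lift_fst]
  · rw [← prod.lift_snd R.src R.tgt, ← Category.assoc, h₂, prod.lift_snd]

lemma Homotopic.precomp {A A' B : D} {f g : A ⟶ B} (h : Homotopic f g) (k : A' ⟶ A) :
    Homotopic (k ≫ f) (k ≫ g) := by
  obtain ⟨P, H, h₁, h₂⟩ := h
  exact ⟨P, k ≫ H, by rw [Category.assoc, h₁], by rw [Category.assoc, h₂]⟩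

lemma Homotopic.of_eq {A B : D} {f g : A ⟶ B} (h : f = g) : Homotopic f g := by
  obtain ⟨R⟩ := exists_pathObj B
  exact ⟨R, f ≫ R.refl, by rw [Category.assoc, R.refl_src, Category.comp_id],
    by rw [Category.assoc, R.refl_tgt, Category.comp_id, h]⟩

/-- The two endpoint maps of a path object agree on constant paths, so they are homotopic in either
order by `IsAcyclicCofibration.homotopic`; precomposing with the given homotopy suffices. No path
object has to be reversed, and the same device gives `Homotopic.postcomp` without a map of path
objects. -/
lemma Homotopic.symm {A B : D} {f g : A ⟶ B} (h : Homotopic f g) : Homotopic g f := by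
  obtain ⟨P, H, rfl, rfl⟩ := h
  exact (P.acyclic.homotopic (P.refl_tgt.trans P.refl_src.symm)).precomp H

lemma Homotopic.postcomp {A B B' : D} {f g : A ⟶ B} (h : Homotopic f g) (k : B ⟶ B') :
    Homotopic (f ≫ k) (g ≫ k) := by
  obtain ⟨P, H, rfl, rfl⟩ := h
  rw [Category.assoc, Category.assoc]
  refine (P.acyclic.homotopic ?_).precomp H
  rw [← Category.assoc, ← Category.assoc, P.refl_src, P.refl_tgt]

/-- The section of the base change of `p` determined by a section of `p` composed with `i`
identifies the total space of `p` with a pullback along `i`. -/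
lemma isPullback_section {E B P : D} (p : E ⟶ B) {r : B ⟶ P} {s : P ⟶ B} (h : r ≫ s = 𝟙 B)
    [HasPullback p s] :
    IsPullback (pullback.lift (𝟙 E) (p ≫ r) (by simp [h])) p (pullback.snd p s) r := by
  refine IsPullback.of_right (h₁₂ := pullback.fst p s) (h₂₂ := s) (v₁₃ := p) ?_ (by simp)
    (IsPullback.of_hasPullback p s)
  rw [pullback.lift_fst, h]
  exact IsPullback.of_horiz_isIso ⟨by simp⟩

/-- Composable pairs of paths form `P ×_B P'`. The inclusion of constant pairs is an acyclic
cofibration, being `P.refl` followed by a pullback of `P'.refl` along a fibration, and the outer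
endpoints agree on it. -/
lemma Homotopic.trans {A B : D} {f g k : A ⟶ B} (h : Homotopic f g) (h' : Homotopic g k) :
    Homotopic f k := by
  obtain ⟨P, H, rfl, rfl⟩ := h
  obtain ⟨P', H', e, rfl⟩ := h'
  have := P'.fibration_src
  have := P.fibration_tgt
  have key := FibrationCategory.acyclicCofibration_pullback
    (isPullback_section P.tgt P'.refl_src) inferInstance P'.acyclic
  have := (P.acyclic.comp key).homotopic (a := pullback.fst _ _ ≫ P.src)
    (b := pullback.snd _ _ ≫ P'.tgt) (by
      simp [P.refl_src, P.refl_tgt, P'.refl_tgt])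
  have := this.precomp (pullback.lift H H' e.symm)
  simpa using this

lemma isHomotopyEquiv_of_inverse {A B : D} {f : A ⟶ B} (g : B ⟶ A) (h₁ : f ≫ g = 𝟙 A)
    (h₂ : g ≫ f = 𝟙 B) : IsHomotopyEquiv f :=
  ⟨g, .of_eq h₁, .of_eq h₂⟩

lemma isHomotopyEquiv_of_isIso {A B : D} (f : A ⟶ B) [IsIso f] : IsHomotopyEquiv f :=
  isHomotopyEquiv_of_inverse (inv f) (by simp) (by simp)

lemma IsHomotopyEquiv.comp {A B E : D} {f : A ⟶ B} {g : B ⟶ E} (hf : IsHomotopyEquiv f)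
    (hg : IsHomotopyEquiv g) : IsHomotopyEquiv (f ≫ g) := by
  obtain ⟨f', h₁, h₂⟩ := hf
  obtain ⟨g', h₃, h₄⟩ := hg
  refine ⟨g' ≫ f', ?_, ?_⟩
  · have := ((h₃.postcomp f').precomp f).trans (by simpa using h₁)
    simpa using this
  · have := ((h₂.postcomp g).precomp g').trans (by simpa using h₄)
    simpa using this

lemma IsHomotopyEquiv.of_comp_right {A B E : D} {f : A ⟶ B} {g : B ⟶ E}
    (hfg : IsHomotopyEquiv (f ≫ g)) (hg : IsHomotopyEquiv g) : IsHomotopyEquiv f := by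
  obtain ⟨h, h₁, h₂⟩ := hfg
  obtain ⟨g', h₃, h₄⟩ := hg
  refine ⟨g ≫ h, by simpa using h₁, ?_⟩
  have e₁ : Homotopic ((g ≫ h) ≫ f) ((g ≫ h ≫ f ≫ g) ≫ g') := by
    simpa using (h₃.symm.precomp (g ≫ h ≫ f))
  have e₂ : Homotopic ((g ≫ h ≫ f ≫ g) ≫ g') (g ≫ g') := by
    simpa using ((h₂.precomp g).postcomp g')
  exact e₁.trans (e₂.trans h₃)

lemma IsHomotopyEquiv.of_comp_left {A B E : D} {f : A ⟶ B} {g : B ⟶ E}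
    (hfg : IsHomotopyEquiv (f ≫ g)) (hf : IsHomotopyEquiv f) : IsHomotopyEquiv g := by
  obtain ⟨h, h₁, h₂⟩ := hfg
  obtain ⟨f', h₃, h₄⟩ := hf
  refine ⟨h ≫ f, ?_, by simpa using h₂⟩
  have e₁ : Homotopic (g ≫ h ≫ f) (f' ≫ (f ≫ g) ≫ h ≫ f) := by
    simpa using (h₄.symm.postcomp (g ≫ h ≫ f))
  have e₂ : Homotopic (f' ≫ (f ≫ g) ≫ h ≫ f) (f' ≫ f) := by
    simpa using ((h₁.postcomp f).precomp f')
  exact e₁.trans (e₂.trans h₄)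

lemma IsHomotopyEquiv.of_section {A B : D} {i : A ⟶ B} {r : B ⟶ A} (hr : IsHomotopyEquiv r)
    (h : i ≫ r = 𝟙 A) : IsHomotopyEquiv i :=
  .of_comp_right (by rw [h]; exact isHomotopyEquiv_of_isIso _) hr

lemma IsHomotopyEquiv.of_retraction {A B : D} {i : A ⟶ B} {r : B ⟶ A} (hi : IsHomotopyEquiv i)
    (h : i ≫ r = 𝟙 A) : IsHomotopyEquiv r :=
  .of_comp_left (by rw [h]; exact isHomotopyEquiv_of_isIso _) hi

lemma IsHomotopyEquiv.of_arrow_iso {X Y X' Y' : D} {f : X ⟶ Y} {f' : X' ⟶ Y'}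
    (hf : IsHomotopyEquiv f) (a : X' ⟶ X) (b : Y' ⟶ Y) [IsIso a] [IsIso b]
    (h : a ≫ f = f' ≫ b) : IsHomotopyEquiv f' :=
  .of_comp_right (h ▸ (isHomotopyEquiv_of_isIso a).comp hf) (isHomotopyEquiv_of_isIso b)

lemma IsAcyclicCofibration.isHomotopyEquiv {A B : D} {i : A ⟶ B} (hi : IsAcyclicCofibration i) :
    IsHomotopyEquiv i := by
  obtain ⟨r, h, -⟩ := hi.exists_lift (fibration_to_terminal A) (𝟙 A) (terminal.from B)
    (Subsingleton.elim _ _)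
  refine ⟨r, .of_eq h, hi.homotopic ?_⟩
  rw [reassoc_of% h, Category.comp_id]

/-- Transport along a homotopy in a fibration. -/
lemma Homotopic.exists_transport {E Q T : D} {p : E ⟶ Q} (hp : Fibration p) {m : T ⟶ E}
    {n : T ⟶ Q} (h : Homotopic (m ≫ p) n) : ∃ n' : T ⟶ E, n' ≫ p = n := by
  obtain ⟨P, H, e, rfl⟩ := h
  -- Attaching a constant path is an acyclic cofibration `E ⟶ E ×_Q P`, a pullback of `P.refl`; its
  -- lift against `p` transports points of `E` along paths in `Q`.
  obtain ⟨l, -, h₂⟩ := (FibrationCategory.acyclicCofibration_pullback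
    (isPullback_section p P.refl_src) inferInstance P.acyclic).exists_lift hp (𝟙 E)
      (pullback.snd _ _ ≫ P.tgt) (by simp [P.refl_tgt])
  exact ⟨pullback.lift m H e.symm ≫ l, by simp [h₂]⟩

/-- Transport along `g ≫ p ≃ 𝟙 B` corrects the homotopy inverse `g` to a strict section `s`. Then `p
≫ s` is homotopic to `p ≫ s ≫ p ≫ g = p ≫ g`, hence to the identity. -/
lemma exists_section {Q B : D} {p : Q ⟶ B} (hp : Fibration p) (h : IsHomotopyEquiv p) :
    ∃ s : B ⟶ Q, s ≫ p = 𝟙 B ∧ Homotopic (p ≫ s) (𝟙 Q) := by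
  obtain ⟨g, h₁, h₂⟩ := h
  obtain ⟨s, hs⟩ := h₂.exists_transport hp
  refine ⟨s, hs, ?_⟩
  have := (h₁.symm.precomp (p ≫ s)).trans (by simpa [reassoc_of% hs] using h₁)
  simpa using this

/-- An acyclic fibration is a fibrewise deformation retraction. -/
lemma exists_fibrewise_section {Q B : D} {p : Q ⟶ B} (hp : Fibration p)
    (h : IsHomotopyEquiv p) :
    ∃ (s : B ⟶ Q) (P : D) (i : Q ⟶ P) (a b : P ⟶ Q) (K : Q ⟶ P), s ≫ p = 𝟙 B ∧
      IsAcyclicCofibration i ∧ Fibration a ∧ i ≫ a = 𝟙 Q ∧ i ≫ b = 𝟙 Q ∧ a ≫ p = b ≫ p ∧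
      K ≫ a = p ≫ s ∧ K ≫ b = 𝟙 Q := by
  obtain ⟨s, hs, hs'⟩ := exists_section hp h
  -- A fibrewise path object of `Q` over `B`.
  obtain ⟨P, i, d, hi, hd, e⟩ := FibrationCategory.factorization
    (pullback.lift (𝟙 Q) (𝟙 Q) rfl : Q ⟶ pullback p p)
  let w : Q ⟶ pullback p p := pullback.lift (p ≫ s) (𝟙 Q) (by simp [hs])
  let e' : B ⟶ pullback w d := pullback.lift s (s ≫ i) (by
    rw [Category.assoc, e]
    apply pullback.hom_ext <;> simp [w, reassoc_of% hs])
  -- The fibration `pullback w d ⟶ Q` parametrizes fibrewise paths from `p ≫ s` to the identity.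
  -- Constant paths lift `s` to it through `e'`, and since `p ≫ s` is homotopic to `𝟙 Q`,
  -- transporting `p ≫ e'` gives a section over all of `Q`.
  obtain ⟨n, hn⟩ := Homotopic.exists_transport (p := pullback.fst w d) inferInstance
    (m := p ≫ e') (n := 𝟙 Q) (by simpa [e'] using hs')
  have hK : (n ≫ pullback.snd w d) ≫ d = w := by
    rw [Category.assoc, ← pullback.condition, reassoc_of% hn]
  refine ⟨s, P, i, d ≫ pullback.fst p p, d ≫ pullback.snd p p, n ≫ pullback.snd w d, hs, hi,
    fibration_comp hd inferInstance, by simp [reassoc_of% e], by simp [reassoc_of% e],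
    by simp [pullback.condition], ?_, ?_⟩
  · rw [← Category.assoc, hK]; simp [w]
  · rw [← Category.assoc, hK]; simp [w]

/-- A fibrewise deformation retraction can be pulled back along any base change. That `f` is a
fibration is what makes the pulled back constant-path map `i'` an acyclic cofibration, as a pullback
of `i` along `RW ⟶ R`. -/
lemma IsHomotopyEquiv.pullback_along_fibration {P E B W : D} {t : P ⟶ E} {l : P ⟶ W} {p : E ⟶ B}
    {f : W ⟶ B} (sq : IsPullback t l p f) (hp : Fibration p) (h : IsHomotopyEquiv p)
    (hf : Fibration f) : IsHomotopyEquiv l := by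
  obtain ⟨s, R, i, a, b, K, hs, hi, ha, hia, hib, hab, hKa, hKb⟩ := exists_fibrewise_section hp h
  have hR : Fibration (a ≫ p) := fibration_comp ha hp
  have ht : Fibration t := fibration_of_isPullback sq.flip hf
  let RW := pullback (a ≫ p) f
  let a' : RW ⟶ P := sq.lift (pullback.fst _ _ ≫ a) (pullback.snd _ _)
    (by simp [RW, ← pullback.condition])
  let b' : RW ⟶ P := sq.lift (pullback.fst _ _ ≫ b) (pullback.snd _ _)
    (by simp [RW, ← pullback.condition, hab])
  let i' : P ⟶ RW := pullback.lift (t ≫ i) l (by simp [reassoc_of% hia, sq.w])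
  let K' : P ⟶ RW := pullback.lift (t ≫ K) l (by
    simp only [Category.assoc, reassoc_of% hKa, hs, Category.comp_id, sq.w])
  let s' : W ⟶ P := sq.lift (f ≫ s) (𝟙 W) (by simp [hs])
  have hi' : IsAcyclicCofibration i' := by
    refine FibrationCategory.acyclicCofibration_pullback (l := t) (g := pullback.fst (a ≫ p) f)
      (f := i) ?_ inferInstance hi
    refine IsPullback.of_bot (v₂₁ := pullback.snd _ _) (h₃₁ := f) (v₂₂ := a ≫ p)
      (h₂₁ := pullback.fst _ _) ?_ (by simp [i']) (IsPullback.of_hasPullback (a ≫ p) f) |>.flip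
    simpa [i', reassoc_of% hia] using sq
  refine ⟨s', ?_, .of_eq (by simp [s'])⟩
  have e₁ : l ≫ s' = K' ≫ a' := by
    apply sq.hom_ext <;> simp [s', K', a', hKa, reassoc_of% sq.w]
  have e₂ : 𝟙 P = K' ≫ b' := by
    apply sq.hom_ext <;> simp [K', b', hKb]
  rw [e₁, e₂]
  refine (hi'.homotopic ?_).precomp K'
  apply sq.hom_ext <;> simp [i', a', b', hia, hib]

/-- Acyclic fibrations are stable under pullback. -/
lemma IsHomotopyEquiv.pullback_acyclicFibration {P E B W : D} {t : P ⟶ E} {l : P ⟶ W} {p : E ⟶ B}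
    {f : W ⟶ B} (sq : IsPullback t l p f) (hp : Fibration p) (h : IsHomotopyEquiv p) :
    IsHomotopyEquiv l := by
  -- Pulling back along the fibration `q` is the previous lemma. Along the acyclic cofibration `j`,
  -- the upper map `m` is again an acyclic cofibration, and two-out-of-three applies.
  obtain ⟨V, j, q, hj, hq, rfl⟩ := FibrationCategory.factorization f
  have hE := IsPullback.of_hasPullback p q
  let m : P ⟶ pullback p q := pullback.lift t (l ≫ j) (by simp [sq.w])
  have hm : IsPullback m l (pullback.snd p q) j :=
    IsPullback.of_right (h₁₂ := pullback.fst p q) (v₁₃ := p) (h₂₂ := q) (by simpa [m] using sq)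
      (by simp [m]) hE
  have h₁ := (FibrationCategory.acyclicCofibration_pullback hm inferInstance hj).isHomotopyEquiv
  have h₂ := h.pullback_along_fibration hE hp hq
  exact .of_comp_right (hm.w ▸ h₁.comp h₂) hj.isHomotopyEquiv

/-- Right properness: homotopy equivalences are stable under pullback along fibrations. -/
lemma IsHomotopyEquiv.pullback_of_fibration {P E B W : D} {t : P ⟶ E} {l : P ⟶ W} {p : E ⟶ B}
    {f : W ⟶ B} (sq : IsPullback t l p f) (hp : Fibration p) (h : IsHomotopyEquiv f) :
    IsHomotopyEquiv t := by
  obtain ⟨V, j, q, hj, hq, rfl⟩ := FibrationCategory.factorization f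
  have hE := IsPullback.of_hasPullback p q
  let m : P ⟶ pullback p q := pullback.lift t (l ≫ j) (by simp [sq.w])
  have hm : IsPullback m l (pullback.snd p q) j :=
    IsPullback.of_right (h₁₂ := pullback.fst p q) (v₁₃ := p) (h₂₂ := q) (by simpa [m] using sq)
      (by simp [m]) hE
  have h₁ := (FibrationCategory.acyclicCofibration_pullback hm inferInstance hj).isHomotopyEquiv
  -- By two-out-of-three `q` is an acyclic fibration, so its base change along `p` is a homotopy
  -- equivalence; `t` is that base change after the acyclic cofibration `m`.
  have hq' := IsHomotopyEquiv.of_comp_left h hj.isHomotopyEquiv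
  have h₂ := hq'.pullback_acyclicFibration hE.flip hq
  have : t = m ≫ pullback.fst p q := by simp [m]
  rw [this]
  exact h₁.comp h₂

/-- Brown's factorization of a homotopy equivalence over `Z`. -/
lemma IsHomotopyEquiv.exists_factorization {X X' Z : D} {k : X ⟶ X'} (h : IsHomotopyEquiv k)
    {x : X ⟶ Z} {x' : X' ⟶ Z} (hx : Fibration x) (hx' : Fibration x') (hk : k ≫ x' = x) :
    ∃ (N : D) (i : X ⟶ N) (r : N ⟶ X) (q : N ⟶ X'), i ≫ r = 𝟙 X ∧ i ≫ q = k ∧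
      q ≫ x' = r ≫ x ∧ Fibration r ∧ IsHomotopyEquiv r ∧ Fibration q ∧ IsHomotopyEquiv q := by
  -- The graph of `k` in `X ×_Z X'` is factored; the two projections are fibrations because `x` and
  -- `x'` are.
  obtain ⟨N, i, c, hi, hc, e⟩ := FibrationCategory.factorization
    (pullback.lift (𝟙 X) k (by simp [hk]) : X ⟶ pullback x x')
  have h₁ : i ≫ c ≫ pullback.fst x x' = 𝟙 X := by simp [reassoc_of% e]
  have h₂ : i ≫ c ≫ pullback.snd x x' = k := by simp [reassoc_of% e]
  exact ⟨N, i, c ≫ pullback.fst _ _, c ≫ pullback.snd _ _, h₁, h₂, by simp [pullback.condition],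
    fibration_comp hc inferInstance, hi.isHomotopyEquiv.of_retraction h₁,
    fibration_comp hc inferInstance, .of_comp_left (h₂ ▸ h) hi.isHomotopyEquiv⟩

end Homotopy

lemma isPullback_of_exists_lift {C : Type u} [Category.{v} C] {P X Y Z : C} {t : P ⟶ Y}
    {l : P ⟶ X} {g : Y ⟶ Z} {f : X ⟶ Z} (w : t ≫ g = l ≫ f)
    (ex : ∀ {W : C} (a : W ⟶ Y) (b : W ⟶ X), a ≫ g = b ≫ f → ∃ s : W ⟶ P, s ≫ t = a ∧ s ≫ l = b)
    (uniq : ∀ {W : C} (s s' : W ⟶ P), s ≫ t = s' ≫ t → s ≫ l = s' ≫ l → s = s') :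
    IsPullback t l g f :=
  ⟨⟨w⟩, ⟨PullbackCone.IsLimit.mk _ (fun s => (ex s.fst s.snd s.condition).choose)
    (fun s => (ex s.fst s.snd s.condition).choose_spec.1)
    (fun s => (ex s.fst s.snd s.condition).choose_spec.2)
    (fun s _ h₁ h₂ => uniq _ _
      (h₁.trans (ex s.fst s.snd s.condition).choose_spec.1.symm)
      (h₂.trans (ex s.fst s.snd s.condition).choose_spec.2.symm))⟩⟩

/-! ## Relative dependent products -/

section RelPi

variable {C : Type u} [Category.{v} C] [CategoryWithFibrations C] [HasFibrationPullbacks C]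

/-- The map of pullbacks of a fibration `b` induced by a map of bases. -/
noncomputable def pbMap {A X W W' : C} (b : A ⟶ X) [Fibration b] (t : W ⟶ W') {q : W ⟶ X}
    {q' : W' ⟶ X} (h : t ≫ q' = q) : pullback q b ⟶ pullback q' b :=
  pullback.lift (pullback.fst q b ≫ t) (pullback.snd q b)
    (by rw [Category.assoc, h, pullback.condition])

section

variable {A X W W' W'' : C} (b : A ⟶ X) [Fibration b]

lemma pbMap_fst (t : W ⟶ W') {q : W ⟶ X} {q' : W' ⟶ X} (h : t ≫ q' = q) :
    pbMap b t h ≫ pullback.fst q' b = pullback.fst q b ≫ t := pullback.lift_fst _ _ _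

lemma pbMap_snd (t : W ⟶ W') {q : W ⟶ X} {q' : W' ⟶ X} (h : t ≫ q' = q) :
    pbMap b t h ≫ pullback.snd q' b = pullback.snd q b := pullback.lift_snd _ _ _

lemma pbMap_fst_assoc (t : W ⟶ W') {q : W ⟶ X} {q' : W' ⟶ X} (h : t ≫ q' = q) {V : C}
    (k : W' ⟶ V) : pbMap b t h ≫ pullback.fst q' b ≫ k = pullback.fst q b ≫ t ≫ k := by
  rw [← Category.assoc, pbMap_fst, Category.assoc]

lemma pbMap_snd_assoc (t : W ⟶ W') {q : W ⟶ X} {q' : W' ⟶ X} (h : t ≫ q' = q) {V : C}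
    (k : A ⟶ V) : pbMap b t h ≫ pullback.snd q' b ≫ k = pullback.snd q b ≫ k := by
  rw [← Category.assoc, pbMap_snd]

attribute [simp] pbMap_fst pbMap_snd pbMap_fst_assoc pbMap_snd_assoc

lemma pbMap_pbMap (t : W ⟶ W') (t' : W' ⟶ W'') {q : W ⟶ X} {q' : W' ⟶ X} {q'' : W'' ⟶ X}
    (h : t ≫ q' = q) (h' : t' ≫ q'' = q') :
    pbMap b t h ≫ pbMap b t' h' = pbMap b (t ≫ t') (by rw [Category.assoc, h', h]) := by
  apply pullback.hom_ext <;> simp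

lemma pbMap_pbMap_assoc (t : W ⟶ W') (t' : W' ⟶ W'') {q : W ⟶ X} {q' : W' ⟶ X} {q'' : W'' ⟶ X}
    (h : t ≫ q' = q) (h' : t' ≫ q'' = q') {V : C} (k : pullback q'' b ⟶ V) :
    pbMap b t h ≫ pbMap b t' h' ≫ k = pbMap b (t ≫ t') (by rw [Category.assoc, h', h]) ≫ k := by
  rw [← Category.assoc, pbMap_pbMap]

lemma pbMap_id {t : W ⟶ W} (ht : t = 𝟙 W) {q : W ⟶ X} (h : t ≫ q = q) :
    pbMap b t h = 𝟙 _ := by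
  apply pullback.hom_ext <;> simp [ht]

lemma pbMap_congr {t t' : W ⟶ W'} (ht : t = t') {q : W ⟶ X} {q' : W' ⟶ X} (h : t ≫ q' = q) :
    pbMap b t h = pbMap b t' (ht ▸ h) := by subst ht; rfl

end

/-- `π : P ⟶ L`, with evaluation map `ev`, represents the functor sending `w : W ⟶ L` to the set
of maps `W ×_X A ⟶ E` over `F`. -/
structure IsRelPi {A X L F E P : C} (b : A ⟶ X) [Fibration b] (p : L ⟶ X)
    (a : pullback p b ⟶ F) (e : E ⟶ F) (π : P ⟶ L) {r : P ⟶ X} (ev : pullback r b ⟶ E) :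
    Prop where
  comm : π ≫ p = r
  w : ev ≫ e = pbMap b π comm ≫ a
  exists_lift : ∀ {W : C} (w : W ⟶ L) {q : W ⟶ X} (hq : w ≫ p = q) (m : pullback q b ⟶ E),
    m ≫ e = pbMap b w hq ≫ a →
      ∃ (t : W ⟶ P) (h : t ≫ π = w), pbMap b t (by rw [← hq, ← h, Category.assoc, comm]) ≫ ev = m
  hom_ext : ∀ {W : C} {t t' : W ⟶ P} {q : W ⟶ X} (h : t ≫ r = q) (h' : t' ≫ r = q),
    t ≫ π = t' ≫ π → pbMap b t h ≫ ev = pbMap b t' h' ≫ ev → t = t'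

variable {A X L F E P : C} {b : A ⟶ X} [Fibration b] {p : L ⟶ X}
    {a : pullback p b ⟶ F} {e : E ⟶ F}

lemma IsRelPi.exists_iso {π : P ⟶ L} {r : P ⟶ X} {ev : pullback r b ⟶ E}
    (H : IsRelPi b p a e π ev) {P' : C} {π' : P' ⟶ L} {r' : P' ⟶ X} {ev' : pullback r' b ⟶ E}
    (H' : IsRelPi b p a e π' ev') : ∃ φ : P ≅ P', φ.hom ≫ π' = π := by
  obtain ⟨f, hf, hf'⟩ := H'.exists_lift π H.comm ev H.w
  obtain ⟨g, hg, hg'⟩ := H.exists_lift π' H'.comm ev' H'.w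
  have ef : f ≫ r' = r := by rw [← H.comm, ← H'.comm, reassoc_of% hf]
  have eg : g ≫ r = r' := by rw [← H.comm, ← H'.comm, reassoc_of% hg]
  refine ⟨⟨f, g, ?_, ?_⟩, hf⟩
  · refine H.hom_ext (by simp [eg, ef]) (Category.id_comp _) (by simp [hg, hf]) ?_
    rw [← pbMap_pbMap b f g ef eg, Category.assoc, hg',
      hf', pbMap_id b rfl, Category.id_comp]
  · refine H'.hom_ext (by simp [eg, ef]) (Category.id_comp _) (by simp [hg, hf]) ?_
    rw [← pbMap_pbMap b g f eg ef, Category.assoc, hf',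
      hg', pbMap_id b rfl, Category.id_comp]

/-- Dependent products yield relative dependent products. -/
lemma DepProd.isRelPi [Fibration e] {P : Over L}
    (r : DepProd (pullback.fst p b) (pullback.fst a e) P) :
    ∃ ev : pullback (P.hom ≫ p) b ⟶ E, IsRelPi b p a e P.hom ev := by
  -- `κ` and `κ'` are the inverse identifications between `W ×_X A`, used by `IsRelPi`, and `W ×_L
  -- (L ×_X A)`, used by `DepProd`.
  let κ {W : C} (w : W ⟶ L) {q : W ⟶ X} (hq : w ≫ p = q) :
      pullback q b ⟶ pullback w (pullback.fst p b) :=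
    pullback.lift (pullback.fst q b) (pbMap b w hq) (by simp)
  let κ' {W : C} (w : W ⟶ L) {q : W ⟶ X} (hq : w ≫ p = q) :
      pullback w (pullback.fst p b) ⟶ pullback q b :=
    pullback.lift (pullback.fst _ _) (pullback.snd _ _ ≫ pullback.snd _ _)
      (by rw [← hq, pullback.condition_assoc, Category.assoc, pullback.condition])
  have κκ' {W : C} (w : W ⟶ L) {q : W ⟶ X} (hq : w ≫ p = q) : κ w hq ≫ κ' w hq = 𝟙 _ := by
    apply pullback.hom_ext <;> simp [κ, κ']
  have κ'κ {W : C} (w : W ⟶ L) {q : W ⟶ X} (hq : w ≫ p = q) : κ' w hq ≫ κ w hq = 𝟙 _ := by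
    apply pullback.hom_ext
    · simp [κ, κ']
    · apply pullback.hom_ext <;> simp [κ, κ', pullback.condition]
  have nat {W : C} (w : W ⟶ L) (t : Over.mk w ⟶ P) : (r.homEquiv t).left =
      ((Over.pullback (pullback.fst p b)).map t).left ≫ (r.homEquiv (𝟙 P)).left := by
    rw [r.homEquiv_eq]; rfl
  have κnat {W : C} (w : W ⟶ L) {q : W ⟶ X} (hq : w ≫ p = q) (t : Over.mk w ⟶ P) :
      κ w hq ≫ ((Over.pullback (pullback.fst p b)).map t).left =
        pbMap b t.left (by rw [← hq, ← Category.assoc]; exact congrArg (· ≫ p) (Over.w t)) ≫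
          κ P.hom rfl := by
    have hw := Over.w t
    dsimp at hw
    apply pullback.hom_ext
    · simp [κ]
    · simp [κ, pbMap_pbMap, hw]
  have hfst {V : Over L} (s : (Over.pullback (pullback.fst p b)).obj V ⟶
      Over.mk (pullback.fst a e)) : s.left ≫ pullback.fst a e = pullback.snd _ _ := Over.w s
  refine ⟨κ P.hom rfl ≫ (r.homEquiv (𝟙 P)).left ≫ pullback.snd a e, rfl, ?_, ?_, ?_⟩
  · rw [Category.assoc, Category.assoc, ← pullback.condition, reassoc_of% (hfst _)]
    simp [κ]
  · intro W w q hq m hm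
    let m' : (Over.pullback (pullback.fst p b)).obj (Over.mk w) ⟶ Over.mk (pullback.fst a e) :=
      Over.homMk (pullback.lift (pullback.snd _ _) (κ' w hq ≫ m) (by
        rw [Category.assoc, hm, ← Category.assoc]
        congr 1
        have := congrArg (· ≫ pullback.snd _ _) (κ'κ w hq)
        simpa [κ] using this.symm)) (by simp)
    let t := r.homEquiv.symm m'
    have ht : t.left ≫ P.hom = w := Over.w t
    refine ⟨t.left, ht, ?_⟩
    rw [← Category.assoc, ← κnat w hq t, Category.assoc, ← Category.assoc _ (r.homEquiv _).left,
      ← nat w t, r.homEquiv.apply_symm_apply]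
    simp [m', reassoc_of% (κκ' w hq)]
  · intro W t t' q h h' e₁ e₂
    let τ : Over.mk (t ≫ P.hom) ⟶ P := Over.homMk t
    let τ' : Over.mk (t ≫ P.hom) ⟶ P := Over.homMk t' e₁.symm
    suffices τ = τ' from congrArg (·.left) this
    apply r.homEquiv.injective
    refine Over.OverMorphism.ext (pullback.hom_ext ?_ ?_)
    · rw [hfst, hfst]
    · have h₀ : (t ≫ P.hom) ≫ p = q := by rw [Category.assoc, h]
      have key (σ : Over.mk (t ≫ P.hom) ⟶ P) : κ _ h₀ ≫ (r.homEquiv σ).left ≫ pullback.snd a e =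
          pbMap b σ.left (by rw [← h₀, ← Category.assoc]; exact congrArg (· ≫ p) (Over.w σ)) ≫
            κ P.hom rfl ≫ (r.homEquiv (𝟙 P)).left ≫ pullback.snd a e := by
        rw [nat, Category.assoc, ← Category.assoc (κ _ _), κnat _ h₀, Category.assoc]
      have := (key τ).trans (e₂.trans (key τ').symm)
      have := congrArg (κ' _ h₀ ≫ ·) this
      simpa [reassoc_of% (κ'κ _ h₀)] using this

end RelPi

/-! ### Existence and homotopical properties of relative dependent products. -/

section Existence

variable {C : Type u} [Category.{v} C] [CategoryWithFibrations C]
  [IsTypeTheoreticFibrationCategory C]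
  {A X L F E : C} (b : A ⟶ X) [Fibration b] (p : L ⟶ X) (a : pullback p b ⟶ F) (e : E ⟶ F)

lemma exists_isRelPi [Fibration e] : ∃ (P : C) (π : P ⟶ L) (r : P ⟶ X) (ev : pullback r b ⟶ E),
    Fibration π ∧ IsRelPi b p a e π ev := by
  obtain ⟨P, hP, ⟨r⟩⟩ := IsTypeTheoreticFibrationCategory.depProd (pullback.fst p b)
    (pullback.fst a e) inferInstance
  obtain ⟨ev, h⟩ := r.isRelPi
  exact ⟨P.left, P.hom, _, ev, hP, h⟩

variable {b p a e}

lemma IsRelPi.fibration [Fibration e] {P : C} {π : P ⟶ L} {r : P ⟶ X} {ev : pullback r b ⟶ E}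
    (H : IsRelPi b p a e π ev) : Fibration π := by
  obtain ⟨P', π', _, ev', h, H'⟩ := exists_isRelPi b p a e
  obtain ⟨φ, hφ⟩ := H.exists_iso H'
  rw [← hφ]
  exact fibration_comp (fibration_of_iso _) h

/-- Pullback along a fibration `g` is left adjoint to the dependent product along `g`, which
preserves fibrations. A lifting problem for the pullback `t` against `e` therefore transposes to one
for `f` against the fibration `π`. -/
instance : FibrationCategory C where
  factorization := IsTypeTheoreticFibrationCategory.factorization
  acyclicCofibration_pullback {P X Y Z t l g f} sq hg hf := .of_exists_lift fun {E F} e he u v w => by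
    obtain ⟨R, π, r, ev, hπ, H⟩ := exists_isRelPi g (𝟙 Z) (pullback.snd (𝟙 Z) g ≫ v) e
    let φ := sq.flip.isoPullback
    obtain ⟨t', ht', ht''⟩ := H.exists_lift f (q := f) (Category.comp_id f) (φ.inv ≫ u) (by
      simp [w, φ])
    obtain ⟨s, hs, hs'⟩ := hf.exists_lift hπ t' (𝟙 Z) (by rw [ht', Category.comp_id])
    let j : Y ⟶ pullback (𝟙 Z) g := pullback.lift g (𝟙 Y) (by simp)
    have hr : r = π := by rw [← H.comm, Category.comp_id]
    have hsπ : s ≫ r = 𝟙 Z := by rw [hr, hs']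
    refine ⟨j ≫ pbMap g s hsπ ≫ ev, ?_, ?_⟩
    · have : t ≫ j ≫ pbMap g s hsπ = φ.hom ≫ pbMap g t' (by rw [hr, ht']) := by
        apply pullback.hom_ext
        · simp [j, φ, ← hs, ← reassoc_of% sq.w]
        · simp [j, φ]
      rw [← Category.assoc, ← Category.assoc, Category.assoc t, this, Category.assoc, ht'',
        φ.hom_inv_id_assoc]
    · rw [Category.assoc, Category.assoc, H.w]
      simp [j]

/-- Up to isomorphism `π` is the dependent product of the base change of `e` along `a`, which is
still an acyclic fibration. -/
lemma IsRelPi.isHomotopyEquiv (hfe : FunctionExtensionality C) [Fibration e]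
    (he : IsHomotopyEquiv e) {P : C} {π : P ⟶ L} {r : P ⟶ X} {ev : pullback r b ⟶ E}
    (H : IsRelPi b p a e π ev) : IsHomotopyEquiv π := by
  obtain ⟨P', hP, ⟨d⟩⟩ := IsTypeTheoreticFibrationCategory.depProd (pullback.fst p b)
    (pullback.fst a e) inferInstance
  obtain ⟨ev', H'⟩ := d.isRelPi
  obtain ⟨φ, hφ⟩ := H.exists_iso H'
  rw [← hφ]
  exact (isHomotopyEquiv_of_isIso _).comp (hfe _ _ inferInstance
    (he.pullback_acyclicFibration (IsPullback.of_hasPullback a e).flip inferInstance) P' d)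


/-- Relative dependent products of composites. -/
lemma IsRelPi.of_comp {N : C} {k : E ⟶ N} {n : N ⟶ F} (hk : k ≫ n = e) {P P' : C} {π : P ⟶ L}
    {r : P ⟶ X} {ev : pullback r b ⟶ E} (H : IsRelPi b p a e π ev) {π' : P' ⟶ L} {r' : P' ⟶ X}
    {ev' : pullback r' b ⟶ N} (H' : IsRelPi b p a n π' ev') {t : P ⟶ P'} (ht : t ≫ π' = π)
    (hr : t ≫ r' = r) (h : pbMap b t hr ≫ ev' = ev ≫ k) : IsRelPi b r' ev' k t ev where
  comm := hr
  w := h.symm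
  exists_lift {W} w q hq m hm := by
    obtain ⟨s, hs, hs'⟩ := H.exists_lift (w ≫ π') (q := q) (by rw [Category.assoc, H'.comm, hq]) m
      (by rw [← hk, reassoc_of% hm, H'.w, ← Category.assoc, pbMap_pbMap])
    have hsr : s ≫ r = q := by rw [← H.comm, reassoc_of% hs, H'.comm, hq]
    refine ⟨s, H'.hom_ext (by rw [Category.assoc, hr, hsr]) hq (by rw [Category.assoc, ht, hs]) ?_,
      hs'⟩
    rw [← hm, ← hs', Category.assoc (pbMap b s _), ← h, ← Category.assoc (pbMap b s _),
      pbMap_pbMap]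
  hom_ext {W s s' q} h₁ h₂ e₁ e₂ := H.hom_ext h₁ h₂
    (by rw [← ht, ← Category.assoc, e₁, Category.assoc]) e₂

/-- Base change of relative dependent products. -/
lemma IsRelPi.isPullback {N L' F' E' : C} {ℓ : L ⟶ L'} {p' : L' ⟶ X} (hp : ℓ ≫ p' = p)
    {t : N ⟶ E'} {n : N ⟶ F} {e' : E' ⟶ F'} {f : F ⟶ F'} (hN : IsPullback t n e' f)
    {a' : pullback p' b ⟶ F'} (ha : pbMap b ℓ hp ≫ a' = a ≫ f)
    {P P' : C} {π : P ⟶ L} {r : P ⟶ X} {ev : pullback r b ⟶ N} (H : IsRelPi b p a n π ev)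
    {π' : P' ⟶ L'} {r' : P' ⟶ X} {ev' : pullback r' b ⟶ E'} (H' : IsRelPi b p' a' e' π' ev')
    {τ : P ⟶ P'} (hτ : τ ≫ π' = π ≫ ℓ) (hr : τ ≫ r' = r)
    (h : pbMap b τ hr ≫ ev' = ev ≫ t) : IsPullback τ π π' ℓ := by
  refine isPullback_of_exists_lift hτ (fun {W} x w hxw => ?_) (fun {W} s s' h₁ h₂ => ?_)
  · have hx : x ≫ r' = w ≫ p := by rw [← H'.comm, reassoc_of% hxw, hp]
    obtain ⟨s, hs, hs'⟩ := H.exists_lift w rfl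
      (hN.lift (pbMap b x hx ≫ ev') (pbMap b w rfl ≫ a) (by
        rw [Category.assoc, H'.w, Category.assoc, ← ha, pbMap_pbMap_assoc, pbMap_pbMap_assoc]
        exact congrArg (· ≫ a') (pbMap_congr b hxw _))) (by simp)
    refine ⟨s, H'.hom_ext (q := w ≫ p) ?_ hx ?_ ?_, hs⟩
    · rw [Category.assoc, hr, ← H.comm, reassoc_of% hs]
    · rw [Category.assoc, hτ, reassoc_of% hs, hxw]
    · rw [← pbMap_pbMap b s τ (by rw [← H.comm, reassoc_of% hs]) hr, Category.assoc, h,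
        reassoc_of% hs', hN.lift_fst]
  · have hq : s ≫ r = s' ≫ r := by rw [← H.comm, reassoc_of% h₂]
    refine H.hom_ext rfl hq.symm h₂ (hN.hom_ext ?_ ?_)
    · rw [Category.assoc, Category.assoc, ← h, ← Category.assoc, ← Category.assoc, pbMap_pbMap,
        pbMap_pbMap]
      exact congrArg (· ≫ ev') (pbMap_congr b h₁ _)
    · rw [Category.assoc, Category.assoc, H.w, ← Category.assoc, ← Category.assoc, pbMap_pbMap,
        pbMap_pbMap]
      exact congrArg (· ≫ a) (pbMap_congr b h₂ _)

/-! ### Gap maps between relative dependent products. -/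

section Comparison

variable {N L' F' E' : C} {ℓ : L ⟶ L'} {p' : L' ⟶ X} (hp : ℓ ≫ p' = p)
  {t : N ⟶ E'} {n : N ⟶ F} {e' : E' ⟶ F'} {f : F ⟶ F'} (hN : IsPullback t n e' f)
  {a' : pullback p' b ⟶ F'} (ha : pbMap b ℓ hp ≫ a' = a ≫ f)
  {P P' : C} {π : P ⟶ L} {r : P ⟶ X} {ev : pullback r b ⟶ E} (H : IsRelPi b p a e π ev)
  {π' : P' ⟶ L'} {r' : P' ⟶ X} {ev' : pullback r' b ⟶ E'} (H' : IsRelPi b p' a' e' π' ev')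
  {k : E ⟶ N} (hk : k ≫ n = e)
  {τ : P ⟶ P'} (hτ : τ ≫ π' = π ≫ ℓ) (hr : τ ≫ r' = r)
  (h : pbMap b τ hr ≫ ev' = ev ≫ k ≫ t)

include hN ha H H' hk hτ h in
/-- The gap map of a map of relative dependent products is a relative dependent product of the
gap map. -/
lemma IsRelPi.exists_gap [Fibration e'] :
    ∃ (Q : C) (x : Q ⟶ P') (y : Q ⟶ L) (s : P ⟶ Q) (rQ : Q ⟶ X) (evQ : pullback rQ b ⟶ N),
      IsPullback x y π' ℓ ∧ s ≫ x = τ ∧ s ≫ y = π ∧ IsRelPi b p a n y evQ ∧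
        IsRelPi b rQ evQ k s ev ∧ ∃ hs : s ≫ rQ = r, pbMap b s hs ≫ evQ = ev ≫ k := by
  have hn : Fibration n := fibration_of_isPullback hN inferInstance
  -- The product `Q` of `n` plays two roles: as `n` is a base change of `e'`, it is the pullback of
  -- `P'` along `ℓ`; as `e = k ≫ n`, the product of `e` is a product of `k` over it.
  obtain ⟨Q, y, rQ, evQ, hy, HQ⟩ := exists_isRelPi b p a n
  obtain ⟨s, hs, hs'⟩ := HQ.exists_lift π H.comm (ev ≫ k) (by rw [Category.assoc, hk, H.w])
  have hsr : s ≫ rQ = r := by rw [← HQ.comm, reassoc_of% hs, H.comm]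
  have hyl : (y ≫ ℓ) ≫ p' = rQ := by rw [Category.assoc, hp, HQ.comm]
  obtain ⟨x, hx, hx'⟩ := H'.exists_lift (y ≫ ℓ) hyl (evQ ≫ t) (by
    rw [Category.assoc, hN.w, ← Category.assoc, HQ.w, Category.assoc, ← ha, ← Category.assoc,
      pbMap_pbMap])
  have hxr : x ≫ r' = rQ := by rw [← H'.comm, reassoc_of% hx, hp, HQ.comm]
  refine ⟨Q, x, y, s, rQ, evQ, HQ.isPullback hp hN ha H' hx hxr hx', ?_, hs, HQ,
    H.of_comp hk HQ hs hsr hs', hsr, hs'⟩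
  refine H'.hom_ext (by rw [Category.assoc, hxr, hsr]) hr
    (by rw [Category.assoc, hx, reassoc_of% hs, hτ]) ?_
  rw [h, ← pbMap_pbMap b s x hsr hxr, Category.assoc, hx', reassoc_of% hs']

-- The gap map into one choice of pullback is a relative dependent product of the fibration `k`; any
-- other choice differs by an isomorphism.
include hN ha H H' hk h in
lemma IsRelPi.fibration_gap [Fibration e'] (hkf : Fibration k) {Q : C} {x : Q ⟶ P'} {y : Q ⟶ L}
    (hQ : IsPullback x y π' ℓ) {s : P ⟶ Q} (hx : s ≫ x = τ) (hy : s ≫ y = π) : Fibration s := by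
  have hτ : τ ≫ π' = π ≫ ℓ := by rw [← hx, ← hy, Category.assoc, Category.assoc, hQ.w]
  obtain ⟨Q', x', y', s', rQ, evQ, hQ', hx', hy', -, Hs, -⟩ := H.exists_gap hp hN ha H' hk hτ hr h
  let φ := hQ'.isoIsPullback _ _ hQ
  have : s = s' ≫ φ.hom := by
    apply hQ.hom_ext
    · simp [φ, hx, hx']
    · simp [φ, hy, hy']
  rw [this]
  exact fibration_comp Hs.fibration (fibration_of_iso _)

/-- Function extensionality speaks only of acyclic fibrations. Brown's factorization over `F` writes
`k` as a section `i` of an acyclic fibration `ρ` followed by an acyclic fibration `κ`. The products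
`α` and `β` of `ρ` and `κ` are homotopy equivalences, and the product `γ` of `i` is a section of
`α`. -/
lemma IsRelPi.isHomotopyEquiv_map (hfe : FunctionExtensionality C) [Fibration e]
    {n : N ⟶ F} [Fibration n] (hk : k ≫ n = e) (hke : IsHomotopyEquiv k) {Q : C} {y : Q ⟶ L}
    {rQ : Q ⟶ X} {evQ : pullback rQ b ⟶ N} (H : IsRelPi b p a e π ev) (HQ : IsRelPi b p a n y evQ)
    {s : P ⟶ Q} (hs : s ≫ y = π) (hsr : s ≫ rQ = r) (hs' : pbMap b s hsr ≫ evQ = ev ≫ k) :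
    IsHomotopyEquiv s := by
  obtain ⟨M, i, ρ, κ, hi, hiκ, hκ, hρf, hρe, hκf, hκe⟩ :=
    hke.exists_factorization (inferInstanceAs (Fibration e)) (inferInstanceAs (Fibration n)) hk
  have hm : Fibration (ρ ≫ e) := fibration_comp hρf inferInstance
  obtain ⟨R, z, rR, evR, hz, HR⟩ := exists_isRelPi b p a (ρ ≫ e)
  obtain ⟨α, hα, hα'⟩ := H.exists_lift z HR.comm (evR ≫ ρ) (by rw [Category.assoc, HR.w])
  obtain ⟨β, hβ, hβ'⟩ := HQ.exists_lift z HR.comm (evR ≫ κ) (by rw [Category.assoc, hκ, HR.w])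
  obtain ⟨γ, hγ, hγ'⟩ := HR.exists_lift π H.comm (ev ≫ i)
    (by rw [Category.assoc, reassoc_of% hi, H.w])
  have hαr : α ≫ r = rR := by rw [← H.comm, reassoc_of% hα, HR.comm]
  have hβr : β ≫ rQ = rR := by rw [← HQ.comm, reassoc_of% hβ, HR.comm]
  have hγr : γ ≫ rR = r := by rw [← HR.comm, reassoc_of% hγ, H.comm]
  have h₁ : IsHomotopyEquiv α := (HR.of_comp rfl H hα hαr hα').isHomotopyEquiv hfe hρe
  have h₂ : IsHomotopyEquiv β := (HR.of_comp hκ HQ hβ hβr hβ').isHomotopyEquiv hfe hκe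
  have h₃ : γ ≫ α = 𝟙 P := by
    refine H.hom_ext (q := r) (by rw [Category.assoc, hαr, hγr]) (Category.id_comp _)
      (by simp [hα, hγ]) ?_
    rw [← pbMap_pbMap b γ α hγr hαr, Category.assoc, hα', reassoc_of% hγ', hi, pbMap_id b rfl,
      Category.id_comp, Category.comp_id]
  have h₄ : γ ≫ β = s := by
    refine HQ.hom_ext (q := r) (by rw [Category.assoc, hβr, hγr]) hsr (by simp [hβ, hγ, hs]) ?_
    rw [← pbMap_pbMap b γ β hγr hβr, Category.assoc, hβ', reassoc_of% hγ', hiκ, hs']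
  rw [← h₄]
  exact (h₁.of_section h₃).comp h₂

-- `τ` factors through the product `Q` of `n`. The first factor is the product of the homotopy
-- equivalence `k`; the second is a pullback of `ℓ` along the fibration `π'`, so right properness
-- applies.
include hN ha H H' hk hτ h in
lemma IsRelPi.isHomotopyEquiv_gap (hfe : FunctionExtensionality C) [Fibration e] [Fibration e']
    (hke : IsHomotopyEquiv k) (hℓ : IsHomotopyEquiv ℓ) : IsHomotopyEquiv τ := by
  have hn : Fibration n := fibration_of_isPullback hN inferInstance
  obtain ⟨Q, x, y, s, rQ, evQ, hQ, hx, hy, HQ, -, hs, hs'⟩ :=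
    H.exists_gap hp hN ha H' hk hτ hr h
  rw [← hx]
  exact (H.isHomotopyEquiv_map hfe hk hke HQ hy hs hs').comp
    (hℓ.pullback_of_fibration hQ H'.fibration)

end Comparison

end Existence

/-! ## The fibration category of fibrations over an object -/

namespace FibOver

section

variable {C : Type u} [Category.{v} C] [CategoryWithFibrations C] {Z : C}

/-- The object of `FibOver Z` given by a fibration. -/
abbrev of {X : C} (f : X ⟶ Z) (h : Fibration f) : FibOver Z := ⟨Over.mk f, h.mem⟩

/-- The map in `FibOver Z` given by a commutative triangle. -/
abbrev homMk {A B : FibOver Z} (k : A.obj.left ⟶ B.obj.left) (h : k ≫ B.obj.hom = A.obj.hom) :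
    A ⟶ B :=
  ObjectProperty.homMk (Over.homMk k h)

lemma fib (A : FibOver Z) : Fibration A.obj.hom := ⟨A.property⟩

lemma w {A B : FibOver Z} (f : A ⟶ B) : f.hom.left ≫ B.obj.hom = A.obj.hom := Over.w f.hom

lemma hom_ext {A B : FibOver Z} {f g : A ⟶ B} (h : f.hom.left = g.hom.left) : f = g :=
  ObjectProperty.hom_ext _ (Over.OverMorphism.ext h)

lemma comp_left {A B E : FibOver Z} (f : A ⟶ B) (g : B ⟶ E) :
    (f ≫ g).hom.left = f.hom.left ≫ g.hom.left := rfl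

lemma isIso_left {A B : FibOver Z} (f : A ⟶ B) [IsIso f] : IsIso f.hom.left :=
  inferInstanceAs (IsIso ((FibOver.total Z).map f))

lemma isPullback_of_left {P A B E : FibOver Z} {t : P ⟶ B} {l : P ⟶ A} {g : B ⟶ E} {f : A ⟶ E}
    (h : IsPullback t.hom.left l.hom.left g.hom.left f.hom.left) : IsPullback t l g f :=
  isPullback_of_exists_lift (hom_ext h.w)
    (fun a b e => ⟨homMk (h.lift a.hom.left b.hom.left (congrArg (·.hom.left) e))
      (by rw [← w t, h.lift_fst_assoc, w]), hom_ext (h.lift_fst _ _ _),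
      hom_ext (h.lift_snd _ _ _)⟩)
    (fun _ _ h₁ h₂ => hom_ext (h.hom_ext (congrArg (·.hom.left) h₁) (congrArg (·.hom.left) h₂)))

variable [HasFibrationPullbacks C]

lemma exists_isPullback {A B E : FibOver Z} (f : A ⟶ E) {g : B ⟶ E} (hg : Fibration g) :
    ∃ (P : FibOver Z) (t : P ⟶ B) (l : P ⟶ A),
      IsPullback t.hom.left l.hom.left g.hom.left f.hom.left := by
  have h₁ : Fibration g.hom.left := hg.mem
  have h₂ : Fibration (pullback.fst f.hom.left g.hom.left ≫ A.obj.hom) :=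
    fibration_comp inferInstance A.fib
  refine ⟨of _ h₂, homMk (pullback.snd f.hom.left g.hom.left) ?_, homMk (pullback.fst _ _) rfl,
    (IsPullback.of_hasPullback f.hom.left g.hom.left).flip⟩
  dsimp
  rw [← w g, ← w f, pullback.condition_assoc]

lemma isPullback_left {P A B E : FibOver Z} {t : P ⟶ B} {l : P ⟶ A} {g : B ⟶ E} {f : A ⟶ E}
    (h : IsPullback t l g f) (hg : Fibration g) :
    IsPullback t.hom.left l.hom.left g.hom.left f.hom.left := by
  obtain ⟨Q, t', l', hQ⟩ := exists_isPullback f hg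
  let φ := h.isoIsPullback _ _ (isPullback_of_left hQ)
  have e₁ : φ.hom.hom.left ≫ t'.hom.left = t.hom.left :=
    congrArg (·.hom.left) (h.isoIsPullback_hom_fst _ _ (isPullback_of_left hQ))
  have e₂ : φ.hom.hom.left ≫ l'.hom.left = l.hom.left :=
    congrArg (·.hom.left) (h.isoIsPullback_hom_snd _ _ (isPullback_of_left hQ))
  have := isIso_left φ.hom
  exact hQ.of_iso (asIso φ.hom.hom.left).symm (Iso.refl _) (Iso.refl _) (Iso.refl _)
    (by simp [← e₁]) (by simp [← e₂]) (by simp) (by simp)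

instance : HasFibrationPullbacks (FibOver Z) where
  hasTerminal := by
    have h : Fibration (𝟙 Z) := fibration_of_iso _
    exact (IsTerminal.ofUniqueHom (Y := of (𝟙 Z) h)
      (fun A => homMk A.obj.hom (Category.comp_id _))
      (fun A m => hom_ext ((Category.comp_id _).symm.trans (w m)))).hasTerminal
  fibration_of_isIso f _ := by
    have := isIso_left f
    exact ⟨fibration_of_iso f.hom.left⟩
  fibration_comp f g hf hg := ⟨fibration_comp hf.mem hg.mem⟩
  fibration_terminal {X T} f := by
    rintro ⟨hT⟩
    have h : Fibration (𝟙 Z) := fibration_of_iso _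
    let k : T ⟶ of (𝟙 Z) h := homMk T.obj.hom (Category.comp_id _)
    let k' : of (𝟙 Z) h ⟶ T := hT.from _
    have e₁ : k'.hom.left ≫ T.obj.hom = 𝟙 Z := w k'
    have e₂ : T.obj.hom ≫ k'.hom.left = 𝟙 T.obj.left :=
      congrArg (·.hom.left) (hT.hom_ext (k ≫ k') (𝟙 T))
    have : IsIso T.obj.hom := ⟨_, e₂, e₁⟩
    refine ⟨fibration_of_arrow_iso X.fib (𝟙 _) T.obj.hom ?_⟩
    rw [Category.id_comp, w]
  hasPullback f g hg := by
    obtain ⟨P, t, l, h⟩ := exists_isPullback f hg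
    exact (isPullback_of_left h).flip.hasPullback
  fibration_pullback h hg := ⟨fibration_of_isPullback (isPullback_left h hg) hg.mem⟩

/-- A lifting problem in `C` against `p : E ⟶ F` is unchanged when `p` is pulled back to a fibration
over `B`, and this pullback is then an object of `FibOver Z`. -/
lemma isAcyclicCofibration_iff {A B : FibOver Z} (i : A ⟶ B) :
    IsAcyclicCofibration i ↔ IsAcyclicCofibration i.hom.left := by
  constructor
  · refine fun hi => .of_exists_lift fun {E F} p hp f g sq => ?_
    have h : Fibration (pullback.fst g p ≫ B.obj.hom) := fibration_comp inferInstance B.fib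
    let q : of _ h ⟶ B := homMk (pullback.fst g p) rfl
    have hq : Fibration q := ⟨inferInstanceAs (Fibration (pullback.fst g p))⟩
    let s : A ⟶ of _ h := homMk (pullback.lift i.hom.left f sq.symm) (by
      dsimp; rw [pullback.lift_fst_assoc, w])
    obtain ⟨l, h₁, h₂⟩ := hi.exists_lift hq s (𝟙 B) (by
      refine hom_ext ?_
      rw [Category.comp_id]
      exact pullback.lift_fst _ _ _)
    have e₁ : i.hom.left ≫ l.hom.left = pullback.lift i.hom.left f sq.symm :=
      congrArg (·.hom.left) h₁
    have e₂ : l.hom.left ≫ pullback.fst g p = 𝟙 _ := congrArg (·.hom.left) h₂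
    refine ⟨l.hom.left ≫ pullback.snd g p, ?_, ?_⟩
    · rw [← Category.assoc, e₁, pullback.lift_snd]
    · rw [Category.assoc, ← pullback.condition, reassoc_of% e₂]
  · refine fun hi => .of_exists_lift fun {E F} p hp f g sq => ?_
    obtain ⟨l, h₁, h₂⟩ := hi.exists_lift hp.mem f.hom.left g.hom.left (congrArg (·.hom.left) sq)
    exact ⟨homMk l (by rw [← w p, reassoc_of% h₂, w]), hom_ext h₁, hom_ext h₂⟩

end

variable {C : Type u} [Category.{v} C] [CategoryWithFibrations C] [FibrationCategory C] {Z : C}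

instance : FibrationCategory (FibOver Z) where
  factorization {X Y} f := by
    obtain ⟨W, i, p, hi, hp, e⟩ := FibrationCategory.factorization f.hom.left
    have h : Fibration (p ≫ Y.obj.hom) := fibration_comp hp Y.fib
    exact ⟨of _ h, homMk i (by dsimp; rw [reassoc_of% e, w]), homMk p rfl,
      (isAcyclicCofibration_iff _).2 hi, ⟨hp⟩, hom_ext e⟩
  acyclicCofibration_pullback h hg hf := (isAcyclicCofibration_iff _).2
    (FibrationCategory.acyclicCofibration_pullback (isPullback_left h hg) hg.mem
      ((isAcyclicCofibration_iff _).1 hf))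

/-- A path object over `Z` is in general not a path object in `C`, but its `refl` is an acyclic
cofibration in `C`, and this alone makes the endpoint maps homotopic. -/
lemma homotopic_left {A B : FibOver Z} {f g : A ⟶ B} (h : Homotopic f g) :
    Homotopic f.hom.left g.hom.left := by
  obtain ⟨P, H, rfl, rfl⟩ := h
  exact (((isAcyclicCofibration_iff _).1 P.acyclic).homotopic
    ((congrArg (·.hom.left) P.refl_src).trans
      (congrArg (·.hom.left) P.refl_tgt).symm)).precomp H.hom.left

/-- Homotopies in `C` need not lie over `Z`. For an acyclic fibration, `exists_fibrewise_section`
supplies homotopies over its codomain, hence over `Z`; a general homotopy equivalence reduces to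
acyclic fibrations by Brown's factorization over `Z`. -/
lemma isHomotopyEquiv_iff {A B : FibOver Z} (f : A ⟶ B) :
    IsHomotopyEquiv f ↔ IsHomotopyEquiv f.hom.left := by
  constructor
  · rintro ⟨g, h₁, h₂⟩
    exact ⟨g.hom.left, homotopic_left h₁, homotopic_left h₂⟩
  · intro h
    have acyclic {E F : FibOver Z} (p : E ⟶ F) (hp : Fibration p.hom.left)
        (hp' : IsHomotopyEquiv p.hom.left) : IsHomotopyEquiv p := by
      obtain ⟨s, P, i, a, b, K, hs, hi, ha, hia, hib, hab, hKa, hKb⟩ :=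
        exists_fibrewise_section hp hp'
      have hP : Fibration (a ≫ E.obj.hom) := fibration_comp ha E.fib
      let s' : F ⟶ E := homMk s (by rw [← w p, reassoc_of% hs])
      let i' : E ⟶ of _ hP := homMk i (by dsimp; rw [reassoc_of% hia])
      let a' : of _ hP ⟶ E := homMk a rfl
      let b' : of _ hP ⟶ E := homMk b (by dsimp; rw [← w p, reassoc_of% hab])
      let K' : E ⟶ of _ hP := homMk K (by
        dsimp; rw [← w p, reassoc_of% hKa, reassoc_of% hs, w])
      have hi' : IsAcyclicCofibration i' := (isAcyclicCofibration_iff _).2 hi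
      have := (hi'.homotopic (a := a') (b := b') (hom_ext (hia.trans hib.symm))).precomp K'
      have e₁ : K' ≫ a' = p ≫ s' := hom_ext hKa
      have e₂ : K' ≫ b' = 𝟙 E := hom_ext hKb
      rw [e₁, e₂] at this
      exact ⟨s', this, .of_eq (hom_ext hs)⟩
    obtain ⟨N, i, r, q, hi, hiq, hq, hrf, hre, hqf, hqe⟩ :=
      h.exists_factorization A.fib B.fib (w f)
    have hN : Fibration (r ≫ A.obj.hom) := fibration_comp hrf A.fib
    let i' : A ⟶ of _ hN := homMk i (by dsimp; rw [reassoc_of% hi])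
    let r' : of _ hN ⟶ A := homMk r rfl
    let q' : of _ hN ⟶ B := homMk q hq
    have e₁ : i' ≫ r' = 𝟙 A := hom_ext hi
    have e₂ : i' ≫ q' = f := hom_ext hiq
    rw [← e₂]
    exact ((acyclic r' hrf hre).of_section e₁).comp (acyclic q' hqf hqe)

end FibOver

/-! ## Reedy limits -/

/-- Well-founded construction of a family of elements related along the order. -/
lemma exists_compatible_family {J : Type*} [PartialOrder J] [WellFoundedLT J] {X : J → Type*}
    (R : ∀ {i j : J}, i < j → X i → X j → Prop)
    (ext : ∀ (j : J) (f : ∀ i, i < j → X i),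
      (∀ i k (h : i < k) (hk : k < j), R h (f i (h.trans hk)) (f k hk)) →
        ∃ x : X j, ∀ i (h : i < j), R h (f i h) x) :
    ∃ f : ∀ j, X j, ∀ i j (h : i < j), R h (f i) (f j) := by
  classical
  -- An extension is available only when the earlier values are compatible, which is not known
  -- during the recursion. So the recursion is carried out in `Option`, with `none` in the
  -- incompatible case, and `key` shows that `none` never occurs.
  let step (j : J) (prev : ∀ i, i < j → Option (X i)) : Option (X j) :=
    if h : ∃ f : ∀ i, i < j → X i, (∀ i hi, prev i hi = some (f i hi)) ∧
      ∀ i k (h : i < k) (hk : k < j), R h (f i (h.trans hk)) (f k hk) then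
      some (ext j h.choose h.choose_spec.2).choose else none
  let g : ∀ j, Option (X j) := (wellFounded_lt (α := J)).fix step
  have hg (j : J) : g j = step j (fun i _ => g i) := WellFounded.fix_eq _ _ _
  have key (j : J) : ∃ x, g j = some x ∧ ∀ i (hi : i < j), ∃ y, g i = some y ∧ R hi y x := by
    induction j using (wellFounded_lt (α := J)).induction with
    | _ j ih =>
      choose f hf hf' using ih
      have h : ∃ f : ∀ i, i < j → X i, (∀ i hi, g i = some (f i hi)) ∧
          ∀ i k (h : i < k) (hk : k < j), R h (f i (h.trans hk)) (f k hk) := by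
        refine ⟨f, hf, fun i k h hk => ?_⟩
        obtain ⟨y, hy, hR⟩ := hf' k hk i h
        rw [hf i (h.trans hk), Option.some_inj] at hy
        exact hy ▸ hR
      refine ⟨(ext j h.choose h.choose_spec.2).choose, ?_, fun i hi =>
        ⟨h.choose i hi, h.choose_spec.1 i hi, (ext j h.choose h.choose_spec.2).choose_spec i hi⟩⟩
      rw [hg]
      exact dif_pos h
  choose f hf hf' using key
  refine ⟨f, fun i j h => ?_⟩
  obtain ⟨y, hy, hR⟩ := hf' j i h
  rw [hf i, Option.some_inj] at hy
  exact hy ▸ hR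

section Reedy

variable {J : Type w} [PartialOrder J] {D : Type u} [Category.{v} D]

/-- The structure map of a diagram on `Jᵒᵖ`. -/
abbrev resMap (A : Jᵒᵖ ⥤ D) {i j : J} (h : i ≤ j) : A.obj (op j) ⟶ A.obj (op i) :=
  A.map (homOfLE h).op

/-- Cones over a diagram on the opposite of a poset. -/
def coneMk (A : Jᵒᵖ ⥤ D) {W : D} (g : ∀ j : J, W ⟶ A.obj (op j))
    (hg : ∀ {i j : J} (h : i < j), g j ≫ resMap A h.le = g i) : Cone A where
  pt := W
  π :=
    { app := fun j => g j.unop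
      naturality := fun a b f => by
        have hle : b.unop ≤ a.unop := f.unop.le
        rcases hle.eq_or_lt with h | h
        · obtain rfl : b = a := congrArg op h
          obtain rfl : f = 𝟙 _ := Subsingleton.elim _ _
          exact (Category.id_comp _).trans ((Category.comp_id _).symm.trans
            (congrArg (g _ ≫ ·) (A.map_id _).symm))
        · exact (Category.id_comp _).trans (hg h).symm }

lemma resMap_natTrans {A B : Jᵒᵖ ⥤ D} (f : A ⟶ B) {i j : J} (h : i ≤ j) :
    resMap A h ≫ f.app (op i) = f.app (op j) ≫ resMap B h := f.naturality _

lemma strictIncl_ext {A : Jᵒᵖ ⥤ D} {j : J} {W : D} {c : Cone (strictIncl j ⋙ A)}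
    (hc : IsLimit c) {a b : W ⟶ c.pt}
    (h : ∀ i : Set.Iio j, a ≫ c.π.app (op i) = b ≫ c.π.app (op i)) : a = b :=
  hc.hom_ext fun i => h i.unop

lemma toMatchingLimit_π (A : Jᵒᵖ ⥤ D) (j : J) [HasLimit (strictIncl j ⋙ A)] {i : J} (h : i < j) :
    toMatchingLimit A j ≫ limit.π (strictIncl j ⋙ A) (op ⟨i, Set.mem_Iio.2 h⟩) = resMap A h.le :=
  limit.lift_π (matchingCone A j) (op ⟨i, Set.mem_Iio.2 h⟩)

variable [CategoryWithFibrations D]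

/-- The component at `j` lifts `i_j` against the fibration `E_j ⟶ M_j E`; the lower map of the
square is assembled from the components already built below `j`, and the lower triangle gives
compatibility with them. -/
lemma natTrans_exists_extension [WellFoundedLT J] {A A' E : Jᵒᵖ ⥤ D} (i : A ⟶ A')
    (hi : ∀ j, IsAcyclicCofibration (i.app j)) (hE : IsReedyFibrantDiagram E) (k : A ⟶ E) :
    ∃ k' : A' ⟶ E, i ≫ k' = k := by
  obtain ⟨f, hf⟩ := exists_compatible_family
    (X := fun j => {l : A'.obj (op j) ⟶ E.obj (op j) // i.app _ ≫ l = k.app _})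
    (fun {a b} h l m => resMap A' h.le ≫ l.1 = m.1 ≫ resMap E h.le) (by
      intro j f hf
      obtain ⟨_, hfib⟩ := hE j
      let c : Cone (strictIncl j ⋙ E) :=
        coneMk (strictIncl j ⋙ E) (W := A'.obj (op j))
          (fun a => resMap A' (show a.1 < j from a.2).le ≫ (f a.1 a.2).1) (fun {a b} h => by
            have hb : b.1 < j := b.2
            have e := hf a.1 b.1 h hb
            have e' : resMap A' hb.le ≫ resMap A' (show a.1 < b.1 from h).le =
              resMap A' ((show a.1 < b.1 from h).trans hb).le := (A'.map_comp _ _).symm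
            refine (Category.assoc _ _ _).trans ((congrArg (resMap A' hb.le ≫ ·) e.symm).trans ?_)
            exact (Category.assoc _ _ _).symm.trans (congrArg (· ≫ (f a.1 _).1) e'))
      obtain ⟨d, hd⟩ : ∃ d : A'.obj (op j) ⟶ limit (strictIncl j ⋙ E), ∀ a (ha : a < j),
          d ≫ limit.π (strictIncl j ⋙ E) (op ⟨a, Set.mem_Iio.2 ha⟩) = resMap A' ha.le ≫ (f a ha).1 :=
        ⟨limit.lift _ c, fun a ha => limit.lift_π c (op ⟨a, Set.mem_Iio.2 ha⟩)⟩
      obtain ⟨l, h₁, h₂⟩ := (hi (op j)).exists_lift hfib (k.app _) d (by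
        refine strictIncl_ext (limit.isLimit _) fun a => ?_
        have ha : a.1 < j := a.2
        have e₁ := toMatchingLimit_π E j ha
        refine (Category.assoc _ _ _).trans ((congrArg (k.app (op j) ≫ ·) e₁).trans ?_)
        refine Eq.trans ?_ ((congrArg (i.app (op j) ≫ ·) (hd a.1 ha)).symm.trans
          (Category.assoc _ _ _).symm)
        have h' := resMap_natTrans i ha.le
        refine (resMap_natTrans k ha.le).symm.trans (Eq.trans ?_
          ((congrArg (· ≫ (f a.1 ha).1) h').trans (Category.assoc _ _ _)))
        rw [Category.assoc, (f a.1 ha).2])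
      refine ⟨⟨l, h₁⟩, fun a ha => ?_⟩
      rw [← hd a ha, ← h₂, Category.assoc, toMatchingLimit_π _ _ ha]
      exact rfl)
  refine ⟨{ app := fun j => (f j.unop).1, naturality := fun a b g => ?_ }, ?_⟩
  · have hle : b.unop ≤ a.unop := g.unop.le
    rcases hle.eq_or_lt with h | h
    · obtain rfl : b = a := congrArg op h
      obtain rfl : g = 𝟙 _ := Subsingleton.elim _ _
      rw [A'.map_id, E.map_id, Category.id_comp, Category.comp_id]
    · exact hf _ _ h
  · ext j
    exact (f j.unop).2

end Reedy

/-! ### Reedy limits over `Z` tested on arbitrary maps to `Z`. -/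

section Total

variable {C : Type u} [Category.{v} C] [CategoryWithFibrations C] [FibrationCategory C] {Z : C}

/-- The mapping path object `W ×_Z P` is fibred over `Z` even when `f` is not a fibration: `W ×_Z P
⟶ W ⨯ Z` is a pullback of `P ⟶ Z ⨯ Z`. -/
lemma PathObj.fibration_pullback_tgt (P : PathObj Z) {W : C} (f : W ⟶ Z)
    [Fibration P.src] : Fibration (pullback.snd f P.src ≫ P.tgt) := by
  have h : IsPullback (pullback.snd f P.src)
      (prod.lift (pullback.fst f P.src) (pullback.snd f P.src ≫ P.tgt))
      (prod.lift P.src P.tgt) (prod.lift (prod.fst ≫ f) prod.snd) := by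
    refine isPullback_of_exists_lift ?_ (fun {V} a b e => ?_) (fun {V} s s' h₁ h₂ => ?_)
    · apply Limits.prod.hom_ext <;> simp [pullback.condition]
    · have e₁ := congrArg (· ≫ prod.fst) e
      have e₂ := congrArg (· ≫ prod.snd) e
      simp only [Category.assoc, prod.lift_fst, prod.lift_snd] at e₁ e₂
      refine ⟨pullback.lift (b ≫ prod.fst) a (by simp [e₁]), by simp, ?_⟩
      apply Limits.prod.hom_ext <;> simp [e₂]
    · apply pullback.hom_ext
      · simpa using congrArg (· ≫ prod.fst) h₂
      · exact h₁
  have := fibration_lift_snd (fibration_of_isPullback h P.fibration_lift)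
  exact this

variable {J : Type w} [PartialOrder J] [WellFoundedLT J] {E : Jᵒᵖ ⥤ FibOver Z}

/-- Limits of Reedy fibrant diagrams of fibrations over `Z` are limits in the full slice over
`Z`. -/
lemma FibOver.isLimit_over (hE : IsReedyFibrantDiagram E) {c : Cone E} (hc : IsLimit c) :
    (∀ {W : C} (f : W ⟶ Z) (γ : ∀ j : J, W ⟶ (E.obj (op j)).obj.left),
      (∀ j, γ j ≫ (E.obj (op j)).obj.hom = f) →
      (∀ {i j : J} (h : i ≤ j), γ j ≫ (resMap E h).hom.left = γ i) →
      ∃ m : W ⟶ c.pt.obj.left, m ≫ c.pt.obj.hom = f ∧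
        ∀ j, m ≫ (c.π.app (op j)).hom.left = γ j) ∧
    ∀ {W : C} {m m' : W ⟶ c.pt.obj.left}, m ≫ c.pt.obj.hom = m' ≫ c.pt.obj.hom →
      (∀ j : J, m ≫ (c.π.app (op j)).hom.left = m' ≫ (c.π.app (op j)).hom.left) → m = m' := by
  obtain ⟨P⟩ := exists_pathObj Z
  have hs : Fibration P.src := P.fibration_src
  -- `T f` replaces an arbitrary map to `Z` by its mapping path fibration, functorially via `τ`; `ρ`
  -- attaches constant paths.
  let T {W : C} (f : W ⟶ Z) : FibOver Z := .of _ (P.fibration_pullback_tgt f)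
  let τ {W W' : C} {f : W ⟶ Z} {f' : W' ⟶ Z} (m : W ⟶ W') (h : m ≫ f' = f) : T f ⟶ T f' :=
    FibOver.homMk (pullback.lift (pullback.fst _ _ ≫ m) (pullback.snd _ _)
      (by rw [Category.assoc, h, pullback.condition])) (by simp [T])
  have τ_congr {W W' : C} {f : W ⟶ Z} {f' : W' ⟶ Z} {m m' : W ⟶ W'} (e : m = m')
      (h : m ≫ f' = f) (h' : m' ≫ f' = f) : τ m h = τ m' h' := by
    subst e; rfl
  let ρ {W : C} (f : W ⟶ Z) : W ⟶ (T f).obj.left :=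
    pullback.lift (𝟙 W) (f ≫ P.refl) (by simp [P.refl_src])
  have hρT {W : C} (f : W ⟶ Z) : ρ f ≫ (T f).obj.hom = f := by simp [ρ, T, P.refl_tgt]
  have ρτ {W W' : C} {f : W ⟶ Z} {f' : W' ⟶ Z} (m : W ⟶ W') (h : m ≫ f' = f) :
      ρ f ≫ (τ m h).hom.left = m ≫ ρ f' := by
    apply pullback.hom_ext <;> simp [ρ, τ, reassoc_of% h]
  have ττ {W W' W'' : C} {f : W ⟶ Z} {f' : W' ⟶ Z} {f'' : W'' ⟶ Z} (m : W ⟶ W') (m' : W' ⟶ W'')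
      (h : m ≫ f' = f) (h' : m' ≫ f'' = f') :
      τ m h ≫ τ m' h' = τ (m ≫ m') (by rw [Category.assoc, h', h]) := by
    refine FibOver.hom_ext ?_
    rw [FibOver.comp_left]
    apply pullback.hom_ext <;> simp [τ]
  let E' : Jᵒᵖ ⥤ FibOver Z :=
    { obj := fun j => T (E.obj j).obj.hom
      map := fun g => τ (E.map g).hom.left (FibOver.w (E.map g))
      map_id := fun j => by
        refine FibOver.hom_ext ?_
        apply pullback.hom_ext
        · exact (pullback.lift_fst _ _ _).trans ((congrArg (fun t => pullback.fst _ _ ≫ t.hom.left)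
            (E.map_id j)).trans ((Category.comp_id _).trans (Category.id_comp _).symm))
        · exact (pullback.lift_snd _ _ _).trans (Category.id_comp _).symm
      map_comp := fun g g' => by
        refine Eq.trans ?_ (ττ _ _ (FibOver.w (E.map g)) (FibOver.w (E.map g'))).symm
        exact τ_congr (congrArg (·.hom.left) (E.map_comp g g')) (FibOver.w _)
          (FibOver.w (E.map g ≫ E.map g')) }
  let i : E ⟶ E' :=
    { app := fun j => FibOver.homMk (ρ (E.obj j).obj.hom) (hρT _)
      naturality := fun a b g => FibOver.hom_ext (ρτ _ (FibOver.w (E.map g))).symm }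
  -- Each `E_j ⟶ T E_j` is a pullback of `P.refl` along a fibration, hence an acyclic cofibration,
  -- so the identity of the Reedy fibrant diagram `E` extends to a retraction `k : E' ⟶ E` natural
  -- in `j`.
  obtain ⟨k, hk⟩ := natTrans_exists_extension i (fun j => by
    refine (FibOver.isAcyclicCofibration_iff _).2 ?_
    exact FibrationCategory.acyclicCofibration_pullback
      (isPullback_section (E.obj j).obj.hom P.refl_src)
      (have := (E.obj j).fib; inferInstance) P.acyclic) hE (𝟙 E)
  have hk' (j : J) : ρ (E.obj (op j)).obj.hom ≫ (k.app (op j)).hom.left = 𝟙 _ :=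
    congrArg (fun t : E ⟶ E => (t.app (op j)).hom.left) hk
  -- A cone with vertex `W` becomes a cone in `FibOver Z` with vertex `T f`, using `k`;
  -- precomposition with `ρ f` recovers the original cone.
  have ex {W : C} (f : W ⟶ Z) (γ : ∀ j : J, W ⟶ (E.obj (op j)).obj.left)
      (hf : ∀ j, γ j ≫ (E.obj (op j)).obj.hom = f)
      (hγ : ∀ {i j : J} (h : i ≤ j), γ j ≫ (resMap E h).hom.left = γ i) :
      ∃ m : T f ⟶ c.pt, ∀ j, m ≫ c.π.app (op j) = τ (γ j) (hf j) ≫ k.app (op j) := by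
    let d : Cone E := coneMk E (fun j => τ (γ j) (hf j) ≫ k.app (op j)) (fun {a b} h => by
      have e₁ : resMap E' h.le = τ (resMap E h.le).hom.left (FibOver.w (resMap E h.le)) := rfl
      rw [Category.assoc, ← resMap_natTrans k h.le, e₁, ← Category.assoc,
        ττ (γ b) _ (hf b) (FibOver.w (resMap E h.le))]
      exact congrArg (· ≫ k.app _) (τ_congr (hγ h.le) (by rw [hγ h.le, hf]) (hf a)))
    exact ⟨hc.lift d, fun j => hc.fac d (op j)⟩
  refine ⟨fun {W} f γ hf hγ => ?_, fun {W m m'} hm h => ?_⟩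
  · obtain ⟨m, hm⟩ := ex f γ hf hγ
    refine ⟨ρ f ≫ m.hom.left, by rw [Category.assoc, FibOver.w, hρT], fun j => ?_⟩
    rw [Category.assoc, ← FibOver.comp_left, hm, FibOver.comp_left, ← Category.assoc, ρτ (γ j) (hf j),
      Category.assoc, hk', Category.comp_id]
  -- For uniqueness the limit itself is a retract of its mapping path object through `r`. A map `n`
  -- to the limit is thus recovered from `τ n ≫ r`, a map in `FibOver Z`, which is determined by its
  -- projections.
  · obtain ⟨r, hr⟩ := ex c.pt.obj.hom (fun j => (c.π.app (op j)).hom.left)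
      (fun j => FibOver.w (c.π.app (op j))) (fun {i j} h => congrArg (·.hom.left) (c.w (homOfLE h).op))
    let ι : c.pt ⟶ T c.pt.obj.hom := FibOver.homMk (ρ c.pt.obj.hom) (hρT _)
    have hι : ι ≫ r = 𝟙 c.pt := by
      refine hc.hom_ext fun j => FibOver.hom_ext ?_
      rw [Category.assoc, hr, Category.id_comp, FibOver.comp_left, FibOver.comp_left,
        ← Category.assoc]
      exact (congrArg (· ≫ (k.app j).hom.left) (ρτ _ (FibOver.w (c.π.app j)))).trans
        ((Category.assoc _ _ _).trans
          ((congrArg (_ ≫ ·) (hk' j.unop)).trans (Category.comp_id _)))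
    have hι' : ρ c.pt.obj.hom ≫ r.hom.left = 𝟙 _ := congrArg (·.hom.left) hι
    have e : τ m rfl ≫ r = τ m' hm.symm ≫ r := by
      refine hc.hom_ext fun j => ?_
      obtain ⟨j⟩ := j
      rw [Category.assoc, Category.assoc, hr, ← Category.assoc, ← Category.assoc]
      refine (congrArg (· ≫ k.app (op j)) (ττ m _ rfl (FibOver.w (c.π.app (op j))))).trans
        (Eq.trans ?_ (congrArg (· ≫ k.app (op j))
          (ττ m' _ hm.symm (FibOver.w (c.π.app (op j))))).symm)
      exact congrArg (· ≫ k.app (op j)) (τ_congr (h j)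
        (by rw [Category.assoc]; exact congrArg (m ≫ ·) (FibOver.w (c.π.app (op j))))
        (by rw [Category.assoc]; exact (congrArg (m' ≫ ·) (FibOver.w (c.π.app (op j)))).trans hm.symm))
    have key (n : W ⟶ c.pt.obj.left) (hn : n ≫ c.pt.obj.hom = m ≫ c.pt.obj.hom) :
        n = ρ _ ≫ (τ n hn ≫ r).hom.left := by
      rw [FibOver.comp_left, ← Category.assoc, ρτ n hn, Category.assoc, hι', Category.comp_id]
    rw [key m rfl, key m' hm.symm, e]

end Total

/-! ### Reedy conditions and maps of limits for arbitrary limit cones. -/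

section Transfer

variable {J : Type w} [PartialOrder J] {D : Type u} [Category.{v} D] [CategoryWithFibrations D]

/-- Reedy fibrancy can be checked on any choice of matching objects. -/
lemma isReedyFibrantDiagram_of_isLimit [HasFibrationPullbacks D] {A : Jᵒᵖ ⥤ D}
    (h : ∀ j : J, ∃ (c : Cone (strictIncl j ⋙ A)) (_ : IsLimit c) (a : A.obj (op j) ⟶ c.pt),
      (∀ i, a ≫ c.π.app i = (matchingCone A j).π.app i) ∧ Fibration a) :
    IsReedyFibrantDiagram A := fun j => by
  obtain ⟨c, hc, a, ha, hf⟩ := h j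
  have : HasLimit (strictIncl j ⋙ A) := ⟨⟨⟨c, hc⟩⟩⟩
  refine ⟨this, ?_⟩
  have e : toMatchingLimit A j =
      a ≫ (hc.conePointUniqueUpToIso (limit.isLimit (strictIncl j ⋙ A))).hom := by
    refine (limit.isLimit _).hom_ext fun i => ?_
    rw [Category.assoc, IsLimit.conePointUniqueUpToIso_hom_comp, ha]
    exact limit.lift_π _ _
  rw [e]
  exact fibration_comp hf (fibration_of_iso _)

/-- Reedy fibrations can be recognized on any choice of matching objects. -/
lemma isReedyFibrationOfDiagrams_of_isLimit [HasFibrationPullbacks D] {A B : Jᵒᵖ ⥤ D} (f : A ⟶ B)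
    (h : ∀ j : J, ∃ (c : Cone (strictIncl j ⋙ A)) (_ : IsLimit c)
      (c' : Cone (strictIncl j ⋙ B)) (_ : IsLimit c') (a : A.obj (op j) ⟶ c.pt)
      (b : B.obj (op j) ⟶ c'.pt) (ℓ : c.pt ⟶ c'.pt) (Q : D) (x : Q ⟶ B.obj (op j))
      (y : Q ⟶ c.pt) (s : A.obj (op j) ⟶ Q),
      (∀ i, a ≫ c.π.app i = (matchingCone A j).π.app i) ∧
      (∀ i, b ≫ c'.π.app i = (matchingCone B j).π.app i) ∧
      (∀ i, ℓ ≫ c'.π.app i = c.π.app i ≫ f.app ((strictIncl j).obj i)) ∧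
      IsPullback x y b ℓ ∧ s ≫ x = f.app (op j) ∧ s ≫ y = a ∧ Fibration b ∧ Fibration s) :
    IsReedyFibrationOfDiagrams f := fun j => by
  obtain ⟨c, hc, c', hc', a, b, ℓ, Q, x, y, s, ha, hb, hℓ, hQ, hx, hy, hbf, hsf⟩ := h j
  have hA : HasLimit (strictIncl j ⋙ A) := ⟨⟨⟨c, hc⟩⟩⟩
  have hB : HasLimit (strictIncl j ⋙ B) := ⟨⟨⟨c', hc'⟩⟩⟩
  let φ := hc.conePointUniqueUpToIso (limit.isLimit (strictIncl j ⋙ A))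
  let ψ := hc'.conePointUniqueUpToIso (limit.isLimit (strictIncl j ⋙ B))
  have hφ (i) : φ.hom ≫ limit.π (strictIncl j ⋙ A) i = c.π.app i :=
    IsLimit.conePointUniqueUpToIso_hom_comp _ _ _
  have hψ (i) : ψ.hom ≫ limit.π (strictIncl j ⋙ B) i = c'.π.app i :=
    IsLimit.conePointUniqueUpToIso_hom_comp _ _ _
  have e₁ : toMatchingLimit A j = a ≫ φ.hom := by
    refine (limit.isLimit _).hom_ext fun i => ?_
    rw [Category.assoc]
    exact (limit.lift_π _ _).trans ((ha i).symm.trans (congrArg (a ≫ ·) (hφ i).symm))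
  have e₂ : toMatchingLimit B j = b ≫ ψ.hom := by
    refine (limit.isLimit _).hom_ext fun i => ?_
    rw [Category.assoc]
    exact (limit.lift_π _ _).trans ((hb i).symm.trans (congrArg (b ≫ ·) (hψ i).symm))
  have e₃ : φ.hom ≫ matchingLimitMap f j = ℓ ≫ ψ.hom := by
    refine (limit.isLimit _).hom_ext fun i => ?_
    rw [Category.assoc, Category.assoc]
    have := limMap_π (Functor.whiskerLeft (strictIncl j) f) i
    refine (congrArg (φ.hom ≫ ·) this).trans ?_
    rw [reassoc_of% hφ i]
    exact (hℓ i).symm.trans (congrArg (ℓ ≫ ·) (hψ i).symm)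
  have hQ' : IsPullback (y ≫ φ.hom) x (matchingLimitMap f j) (toMatchingLimit B j) := by
    refine hQ.flip.of_iso (Iso.refl _) φ (Iso.refl _) ψ (by simp) (by simp) e₃.symm
      (by simp [e₂])
  have hP : HasPullback (matchingLimitMap f j) (toMatchingLimit B j) := hQ'.hasPullback
  refine ⟨hA, hB, hP, ?_⟩
  have e : pullback.lift (toMatchingLimit A j) (f.app (op j)) (toMatchingLimit_naturality f j) =
      s ≫ hQ'.isoPullback.hom := by
    apply pullback.hom_ext
    · simp [e₁, reassoc_of% hy]
    · simp [hx]
  rw [e]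
  exact fibration_comp hsf (fibration_of_iso _)

variable {A B : Jᵒᵖ ⥤ D} (f : A ⟶ B) {c : Cone A} (hc : IsLimit c) {c' : Cone B} (hc' : IsLimit c')
  {m : c.pt ⟶ c'.pt} (hm : ∀ j : J, m ≫ c'.π.app (op j) = c.π.app (op j) ≫ f.app (op j))

include hc hc' hm

omit [CategoryWithFibrations D] in
lemma exists_limMap_iso : ∃ (_ : HasLimit A) (_ : HasLimit B) (φ : c.pt ≅ limit A)
    (ψ : c'.pt ≅ limit B), φ.hom ≫ limMap f = m ≫ ψ.hom := by
  have hA : HasLimit A := ⟨⟨⟨c, hc⟩⟩⟩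
  have hB : HasLimit B := ⟨⟨⟨c', hc'⟩⟩⟩
  refine ⟨hA, hB, hc.conePointUniqueUpToIso (limit.isLimit _),
    hc'.conePointUniqueUpToIso (limit.isLimit _), ?_⟩
  refine (limit.isLimit _).hom_ext fun j => ?_
  have h₁ := hc.conePointUniqueUpToIso_hom_comp (limit.isLimit _) j
  have h₂ := hc'.conePointUniqueUpToIso_hom_comp (limit.isLimit _) j
  have h₃ := limMap_π f j
  rw [Category.assoc, Category.assoc, h₂, hm j.unop]
  exact (congrArg (_ ≫ ·) h₃).trans ((Category.assoc _ _ _).symm.trans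
    (congrArg (· ≫ f.app j) h₁))

lemma HasReedyLimits.fibration_of_isLimit [HasFibrationPullbacks D] (H : HasReedyLimits J D)
    (hA : IsReedyFibrantDiagram A) (hB : IsReedyFibrantDiagram B)
    (hf : IsReedyFibrationOfDiagrams f) : Fibration m := by
  obtain ⟨_, _, φ, ψ, e⟩ := exists_limMap_iso f hc hc' hm
  exact fibration_of_arrow_iso (H.fibration f hA hB hf) φ.hom ψ.hom e

lemma HasReedyLimits.isHomotopyEquiv_of_isLimit [FibrationCategory D] (H : HasReedyLimits J D)
    (hA : IsReedyFibrantDiagram A) (hB : IsReedyFibrantDiagram B)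
    (hf : ∀ j : J, IsHomotopyEquiv (f.app (op j))) : IsHomotopyEquiv m := by
  obtain ⟨_, _, φ, ψ, e⟩ := exists_limMap_iso f hc hc' hm
  exact .of_arrow_iso (H.homotopyEquiv f hA hB hf) φ.hom ψ.hom e

end Transfer

/-! ## Families of maps between diagrams -/

section Fam

variable {C : Type u} [Category.{v} C] [CategoryWithFibrations C] [HasFibrationPullbacks C]
  {K : Type w} [PartialOrder K] {I : InverseCat C K} {T : Type*} {ι : T → K} {X Y : C}

/-- Diagrams on the full subcategory of `I` on the objects `ι z`, with the actions given on
generalized elements. -/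
structure PDiag (I : InverseCat C K) {T : Type*} (ι : T → K) (X : C) where
  obj : T → C
  base : ∀ z, obj z ⟶ X
  anchor : ∀ z, obj z ⟶ I.obj (ι z)
  [fib_base : ∀ z, Fibration (base z)]
  actOn : ∀ {y z : T} (h : ι y < ι z) {V : C} (a : V ⟶ obj z) (b : V ⟶ I.hom h),
    a ≫ anchor z = b ≫ I.src h → (V ⟶ obj y)
  comp_actOn : ∀ {y z : T} (h : ι y < ι z) {V V' : C} (f : V' ⟶ V) (a : V ⟶ obj z)
    (b : V ⟶ I.hom h) (e : a ≫ anchor z = b ≫ I.src h),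
    f ≫ actOn h a b e = actOn h (f ≫ a) (f ≫ b) (by rw [Category.assoc, Category.assoc, e])
  actOn_base : ∀ {y z : T} (h : ι y < ι z) {V : C} (a : V ⟶ obj z) (b : V ⟶ I.hom h)
    (e : a ≫ anchor z = b ≫ I.src h), actOn h a b e ≫ base y = a ≫ base z
  actOn_anchor : ∀ {y z : T} (h : ι y < ι z) {V : C} (a : V ⟶ obj z) (b : V ⟶ I.hom h)
    (e : a ≫ anchor z = b ≫ I.src h), actOn h a b e ≫ anchor y = b ≫ I.tgt h
  actOn_actOn : ∀ {x y z : T} (h : ι y < ι z) (k : ι x < ι y) {V : C} (a : V ⟶ obj z)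
    (b : V ⟶ I.hom h) (c : V ⟶ I.hom k) (e : a ≫ anchor z = b ≫ I.src h)
    (e' : b ≫ I.tgt h = c ≫ I.src k),
    actOn k (actOn h a b e) c (by rw [actOn_anchor, e']) =
      actOn (k.trans h) a (pullback.lift b c e' ≫ I.comp h k)
        (by rw [Category.assoc, I.comp_src, pullback.lift_fst_assoc, e])

attribute [instance] PDiag.fib_base

lemma PDiag.actOn_congr (A : PDiag I ι X) {y z : T} (h : ι y < ι z) {V : C} {a a' : V ⟶ A.obj z}
    {b b' : V ⟶ I.hom h} (e : a ≫ A.anchor z = b ≫ I.src h) (ha : a = a') (hb : b = b') :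
    A.actOn h a b e = A.actOn h a' b' (by rw [← ha, ← hb, e]) := by
  subst ha hb; rfl

omit [CategoryWithFibrations C] [HasFibrationPullbacks C] in
lemma pullback_lift_congr {P Q R V : C} {f : P ⟶ R} {g : Q ⟶ R} [HasPullback f g] {a a' : V ⟶ P}
    {b b' : V ⟶ Q} (ha : a = a') (hb : b = b') (e : a ≫ f = b ≫ g) :
    pullback.lift a b e = pullback.lift a' b' (by rw [← ha, ← hb, e]) := by
  subst ha hb; rfl

lemma fullLt {T : Set K} {y z : T} (h : y.1 < z.1) : y < z := h

/-- A diagram on a full subcategory, with the actions given on generalized elements. -/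
noncomputable def Diag.fullToPDiag {T : Set K} (A : Diag (I.full T) X) :
    PDiag I (fun z : T => z.1) X where
  obj := A.obj
  base := A.base
  anchor := A.anchor
  fib_base := A.fib_base
  actOn h _ a b e := A.actOn (fullLt h) a b e
  comp_actOn h _ _ f a b e := A.comp_actOn (fullLt h) f a b e
  actOn_base h _ a b e := A.actOn_base (fullLt h) a b e
  actOn_anchor h _ a b e := A.actOn_anchor (fullLt h) a b e
  actOn_actOn h k _ a b c e e' :=
    A.act_assoc (fullLt h) (fullLt k) a b c e e'

/-- A map of reindexed diagrams `p^* A ⟶ q^* B` defined only on the objects in `S`. -/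
structure Fam (A : PDiag I ι X) (B : Diag I Y) (S : Set T) {W : C} (p : W ⟶ X)
    (q : W ⟶ Y) where
  app : ∀ z ∈ S, (pullback p (A.base z) ⟶ B.obj (ι z))
  app_base : ∀ z hz, app z hz ≫ B.base (ι z) = pullback.fst p (A.base z) ≫ q
  app_anchor : ∀ z hz, app z hz ≫ B.anchor (ι z) = pullback.snd p (A.base z) ≫ A.anchor z
  app_act : ∀ {y z : T} (h : ι y < ι z) (hy : y ∈ S) (hz : z ∈ S) {V : C} (w : V ⟶ W)
    (a : V ⟶ A.obj z) (e : w ≫ p = a ≫ A.base z) (b : V ⟶ I.hom h)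
    (e' : a ≫ A.anchor z = b ≫ I.src h),
    pullback.lift w (A.actOn h a b e') (by rw [A.actOn_base, e]) ≫ app y hy =
      B.actOn h (pullback.lift w a e ≫ app z hz) b
        (by rw [Category.assoc, app_anchor, pullback.lift_snd_assoc, e'])

namespace Fam

variable {A : PDiag I ι X} {B B' : Diag I Y} {S S' : Set T} {W W' W'' : C} {p : W ⟶ X}
  {q : W ⟶ Y} {p' : W' ⟶ X} {q' : W' ⟶ Y} {p'' : W'' ⟶ X} {q'' : W'' ⟶ Y}

@[ext]
lemma ext' {φ ψ : Fam A B S p q} (h : ∀ z hz, φ.app z hz = ψ.app z hz) : φ = ψ := by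
  obtain ⟨a, _, _, _⟩ := φ
  obtain ⟨b, _, _, _⟩ := ψ
  obtain rfl : a = b := by
    funext z hz
    exact h z hz
  rfl

/-- Base change of families. -/
noncomputable def pull (φ : Fam A B S p q) (f : W' ⟶ W) (hp : f ≫ p = p') (hq : f ≫ q = q') :
    Fam A B S p' q' where
  app z hz := pbMap (A.base z) f hp ≫ φ.app z hz
  app_base z hz := by rw [Category.assoc, φ.app_base, pbMap_fst_assoc, hq]
  app_anchor z hz := by rw [Category.assoc, φ.app_anchor, pbMap_snd_assoc]
  app_act {y z} h hy hz V w a e b e' := by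
    have e₁ : (w ≫ f) ≫ p = a ≫ A.base z := by rw [Category.assoc, hp, e]
    have h₁ : pullback.lift w (A.actOn h a b e') (by rw [PDiag.actOn_base, e]) ≫
        pbMap (A.base y) f hp =
        pullback.lift (w ≫ f) (A.actOn h a b e') (by rw [PDiag.actOn_base, e₁]) := by
      apply pullback.hom_ext <;> simp
    have h₂ : pullback.lift w a e ≫ pbMap (A.base z) f hp = pullback.lift (w ≫ f) a e₁ := by
      apply pullback.hom_ext <;> simp
    rw [← Category.assoc, h₁, φ.app_act h hy hz (w ≫ f) a e₁ b e']
    exact B.actOn_congr _ _ (by rw [← Category.assoc, h₂]) rfl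

@[simp]
lemma pull_app (φ : Fam A B S p q) (f : W' ⟶ W) (hp : f ≫ p = p') (hq : f ≫ q = q') (z : T)
    (hz : z ∈ S) : (φ.pull f hp hq).app z hz = pbMap (A.base z) f hp ≫ φ.app z hz := rfl

lemma pull_pull (φ : Fam A B S p q) (f : W' ⟶ W) (hp : f ≫ p = p') (hq : f ≫ q = q')
    (g : W'' ⟶ W') (hp' : g ≫ p' = p'') (hq' : g ≫ q' = q'') :
    (φ.pull f hp hq).pull g hp' hq' =
      φ.pull (g ≫ f) (by rw [Category.assoc, hp, hp']) (by rw [Category.assoc, hq, hq']) := by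
  ext z hz
  simp [pbMap_pbMap_assoc]

lemma pull_congr (φ : Fam A B S p q) {f f' : W' ⟶ W} (h : f = f') (hp : f ≫ p = p')
    (hq : f ≫ q = q') : φ.pull f hp hq = φ.pull f' (h ▸ hp) (h ▸ hq) := by
  subst h; rfl

lemma pull_id (φ : Fam A B S p q) {f : W ⟶ W} (h : f = 𝟙 W) (hp : f ≫ p = p)
    (hq : f ≫ q = q) : φ.pull f hp hq = φ := by
  ext z hz
  rw [pull_app, pbMap_id _ h, Category.id_comp]

/-- Restriction of families. -/
def restrict (φ : Fam A B S p q) (h : S' ⊆ S) : Fam A B S' p q where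
  app z hz := φ.app z (Set.mem_of_subset_of_mem h hz)
  app_base z hz := φ.app_base z (Set.mem_of_subset_of_mem h hz)
  app_anchor z hz := φ.app_anchor z (Set.mem_of_subset_of_mem h hz)
  app_act k hy hz _ w a e b e' := φ.app_act k (Set.mem_of_subset_of_mem h hy) (Set.mem_of_subset_of_mem h hz) w a e b e'

/-- Postcomposition of families with maps of diagrams. -/
noncomputable def map (φ : Fam A B S p q) (g : B ⟶ B') : Fam A B' S p q where
  app z hz := φ.app z hz ≫ g.app (ι z)
  app_base z hz := by rw [Category.assoc, g.app_base, φ.app_base]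
  app_anchor z hz := by rw [Category.assoc, g.app_anchor, φ.app_anchor]
  app_act {y z} h hy hz V w a e b e' := by
    rw [← Category.assoc, φ.app_act h hy hz w a e b e', Diag.actOn_app]
    exact B'.actOn_congr _ _ (Category.assoc _ _ _) rfl

@[simp]
lemma map_app (φ : Fam A B S p q) (g : B ⟶ B') (z : T) (hz : z ∈ S) :
    (φ.map g).app z hz = φ.app z hz ≫ g.app (ι z) := rfl

lemma map_pull (φ : Fam A B S p q) (g : B ⟶ B') (f : W' ⟶ W) (hp : f ≫ p = p')
    (hq : f ≫ q = q') : (φ.map g).pull f hp hq = (φ.pull f hp hq).map g := by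
  ext z hz
  simp

lemma restrict_pull (φ : Fam A B S p q) (h : S' ⊆ S) (f : W' ⟶ W) (hp : f ≫ p = p')
    (hq : f ≫ q = q') : (φ.restrict h).pull f hp hq = (φ.pull f hp hq).restrict h := rfl

lemma map_restrict (φ : Fam A B S p q) (g : B ⟶ B') (h : S' ⊆ S) :
    (φ.map g).restrict h = (φ.restrict h).map g := rfl

end Fam

/-- A representation of the presheaf of families. -/
structure FamRep (A : PDiag I ι X) (B : Diag I Y) (S : Set T) where
  obj : C
  p : obj ⟶ X
  q : obj ⟶ Y
  fam : Fam A B S p q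
  exists_lift : ∀ {W : C} {p' : W ⟶ X} {q' : W ⟶ Y} (φ : Fam A B S p' q'),
    ∃ (f : W ⟶ obj) (hp : f ≫ p = p') (hq : f ≫ q = q'), fam.pull f hp hq = φ
  hom_ext : ∀ {W : C} {f f' : W ⟶ obj} {p' : W ⟶ X} {q' : W ⟶ Y} (hp : f ≫ p = p')
    (hq : f ≫ q = q') (hp' : f' ≫ p = p') (hq' : f' ≫ q = q'),
    fam.pull f hp hq = fam.pull f' hp' hq' → f = f'

namespace FamRep

variable {A : PDiag I ι X} {B B' B'' : Diag I Y} {S S' S'' : Set T} (R : FamRep A B S)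
  (R' : FamRep A B' S) {W W' : C} {p : W ⟶ X} {q : W ⟶ Y}

/-- The map classifying a family. -/
noncomputable def lift (φ : Fam A B S p q) : W ⟶ R.obj := (R.exists_lift φ).choose

@[simp]
lemma lift_p (φ : Fam A B S p q) : R.lift φ ≫ R.p = p := (R.exists_lift φ).choose_spec.choose

@[simp]
lemma lift_q (φ : Fam A B S p q) : R.lift φ ≫ R.q = q :=
  (R.exists_lift φ).choose_spec.choose_spec.choose

lemma pull_lift (φ : Fam A B S p q) : R.fam.pull (R.lift φ) (R.lift_p φ) (R.lift_q φ) = φ :=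
  (R.exists_lift φ).choose_spec.choose_spec.choose_spec

lemma lift_app (φ : Fam A B S p q) (z : T) (hz : z ∈ S) :
    pbMap (A.base z) (R.lift φ) (R.lift_p φ) ≫ R.fam.app z hz = φ.app z hz := by
  rw [← Fam.pull_app _ _ (R.lift_p φ) (R.lift_q φ), pull_lift]

lemma eq_lift (φ : Fam A B S p q) {f : W ⟶ R.obj} (hp : f ≫ R.p = p) (hq : f ≫ R.q = q)
    (h : R.fam.pull f hp hq = φ) : f = R.lift φ :=
  R.hom_ext hp hq (R.lift_p φ) (R.lift_q φ) (by rw [h, pull_lift])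

lemma comp_lift (φ : Fam A B S p q) (f : W' ⟶ W) {p' : W' ⟶ X} {q' : W' ⟶ Y} (hp : f ≫ p = p')
    (hq : f ≫ q = q') : f ≫ R.lift φ = R.lift (φ.pull f hp hq) :=
  R.eq_lift _ (by rw [Category.assoc, lift_p, hp]) (by rw [Category.assoc, lift_q, hq])
    (by rw [← R.fam.pull_pull _ (R.lift_p φ) (R.lift_q φ) f hp hq, pull_lift])

lemma lift_fam : R.lift R.fam = 𝟙 R.obj :=
  (R.eq_lift _ (Category.id_comp _) (Category.id_comp _) (R.fam.pull_id rfl _ _)).symm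

/-- The map of representing objects induced by a map of diagrams. -/
noncomputable def map (g : B ⟶ B') : R.obj ⟶ R'.obj := R'.lift (R.fam.map g)

@[simp]
lemma map_p (g : B ⟶ B') : R.map R' g ≫ R'.p = R.p := R'.lift_p _

@[simp]
lemma map_q (g : B ⟶ B') : R.map R' g ≫ R'.q = R.q := R'.lift_q _

lemma lift_map (φ : Fam A B S p q) (g : B ⟶ B') : R.lift φ ≫ R.map R' g = R'.lift (φ.map g) := by
  rw [map, R'.comp_lift _ _ (R.lift_p φ) (R.lift_q φ), Fam.map_pull, pull_lift]

/-- The restriction map of representing objects. -/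
noncomputable def res {S' : Set T} (R₁ : FamRep A B S') (h : S' ⊆ S) : R.obj ⟶ R₁.obj :=
  R₁.lift (R.fam.restrict h)

@[simp]
lemma res_p {S' : Set T} (R₁ : FamRep A B S') (h : S' ⊆ S) : R.res R₁ h ≫ R₁.p = R.p :=
  R₁.lift_p _

@[simp]
lemma res_q {S' : Set T} (R₁ : FamRep A B S') (h : S' ⊆ S) : R.res R₁ h ≫ R₁.q = R.q :=
  R₁.lift_q _

lemma pull_res {S' : Set T} (R₁ : FamRep A B S') (h : S' ⊆ S) :
    R₁.fam.pull (R.res R₁ h) (R.res_p R₁ h) (R.res_q R₁ h) = R.fam.restrict h := R₁.pull_lift _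

lemma lift_res (φ : Fam A B S p q) {S' : Set T} (R₁ : FamRep A B S') (h : S' ⊆ S) :
    R.lift φ ≫ R.res R₁ h = R₁.lift (φ.restrict h) := by
  rw [res, R₁.comp_lift _ _ (R.lift_p φ) (R.lift_q φ), Fam.restrict_pull, pull_lift]

lemma res_res (R₁ : FamRep A B S') (h : S' ⊆ S) (R₂ : FamRep A B S'') (h' : S'' ⊆ S') :
    R.res R₁ h ≫ R₁.res R₂ h' = R.res R₂ (h'.trans h) := lift_res _ _ _ _

lemma map_res (g : B ⟶ B') (R₁ : FamRep A B S') (R₁' : FamRep A B' S') (h : S' ⊆ S) :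
    R.map R' g ≫ R'.res R₁' h = R.res R₁ h ≫ R₁.map R₁' g := by
  rw [map, lift_res, res, lift_map, Fam.map_restrict]

/-- Uniqueness of representing objects. -/
noncomputable def uniqueIso (R₁ : FamRep A B S) : R.obj ≅ R₁.obj where
  hom := R₁.lift R.fam
  inv := R.lift R₁.fam
  hom_inv_id := by
    rw [R.comp_lift _ _ (R₁.lift_p _) (R₁.lift_q _), R₁.pull_lift, lift_fam]
  inv_hom_id := by
    rw [R₁.comp_lift _ _ (R.lift_p _) (R.lift_q _), R.pull_lift, lift_fam]

lemma fibration_of_fibration (R₁ : FamRep A B S) (h : Fibration (prod.lift R.p R.q)) :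
    Fibration (prod.lift R₁.p R₁.q) := by
  refine fibration_of_arrow_iso h (R₁.uniqueIso R).hom (𝟙 _) ?_
  apply Limits.prod.hom_ext <;> simp [uniqueIso]

end FamRep

end Fam

/-! ### Matching families and extension by one object. -/

section Matching

variable {C : Type u} [Category.{v} C] [CategoryWithFibrations C] [HasFibrationPullbacks C]
  {K : Type w} [PartialOrder K] {I : InverseCat C K} {X Y : C}

lemma lt_of_Iio {x : K} (y : Set.Iio x) : y.1 < x := y.2

/-- An element below an element of a lower set, as an element of the lower set. -/
abbrev belowOf {T : Set K} (hT : IsLowerSet T) (z : T) (y : Set.Iio z.1) : T :=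
  ⟨y.1, hT (lt_of_Iio y).le z.2⟩

lemma belowOf_mem {T : Set K} (hT : IsLowerSet T) (z : T) (y : Set.Iio z.1) :
    belowOf hT z y ∈ Set.Iio z := lt_of_Iio y

lemma belowOf_mem_of_subset {T : Set K} (hT : IsLowerSet T) {z : T} {S : Set T}
    (hS : Set.Iio z ⊆ S) (y : Set.Iio z.1) : belowOf hT z y ∈ S := hS (belowOf_mem hT z y)

/-- The diagram `I(x, -)`, with the actions given on generalized elements. -/
noncomputable abbrev InverseCat.repP (I : InverseCat C K) (x : K) :
    PDiag I (fun y : Set.Iio x => y.1) (I.obj x) where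
  obj y := I.hom (lt_of_Iio y)
  base y := I.src (lt_of_Iio y)
  anchor y := I.tgt (lt_of_Iio y)
  fib_base y := I.fib_src (lt_of_Iio y)
  actOn {y z} h _ a b e := pullback.lift a b e ≫ I.comp (lt_of_Iio z) h
  comp_actOn h _ _ f a b e := by
    rw [← Category.assoc]
    congr 1
    apply pullback.hom_ext <;> simp
  actOn_base h _ a b e := by rw [Category.assoc, I.comp_src, pullback.lift_fst_assoc]
  actOn_anchor h _ a b e := by rw [Category.assoc, I.comp_tgt, pullback.lift_snd_assoc]
  actOn_actOn {x y z} h k _ a b c e e' := I.assoc (lt_of_Iio z) h k a b c e e'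

namespace Diag

variable (B : Diag I Y) {V V' : C}

/-- The family of maps `I(x, y) ⟶ B_y` given by the action on an element of `B_x`. -/
noncomputable def actFam (x : K) (b : V ⟶ B.obj x) {p : V ⟶ I.obj x} {q : V ⟶ Y}
    (hp : b ≫ B.anchor x = p) (hq : b ≫ B.base x = q) : Fam (I.repP x) B Set.univ p q where
  app y _ := B.actOn (lt_of_Iio y) (pullback.fst p (I.src (lt_of_Iio y)) ≫ b) (pullback.snd p (I.src (lt_of_Iio y)))
    (by rw [Category.assoc, hp, pullback.condition])
  app_base y _ := by rw [actOn_base, Category.assoc, hq]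
  app_anchor y _ := actOn_anchor _ _ _ _ _
  app_act {y z} h _ _ U w a e c e' := by
    have key := B.act_assoc (lt_of_Iio z) h (w ≫ b) a c (by rw [Category.assoc, hp, e]) e'
    refine ((B.comp_actOn _ _ _ _ _).trans (B.actOn_congr _ _ ?_ (pullback.lift_snd _ _ _))).trans
      (key.symm.trans (B.actOn_congr _ _ ((B.comp_actOn _ _ _ _ _).trans
        (B.actOn_congr _ _ ?_ (pullback.lift_snd _ _ _))).symm rfl))
    · rw [pullback.lift_fst_assoc]
    · rw [pullback.lift_fst_assoc]

lemma actFam_app_lift (x : K) (b : V ⟶ B.obj x) {p : V ⟶ I.obj x} {q : V ⟶ Y}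
    (hp : b ≫ B.anchor x = p) (hq : b ≫ B.base x = q) (y : Set.Iio x) {U : C} (w : U ⟶ V)
    (a : U ⟶ I.hom (lt_of_Iio y)) (e : w ≫ p = a ≫ I.src (lt_of_Iio y)) :
    pullback.lift w a e ≫ (B.actFam x b hp hq).app y (Set.mem_univ y) =
      B.actOn (lt_of_Iio y) (w ≫ b) a (by rw [Category.assoc, hp, e]) :=
  (B.comp_actOn _ _ _ _ _).trans
    (B.actOn_congr _ _ (pullback.lift_fst_assoc _ _ _ _) (pullback.lift_snd _ _ _))

lemma actFam_pull (x : K) (b : V ⟶ B.obj x) {p : V ⟶ I.obj x} {q : V ⟶ Y}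
    (hp : b ≫ B.anchor x = p) (hq : b ≫ B.base x = q) (f : V' ⟶ V) {p' : V' ⟶ I.obj x}
    {q' : V' ⟶ Y} (hp' : f ≫ p = p') (hq' : f ≫ q = q') :
    (B.actFam x b hp hq).pull f hp' hq' =
      B.actFam x (f ≫ b) (by rw [Category.assoc, hp, hp']) (by rw [Category.assoc, hq, hq']) := by
  ext y hy
  exact (B.actFam_app_lift x b hp hq y _ _ _).trans
    (B.actOn_congr _ _ (Category.assoc _ _ _) rfl)

lemma actFam_map {B B' : Diag I Y} (g : B ⟶ B') (x : K) (b : V ⟶ B.obj x) {p : V ⟶ I.obj x}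
    {q : V ⟶ Y} (hp : b ≫ B.anchor x = p) (hq : b ≫ B.base x = q) :
    (B.actFam x b hp hq).map g = B'.actFam x (b ≫ g.app x)
      (by rw [Category.assoc, g.app_anchor, hp]) (by rw [Category.assoc, g.app_base, hq]) := by
  ext y hy
  exact (actOn_app _ _ _ _ _).trans (B'.actOn_congr _ _ (Category.assoc _ _ _) rfl)

end Diag

namespace FamRep

variable {B B' : Diag I Y} {x : K} (M : FamRep (I.repP x) B Set.univ)
  (M' : FamRep (I.repP x) B' Set.univ) {V : C}

/-- The canonical map `B_x ⟶ M_x B`. -/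
noncomputable def toM : B.obj x ⟶ M.obj :=
  M.lift (B.actFam x (𝟙 _) (Category.id_comp _) (Category.id_comp _))

@[simp]
lemma toM_p : M.toM ≫ M.p = B.anchor x := M.lift_p _

@[simp]
lemma toM_q : M.toM ≫ M.q = B.base x := M.lift_q _

lemma comp_toM (b : V ⟶ B.obj x) {p : V ⟶ I.obj x} {q : V ⟶ Y} (hp : b ≫ B.anchor x = p)
    (hq : b ≫ B.base x = q) : b ≫ M.toM = M.lift (B.actFam x b hp hq) := by
  rw [toM, M.comp_lift _ b hp hq, B.actFam_pull]
  congr 1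
  ext y hy
  exact B.actOn_congr _ _ (by rw [Category.comp_id]) rfl

lemma toM_map (g : B ⟶ B') : M.toM ≫ M.map M' g = g.app x ≫ M'.toM := by
  rw [M'.comp_toM (g.app x) (g.app_anchor x) (g.app_base x), toM, lift_map, Diag.actFam_map]
  congr 1
  ext y hy
  exact B'.actOn_congr _ _ (by rw [Category.id_comp]) rfl

lemma lift_injective {T : Type*} {ι : T → K} {A : PDiag I ι X} {S : Set T} (R : FamRep A B S)
    {W : C} {p : W ⟶ X} {q : W ⟶ Y} {φ ψ : Fam A B S p q} (h : R.lift φ = R.lift ψ) : φ = ψ := by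
  rw [← R.pull_lift φ, ← R.pull_lift ψ]
  exact R.fam.pull_congr h _ _

end FamRep

variable {T : Set K} {A : PDiag I (fun z : T => z.1) X} {B B' : Diag I Y}

namespace Fam

variable {S : Set T} {W W' V V' : C} {p : W ⟶ X} {q : W ⟶ Y} (hT : IsLowerSet T)

/-- The family of maps `I(z, y) ⟶ B_y` obtained by applying a family of maps `A_y ⟶ B_y` to the
action on an element of `A_z`. -/
noncomputable def matching (φ : Fam A B S p q) (z : T) (hS : Set.Iio z ⊆ S) (w : V ⟶ W)
    (a : V ⟶ A.obj z) (e : w ≫ p = a ≫ A.base z) {p' : V ⟶ I.obj z.1} {q' : V ⟶ Y}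
    (hp : a ≫ A.anchor z = p') (hq : w ≫ q = q') :
    Fam (I.repP z.1) B Set.univ p' q' where
  app y _ := pullback.lift (pullback.fst p' (I.src (lt_of_Iio y)) ≫ w)
      (A.actOn (y := belowOf hT z y) (lt_of_Iio y) (pullback.fst p' (I.src (lt_of_Iio y)) ≫ a)
        (pullback.snd p' (I.src (lt_of_Iio y))) (by rw [Category.assoc, hp, pullback.condition]))
      (by rw [Category.assoc, e, A.actOn_base, Category.assoc]) ≫
    φ.app (belowOf hT z y) (belowOf_mem_of_subset hT hS y)
  app_base y _ := by
    rw [Category.assoc, φ.app_base, pullback.lift_fst_assoc, Category.assoc, hq]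
  app_anchor y _ := by
    rw [Category.assoc, φ.app_anchor, pullback.lift_snd_assoc, A.actOn_anchor]
  app_act {y x} h _ _ U u c d b e' := by
    have key := φ.app_act (y := belowOf hT z y) (z := belowOf hT z x) h (belowOf_mem_of_subset hT hS y)
      (belowOf_mem_of_subset hT hS x) (u ≫ w) (A.actOn (y := belowOf hT z x) (lt_of_Iio x) (u ≫ a) c
        (by rw [Category.assoc, hp, d])) (by rw [Category.assoc, e, A.actOn_base, Category.assoc])
      b (by rw [A.actOn_anchor, e'])
    have e₁ := A.actOn_actOn (y := belowOf hT z x) (x := belowOf hT z y) (lt_of_Iio x) h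
      (u ≫ a) c b (by rw [Category.assoc, hp, d]) e'
    refine Eq.trans ?_ (key.trans (B.actOn_congr _ _ ?_ rfl))
    · rw [← Category.assoc]
      congr 1
      apply pullback.hom_ext
      · simp
      · simp [A.comp_actOn, e₁]
    · refine Eq.trans ?_ (Category.assoc _ _ _)
      congr 1
      apply pullback.hom_ext
      · simp
      · simp [A.comp_actOn]

lemma matching_app_lift (φ : Fam A B S p q) (z : T) (hS : Set.Iio z ⊆ S) (w : V ⟶ W)
    (a : V ⟶ A.obj z) (e : w ≫ p = a ≫ A.base z) {p' : V ⟶ I.obj z.1} {q' : V ⟶ Y}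
    (hp : a ≫ A.anchor z = p') (hq : w ≫ q = q') (y : Set.Iio z.1) {U : C} (u : U ⟶ V)
    (c : U ⟶ I.hom (lt_of_Iio y)) (d : u ≫ p' = c ≫ I.src (lt_of_Iio y)) :
    pullback.lift u c d ≫ (φ.matching hT z hS w a e hp hq).app y (Set.mem_univ y) =
      pullback.lift (u ≫ w) (A.actOn (y := belowOf hT z y) (lt_of_Iio y) (u ≫ a) c
        (by rw [Category.assoc, hp, d])) (by rw [Category.assoc, e, A.actOn_base, Category.assoc]) ≫
      φ.app (belowOf hT z y) (belowOf_mem_of_subset hT hS y) := by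
  refine (Category.assoc _ _ _).symm.trans ?_
  congr 1
  apply pullback.hom_ext
  · simp
  · simp [A.comp_actOn]

lemma matching_pull (φ : Fam A B S p q) (z : T) (hS : Set.Iio z ⊆ S) (w : V ⟶ W)
    (a : V ⟶ A.obj z) (e : w ≫ p = a ≫ A.base z) {p' : V ⟶ I.obj z.1} {q' : V ⟶ Y}
    (hp : a ≫ A.anchor z = p') (hq : w ≫ q = q') (f : V' ⟶ V) {p'' : V' ⟶ I.obj z.1}
    {q'' : V' ⟶ Y} (hp' : f ≫ p' = p'') (hq' : f ≫ q' = q'') :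
    (φ.matching hT z hS w a e hp hq).pull f hp' hq' =
      φ.matching hT z hS (f ≫ w) (f ≫ a) (by rw [Category.assoc, e, Category.assoc])
        (by rw [Category.assoc, hp, hp']) (by rw [Category.assoc, hq, hq']) := by
  ext y hy
  refine (φ.matching_app_lift hT z hS w a e hp hq y _ _ _).trans ?_
  refine congrArg (· ≫ φ.app _ _) ?_
  apply pullback.hom_ext
  · simp
  · simp

lemma pull_matching (φ : Fam A B S p q) (z : T) (hS : Set.Iio z ⊆ S) (f : W' ⟶ W)
    {p' : W' ⟶ X} {q' : W' ⟶ Y} (hp : f ≫ p = p') (hq : f ≫ q = q') (w : V ⟶ W')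
    (a : V ⟶ A.obj z) (e : w ≫ p' = a ≫ A.base z) {r : V ⟶ I.obj z.1} {s : V ⟶ Y}
    (hr : a ≫ A.anchor z = r) (hs : w ≫ q' = s) :
    (φ.pull f hp hq).matching hT z hS w a e hr hs =
      φ.matching hT z hS (w ≫ f) a (by rw [Category.assoc, hp, e]) hr
        (by rw [Category.assoc, hq, hs]) := by
  ext y hy
  dsimp only [matching]
  rw [pull_app, ← Category.assoc]
  congr 1
  apply pullback.hom_ext <;> simp

lemma map_matching (φ : Fam A B S p q) (g : B ⟶ B') (z : T) (hS : Set.Iio z ⊆ S) (w : V ⟶ W)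
    (a : V ⟶ A.obj z) (e : w ≫ p = a ≫ A.base z) {p' : V ⟶ I.obj z.1} {q' : V ⟶ Y}
    (hp : a ≫ A.anchor z = p') (hq : w ≫ q = q') :
    (φ.map g).matching hT z hS w a e hp hq = (φ.matching hT z hS w a e hp hq).map g := by
  ext y hy
  exact (Category.assoc _ _ _).symm

/-- Naturality along all arrows out of `z`: acting on the value of a family at an element of `A_z`
gives the matching family of that element. This is the necessary condition for an extension to `z`;
`exists_extend` shows that it suffices. -/
lemma actFam_app (φ : Fam A B S p q) (z : T) (hz : z ∈ S) (hS : Set.Iio z ⊆ S) (w : V ⟶ W)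
    (a : V ⟶ A.obj z) (e : w ≫ p = a ≫ A.base z) {p' : V ⟶ I.obj z.1} {q' : V ⟶ Y}
    (hp : a ≫ A.anchor z = p') (hq : w ≫ q = q') :
    B.actFam z.1 (pullback.lift w a e ≫ φ.app z hz)
        (by rw [Category.assoc, φ.app_anchor, pullback.lift_snd_assoc, hp])
        (by rw [Category.assoc, φ.app_base, pullback.lift_fst_assoc, hq]) =
      φ.matching hT z hS w a e hp hq := by
  ext y hy
  refine (B.actOn_congr _ _ ?_ rfl).trans (φ.app_act (y := belowOf hT z y) (z := z) (lt_of_Iio y)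
    (belowOf_mem_of_subset hT hS y) hz (pullback.fst p' (I.src (lt_of_Iio y)) ≫ w) (pullback.fst p' (I.src (lt_of_Iio y)) ≫ a)
    (by rw [Category.assoc, e, Category.assoc]) (pullback.snd _ _)
    (by rw [Category.assoc, hp, pullback.condition])).symm
  rw [← Category.assoc]
  congr 1
  apply pullback.hom_ext <;> simp

lemma exists_extend_aux {z : T} {P : T → Type*} (f : ∀ y ∈ Set.Iio z, P y) (t : P z) :
    ∃ g : ∀ y ∈ Set.Iic z, P y, (∀ y (hy : y ∈ Set.Iio z), g y (Set.Iio_subset_Iic_self hy) = f y hy) ∧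
      g z Set.self_mem_Iic = t := by
  classical
  refine ⟨fun y hy => if h : y = z then h ▸ t else f y ((Set.mem_Iic.1 hy).lt_of_ne h), fun y hy => ?_, ?_⟩
  · exact dif_neg (show ¬ y = z from (Set.mem_Iio.1 hy).ne)
  · exact dif_pos rfl

/-- Extension of families from `{y | y < z}` to `{y | y ≤ z}`. -/
lemma exists_extend {z : T} (M : FamRep (I.repP z.1) B Set.univ) (φ : Fam A B (Set.Iio z) p q)
    (ψ : pullback p (A.base z) ⟶ B.obj z.1)
    (h : ψ ≫ M.toM = M.lift (φ.matching hT z subset_rfl (pullback.fst p (A.base z))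
      (pullback.snd p (A.base z)) pullback.condition rfl rfl)) :
    ∃ φ' : Fam A B (Set.Iic z) p q, φ'.restrict Set.Iio_subset_Iic_self = φ ∧
      φ'.app z Set.self_mem_Iic = ψ := by
  have hp : ψ ≫ B.anchor z.1 = pullback.snd p (A.base z) ≫ A.anchor z := by
    rw [← M.toM_p, ← Category.assoc, h, M.lift_p]
  have hq : ψ ≫ B.base z.1 = pullback.fst p (A.base z) ≫ q := by
    rw [← M.toM_q, ← Category.assoc, h, M.lift_q]
  rw [M.comp_toM ψ hp hq] at h
  have key := M.lift_injective h
  obtain ⟨g, hg, hg'⟩ := exists_extend_aux (P := fun y : T => (pullback p (A.base y) ⟶ B.obj y.1))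
    φ.app ψ
  have base : ∀ y hy, g y hy ≫ B.base y.1 = pullback.fst p (A.base y) ≫ q := by
    intro y hy
    rcases (show y ≤ z from hy).eq_or_lt with rfl | hy'
    · rw [hg', hq]
    · rw [hg y (Set.mem_Iio.2 hy'), φ.app_base]
  have anchor : ∀ y hy, g y hy ≫ B.anchor y.1 = pullback.snd p (A.base y) ≫ A.anchor y := by
    intro y hy
    rcases (show y ≤ z from hy).eq_or_lt with rfl | hy'
    · rw [hg', hp]
    · rw [hg y (Set.mem_Iio.2 hy'), φ.app_anchor]
  refine ⟨⟨g, base, anchor, ?_⟩, ext' hg, hg'⟩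
  intro y x h' hy hx V w a e b e'
  have hyx : y < x := h'
  rw [hg y (Set.mem_Iio.2 (hyx.trans_le hx))]
  -- An arrow starting at the top object is governed by `key`, evaluated at that arrow; an arrow
  -- starting strictly below is governed by `φ`.
  rcases (show x ≤ z from hx).eq_or_lt with rfl | hx'
  · let y' : Set.Iio x.1 := ⟨y.1, Set.mem_Iio.2 h'⟩
    have d : pullback.lift w a e ≫ pullback.snd p (A.base x) ≫ A.anchor x = b ≫ I.src h' := by
      rw [pullback.lift_snd_assoc, e']
    have e₁ := B.actFam_app_lift x.1 ψ hp hq y' (pullback.lift w a e) b d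
    have e₂ := φ.matching_app_lift hT x subset_rfl _ _ pullback.condition rfl rfl y'
      (pullback.lift w a e) b d
    rw [← key] at e₂
    refine Eq.trans ?_ (e₂.symm.trans (e₁.trans (B.actOn_congr _ _ (by rw [hg']) rfl)))
    exact congrArg (· ≫ φ.app y _) (pullback_lift_congr (pullback.lift_fst _ _ _).symm
      (A.actOn_congr _ _ (pullback.lift_snd _ _ _).symm rfl) _)
  · exact (φ.app_act h' _ (Set.mem_Iio.2 hx') w a e b e').trans (B.actOn_congr _ _ (by rw [hg x (Set.mem_Iio.2 hx')]) rfl)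

end Fam

namespace FamRep

variable (hT : IsLowerSet T) {z : T} (R : FamRep A B (Set.Iio z))
  (M : FamRep (I.repP z.1) B Set.univ)

/-- The map classifying the family of maps `I(z, y) ⟶ B_y` determined by an element of `A_z` and
a family of maps `A_y ⟶ B_y` for `y < z`. -/
noncomputable def toMatching : pullback R.p (A.base z) ⟶ M.obj :=
  M.lift (R.fam.matching hT z subset_rfl (pullback.fst R.p (A.base z))
    (pullback.snd R.p (A.base z)) pullback.condition rfl rfl)

lemma pbMap_lift_toMatching {W : C} {p : W ⟶ X} {q : W ⟶ Y} (φ : Fam A B (Set.Iio z) p q) :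
    pbMap (A.base z) (R.lift φ) (R.lift_p φ) ≫ R.toMatching hT M =
      M.lift (φ.matching hT z subset_rfl (pullback.fst p (A.base z))
        (pullback.snd p (A.base z)) pullback.condition rfl rfl) := by
  rw [toMatching, M.comp_lift _ _ (p' := pullback.snd p (A.base z) ≫ A.anchor z)
    (q' := pullback.fst p (A.base z) ≫ q) (by simp) (by simp), Fam.matching_pull]
  congr 1
  conv_rhs => rw! [← R.pull_lift φ]
  rw [Fam.pull_matching]
  ext y hy
  dsimp only [Fam.matching]
  congr 2
  · simp
  · congr 1 
    simp

/-- A family on `{y | y ≤ z}` is a family on `{y | y < z}` together with a lift of its matching map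
along `M.toM`. This is precisely the functor represented by the relative dependent product of
`M.toM` over `R.obj`. -/
lemma exists_rep_of_isRelPi {P : C} {π : P ⟶ R.obj} {r : P ⟶ X}
    {ev : pullback r (A.base z) ⟶ B.obj z.1}
    (H : IsRelPi (A.base z) R.p (R.toMatching hT M) M.toM π ev) :
    ∃ D : FamRep A B (Set.Iic z), IsRelPi (A.base z) R.p (R.toMatching hT M) M.toM
      (D.res R Set.Iio_subset_Iic_self) (D.fam.app z Set.self_mem_Iic) := by
  have hres {W : C} {p : W ⟶ X} {q : W ⟶ Y} (φ : Fam A B (Set.Iic z) p q) :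
      φ.app z Set.self_mem_Iic ≫ M.toM = pbMap (A.base z)
        (R.lift (φ.restrict Set.Iio_subset_Iic_self)) (R.lift_p _) ≫ R.toMatching hT M := by
    rw [pbMap_lift_toMatching, M.comp_toM _ (φ.app_anchor _ _) (φ.app_base _ _)]
    congr 1
    have := φ.actFam_app hT z Set.self_mem_Iic Set.Iio_subset_Iic_self (pullback.fst p (A.base z))
      (pullback.snd p (A.base z)) pullback.condition rfl rfl
    refine Eq.trans ?_ this
    ext y hy
    exact B.actOn_congr _ _ (by
      have : pullback.lift (pullback.fst p (A.base z)) (pullback.snd p (A.base z))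
        pullback.condition = 𝟙 _ := by apply pullback.hom_ext <;> simp
      rw [this, Category.id_comp]) rfl
  obtain ⟨φ, hφ, hφ'⟩ := Fam.exists_extend hT M (R.fam.pull π H.comm rfl) ev (by
    rw [H.w, ← R.pbMap_lift_toMatching]
    congr 1
    exact pbMap_congr _ (R.eq_lift _ H.comm rfl rfl) _)
  have hπ : π = R.lift (φ.restrict Set.Iio_subset_Iic_self) :=
    R.eq_lift _ H.comm rfl hφ.symm
  let D : FamRep A B (Set.Iic z) :=
    { obj := P
      p := r
      q := π ≫ R.q
      fam := φ
      exists_lift := fun {W p' q'} ψ => by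
        obtain ⟨t, ht, ht'⟩ := H.exists_lift (R.lift (ψ.restrict Set.Iio_subset_Iic_self))
          (R.lift_p _) (ψ.app z Set.self_mem_Iic) (hres ψ)
        have hp : t ≫ r = p' := by rw [← H.comm, reassoc_of% ht, R.lift_p]
        have hq : t ≫ π ≫ R.q = q' := by rw [reassoc_of% ht, R.lift_q]
        refine ⟨t, hp, hq, ?_⟩
        have h₁ : (φ.pull t hp hq).restrict Set.Iio_subset_Iic_self =
            ψ.restrict Set.Iio_subset_Iic_self := by
          rw [← Fam.restrict_pull, hφ, Fam.pull_pull, R.fam.pull_congr ht, R.pull_lift]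
        ext y hy
        rcases (show y ≤ z from hy).eq_or_lt with rfl | hy'
        · rw [← ht', Fam.pull_app, hφ']
        · exact congrArg (fun φ => φ.app y hy') h₁
      hom_ext := fun {W f f' p' q'} hp hq hp' hq' h => by
        refine H.hom_ext hp hp' (R.hom_ext (p' := p') (q' := q')
          (by rw [Category.assoc, H.comm, hp]) (by rw [Category.assoc, hq])
          (by rw [Category.assoc, H.comm, hp']) (by rw [Category.assoc, hq']) ?_) ?_
        · have := congrArg (fun φ => φ.restrict Set.Iio_subset_Iic_self) h
          rw [← Fam.restrict_pull, ← Fam.restrict_pull, hφ, Fam.pull_pull, Fam.pull_pull] at this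
          exact this
        · have := congrArg (fun φ => φ.app z Set.self_mem_Iic) h
          rwa [Fam.pull_app, Fam.pull_app, hφ'] at this }
  refine ⟨D, ?_⟩
  have e₁ : D.res R Set.Iio_subset_Iic_self = π := hπ.symm
  have e₂ : D.fam.app z Set.self_mem_Iic = ev := hφ'
  rw [e₁, e₂]
  exact H

end FamRep

end Matching

/-! ## Gluing families -/

section Gluing

variable {C : Type u} [Category.{v} C] [CategoryWithFibrations C] [FibrationCategory C]
  {K : Type w} [PartialOrder K] {I : InverseCat C K} {X Y : C} {T : Set K}
  {A : PDiag I (fun z : T => z.1) X} {B B' : Diag I Y} {J : Type w} [PartialOrder J]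

/-- A preimage has to be chosen and the value transported along an equality; injectivity of `σ`
makes the choice harmless. -/
lemma exists_family_of_forall {T J : Type*} {σ : J → T} (hσ : Function.Injective σ) {S : Set T}
    (hS : ∀ z ∈ S, ∃ j, σ j = z) {P : T → Type*} (m : ∀ j, P (σ j)) :
    ∃ f : ∀ z ∈ S, P z, ∀ j (h : σ j ∈ S), f (σ j) h = m j := by
  refine ⟨fun z hz => (hS z hz).choose_spec ▸ m (hS z hz).choose, fun j h => ?_⟩
  have key : ∀ (i : J) (e : σ i = σ j), e ▸ m i = m j := by
    intro i e
    obtain rfl := hσ e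
    rfl
  exact key _ _

variable (σ : J ↪o T) (U : ∀ j, FamRep A B (Set.Iic (σ j)))
  (hU : ∀ j, Fibration (prod.lift (U j).p (U j).q))

lemma Iic_subset_of_le {i j : J} (h : i ≤ j) : Set.Iic (σ i) ⊆ Set.Iic (σ j) :=
  Set.Iic_subset_Iic.2 (σ.monotone h)

lemma FamRep.res_lift_p_q {S S' : Set T} (R : FamRep A B S) (R' : FamRep A B S') (h : S' ⊆ S) :
    R.res R' h ≫ prod.lift R'.p R'.q = prod.lift R.p R.q := by
  apply Limits.prod.hom_ext <;> simp

lemma FamRep.map_lift_p_q {S : Set T} (R : FamRep A B S) (R' : FamRep A B' S) (g : B ⟶ B') :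
    R.map R' g ≫ prod.lift R'.p R'.q = prod.lift R.p R.q := by
  apply Limits.prod.hom_ext <;> simp

/-- The diagram of the objects representing the families indexed by `{y | y ≤ σ j}`. -/
noncomputable def famDiag : Jᵒᵖ ⥤ FibOver (X ⨯ Y) where
  obj j := .of (prod.lift (U j.unop).p (U j.unop).q) (hU j.unop)
  map {a b} f := FibOver.homMk ((U a.unop).res (U b.unop) (Iic_subset_of_le σ f.unop.le))
    (FamRep.res_lift_p_q _ _ _)
  map_id _ := FibOver.hom_ext (FamRep.lift_fam _)
  map_comp _ _ := FibOver.hom_ext (FamRep.res_res _ _ _ _ _).symm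

variable {S : Set T} (hS : ∀ j, Set.Iic (σ j) ⊆ S)

include hS in
lemma fam_ext_of_restrict (hσS : ∀ z ∈ S, ∃ j, σ j = z) {W : C} {p : W ⟶ X} {q : W ⟶ Y}
    {φ ψ : Fam A B S p q} (h : ∀ j, φ.restrict (hS j) = ψ.restrict (hS j)) : φ = ψ := by
  ext z hz
  obtain ⟨j, rfl⟩ := hσS z hz
  exact congrArg (fun φ => φ.app (σ j) Set.self_mem_Iic) (h j)

/-- The component at `σ j` is read off from the family on `{y | y ≤ σ j}`. Naturality along an arrow
out of `σ j` takes place inside that set, where compatibility identifies the glued components with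
those of the single family. -/
lemma exists_fam_of_compatible (hσS : ∀ z ∈ S, ∃ j, σ j = z) {W : C} {p : W ⟶ X} {q : W ⟶ Y}
    (γ : ∀ j, W ⟶ (U j).obj) (hp : ∀ j, γ j ≫ (U j).p = p) (hq : ∀ j, γ j ≫ (U j).q = q)
    (hγ : ∀ {i j : J} (h : i ≤ j), γ j ≫ (U j).res (U i) (Iic_subset_of_le σ h) = γ i) :
    ∃ φ : Fam A B S p q, ∀ j, (U j).fam.pull (γ j) (hp j) (hq j) = φ.restrict (hS j) := by
  obtain ⟨f, hf⟩ := exists_family_of_forall σ.injective hσS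
    (P := fun z : T => (pullback p (A.base z) ⟶ B.obj z.1))
    (fun j => ((U j).fam.pull (γ j) (hp j) (hq j)).app (σ j) Set.self_mem_Iic)
  have hf' (j : J) (y : T) (hy : y ∈ Set.Iic (σ j)) (hy' : y ∈ S) :
      f y hy' = ((U j).fam.pull (γ j) (hp j) (hq j)).app y hy := by
    obtain ⟨i, rfl⟩ := hσS y hy'
    have hij : i ≤ j := σ.le_iff_le.1 (Set.mem_Iic.1 hy)
    have h₁ : (U i).fam.pull (γ i) (hp i) (hq i) =
        ((U j).fam.pull (γ j) (hp j) (hq j)).restrict (Iic_subset_of_le σ hij) := by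
      rw [(U i).fam.pull_congr (hγ hij).symm, ← Fam.pull_pull _ _ (FamRep.res_p _ _ _)
        (FamRep.res_q _ _ _) _ (hp j) (hq j), FamRep.pull_res, Fam.restrict_pull]
    rw [hf, h₁]
    rfl
  refine ⟨⟨f, fun z hz => ?_, fun z hz => ?_, ?_⟩, fun j => ?_⟩
  · obtain ⟨j, rfl⟩ := hσS z hz
    rw [hf, Fam.app_base]
  · obtain ⟨j, rfl⟩ := hσS z hz
    rw [hf, Fam.app_anchor]
  · intro y z h hy hz V w a e b e'
    obtain ⟨j, rfl⟩ := hσS z hz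
    have hyj : y ∈ Set.Iic (σ j) := Set.mem_Iic.2 (le_of_lt (show y < σ j from h))
    rw [hf' j y hyj]
    exact (((U j).fam.pull (γ j) (hp j) (hq j)).app_act h hyj Set.self_mem_Iic w a e b e').trans
      (B.actOn_congr _ _ (by rw [hf]) rfl)
  · ext y hy
    exact (hf' j y hy _).symm

section

variable (c : Cone (famDiag σ U hU)) (j : J)

/-- The components of a cone over the diagram of representing objects. -/
noncomputable def famConeApp : c.pt.obj.left ⟶ (U j).obj := (c.π.app (op j)).hom.left

lemma famConeApp_lift : famConeApp σ U hU c j ≫ prod.lift (U j).p (U j).q = c.pt.obj.hom :=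
  FibOver.w (c.π.app (op j))

lemma famConeApp_p : famConeApp σ U hU c j ≫ (U j).p = c.pt.obj.hom ≫ prod.fst := by
  rw [← famConeApp_lift σ U hU c j, Category.assoc, prod.lift_fst]

lemma famConeApp_q : famConeApp σ U hU c j ≫ (U j).q = c.pt.obj.hom ≫ prod.snd := by
  rw [← famConeApp_lift σ U hU c j, Category.assoc, prod.lift_snd]

end

lemma exists_fam_of_cone (hσS : ∀ z ∈ S, ∃ j, σ j = z) (c : Cone (famDiag σ U hU)) :
    ∃ φ : Fam A B S (c.pt.obj.hom ≫ prod.fst) (c.pt.obj.hom ≫ prod.snd), ∀ j,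
      (U j).fam.pull (famConeApp σ U hU c j) (famConeApp_p σ U hU c j) (famConeApp_q σ U hU c j) =
        φ.restrict (hS j) :=
  exists_fam_of_compatible σ U hS hσS _ _ _
    (fun h => congrArg (·.hom.left) (c.w (homOfLE h).op))

/-- The cone given by an object representing families. -/
noncomputable def famCone (R : FamRep A B S) (hR : Fibration (prod.lift R.p R.q)) :
    Cone (famDiag σ U hU) where
  pt := .of (prod.lift R.p R.q) hR
  π :=
    { app := fun j => FibOver.homMk (R.res (U j.unop) (hS j.unop)) (FamRep.res_lift_p_q _ _ _)
      naturality := fun _ _ _ => FibOver.hom_ext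
        ((Category.id_comp _).trans (FamRep.res_res _ _ _ _ _).symm) }

/-- Families on `S` are compatible systems of families on the principal lower sets contained in it.
With `S = {y | y < σ j}` this identifies the matching object of `famDiag` at `j`. -/
lemma isLimit_famCone (hσS : ∀ z ∈ S, ∃ j, σ j = z) (R : FamRep A B S)
    (hR : Fibration (prod.lift R.p R.q)) : Nonempty (IsLimit (famCone σ U hU hS R hR)) := by
  refine ⟨IsLimit.ofExistsUnique fun s => ?_⟩
  obtain ⟨φ, hφ⟩ := exists_fam_of_cone σ U hU hS hσS s
  have huniq (n : s.pt.obj.left ⟶ R.obj) (h : n ≫ prod.lift R.p R.q = s.pt.obj.hom)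
      (h' : ∀ j, n ≫ R.res (U j) (hS j) = famConeApp σ U hU s j) : n = R.lift φ := by
    have hp : n ≫ R.p = s.pt.obj.hom ≫ prod.fst := by rw [← h, Category.assoc, prod.lift_fst]
    have hq : n ≫ R.q = s.pt.obj.hom ≫ prod.snd := by rw [← h, Category.assoc, prod.lift_snd]
    refine R.eq_lift φ hp hq (fam_ext_of_restrict σ hS hσS fun j => ?_)
    rw [← hφ, (U j).fam.pull_congr (h' j).symm, ← Fam.pull_pull _ _ (FamRep.res_p _ _ _)
        (FamRep.res_q _ _ _) _ hp hq, FamRep.pull_res, Fam.restrict_pull]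
  refine ⟨FibOver.homMk (R.lift φ) ?_, fun j => FibOver.hom_ext ?_, fun m hm => FibOver.hom_ext ?_⟩
  · apply Limits.prod.hom_ext
    · exact (Category.assoc _ _ _).trans ((congrArg (R.lift φ ≫ ·) (prod.lift_fst _ _)).trans
        (R.lift_p φ))
    · exact (Category.assoc _ _ _).trans ((congrArg (R.lift φ ≫ ·) (prod.lift_snd _ _)).trans
        (R.lift_q φ))
  · refine (R.lift_res φ _ (hS j.unop)).trans ?_
    exact ((U j.unop).eq_lift _ _ _ (hφ j.unop)).symm
  · exact huniq m.hom.left (FibOver.w m) fun j => congrArg (·.hom.left) (hm (op j))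

-- The limit cone is universal only among fibrations over `X ⨯ Y`, whereas `FamRep` tests against
-- arbitrary maps; `FibOver.isLimit_over` upgrades the universal property.
include hS in
lemma exists_rep_of_isLimit [WellFoundedLT J] (hσS : ∀ z ∈ S, ∃ j, σ j = z)
    (hF : IsReedyFibrantDiagram (famDiag σ U hU)) {c : Cone (famDiag σ U hU)} (hc : IsLimit c) :
    ∃ R : FamRep A B S, Fibration (prod.lift R.p R.q) := by
  obtain ⟨ex, uniq⟩ := FibOver.isLimit_over hF hc
  obtain ⟨φ, hφ⟩ := exists_fam_of_cone σ U hU hS hσS c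
  let R : FamRep A B S :=
    { obj := c.pt.obj.left
      p := c.pt.obj.hom ≫ prod.fst
      q := c.pt.obj.hom ≫ prod.snd
      fam := φ
      exists_lift := fun {W p' q'} ψ => by
        obtain ⟨m, hm, hm'⟩ := ex (prod.lift p' q') (fun j => (U j).lift (ψ.restrict (hS j)))
          (fun j => by
            apply Limits.prod.hom_ext
            · exact (Category.assoc _ _ _).trans ((congrArg (_ ≫ ·) (prod.lift_fst _ _)).trans
                (((U j).lift_p _).trans (prod.lift_fst _ _).symm))
            · exact (Category.assoc _ _ _).trans ((congrArg (_ ≫ ·) (prod.lift_snd _ _)).trans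
                (((U j).lift_q _).trans (prod.lift_snd _ _).symm)))
          (fun {i j} h => FamRep.lift_res _ _ _ _)
        have hmp : m ≫ c.pt.obj.hom ≫ prod.fst = p' := by
          rw [← Category.assoc, hm, prod.lift_fst]
        have hmq : m ≫ c.pt.obj.hom ≫ prod.snd = q' := by
          rw [← Category.assoc, hm, prod.lift_snd]
        refine ⟨m, hmp, hmq, fam_ext_of_restrict σ hS hσS fun j => ?_⟩
        rw [← Fam.restrict_pull, ← hφ, Fam.pull_pull]
        exact ((U j).fam.pull_congr (hm' j) _ _).trans ((U j).pull_lift _)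
      hom_ext := fun {W f f' p' q'} hp' hq' hp'' hq'' h => by
        refine uniq ?_ fun j => ?_
        · apply Limits.prod.hom_ext
          · rw [Category.assoc, Category.assoc, hp', hp'']
          · rw [Category.assoc, Category.assoc, hq', hq'']
        · change f ≫ famConeApp σ U hU c j = f' ≫ famConeApp σ U hU c j
          refine (U j).hom_ext (p' := p') (q' := q') (by rw [Category.assoc, famConeApp_p σ U hU c j, hp'])
            (by rw [Category.assoc, famConeApp_q σ U hU c j, hq']) (by rw [Category.assoc, famConeApp_p σ U hU c j, hp''])
            (by rw [Category.assoc, famConeApp_q σ U hU c j, hq'']) ?_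
          rw [← Fam.pull_pull _ _ (famConeApp_p σ U hU c j) (famConeApp_q σ U hU c j) _ hp' hq',
            ← Fam.pull_pull _ _ (famConeApp_p σ U hU c j) (famConeApp_q σ U hU c j) _ hp'' hq'', hφ j, Fam.restrict_pull,
            Fam.restrict_pull, h] }
  refine ⟨R, ?_⟩
  have : prod.lift R.p R.q = c.pt.obj.hom := by
    apply Limits.prod.hom_ext
    · rw [prod.lift_fst]
    · rw [prod.lift_snd]
  rw [this]
  exact c.pt.fib

/-- The map of diagrams of representing objects induced by a map of diagrams. -/
noncomputable def famDiagMap (U' : ∀ j, FamRep A B' (Set.Iic (σ j)))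
    (hU' : ∀ j, Fibration (prod.lift (U' j).p (U' j).q)) (g : B ⟶ B') :
    famDiag σ U hU ⟶ famDiag σ U' hU' where
  app j := FibOver.homMk ((U j.unop).map (U' j.unop) g) (FamRep.map_lift_p_q _ _ _)
  naturality _ _ _ := FibOver.hom_ext (FamRep.map_res _ _ _ _ _ _).symm

/-- As the image of `σ` is closed downwards, `isLimit_famCone` makes `R j` the matching object at
`j`, and the matching map becomes restriction from `{y | y ≤ σ j}` to `{y | y < σ j}`. -/
lemma isReedyFibrantDiagram_famDiag (hσ : ∀ j, ∀ z < σ j, ∃ i, σ i = z)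
    (R : ∀ j, FamRep A B (Set.Iio (σ j))) (hR : ∀ j, Fibration (prod.lift (R j).p (R j).q))
    (hUR : ∀ j, Fibration ((U j).res (R j) Set.Iio_subset_Iic_self)) :
    IsReedyFibrantDiagram (famDiag σ U hU) := by
  refine isReedyFibrantDiagram_of_isLimit fun j => ?_
  let σ' : Set.Iio j ↪o T := (OrderEmbedding.subtype (· ∈ Set.Iio j)).trans σ
  have hS (i : Set.Iio j) : Set.Iic (σ' i) ⊆ Set.Iio (σ j) :=
    Set.Iic_subset_Iio.2 (σ.lt_iff_lt.2 (lt_of_Iio i))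
  obtain ⟨hc⟩ := isLimit_famCone σ' (fun i => U i.1) (fun i => hU i.1) hS (fun z hz => by
    obtain ⟨i, rfl⟩ := hσ j z hz
    exact ⟨⟨i, σ.lt_iff_lt.1 hz⟩, rfl⟩) (R j) (hR j)
  exact ⟨famCone σ' (fun i => U i.1) (fun i => hU i.1) hS (R j) (hR j), hc,
    FibOver.homMk ((U j).res (R j) Set.Iio_subset_Iic_self) (FamRep.res_lift_p_q _ _ _),
    fun i => FibOver.hom_ext (FamRep.res_res _ _ _ _ _), ⟨hUR j⟩⟩

/-- With `R j` and `R' j` as matching objects, the Reedy condition at `j` is the gap condition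
`hgap`, stated for every choice of pullback. -/
lemma isReedyFibrationOfDiagrams_famDiagMap (hσ : ∀ j, ∀ z < σ j, ∃ i, σ i = z)
    (U' : ∀ j, FamRep A B' (Set.Iic (σ j))) (hU' : ∀ j, Fibration (prod.lift (U' j).p (U' j).q))
    (R : ∀ j, FamRep A B (Set.Iio (σ j))) (hR : ∀ j, Fibration (prod.lift (R j).p (R j).q))
    (R' : ∀ j, FamRep A B' (Set.Iio (σ j))) (hR' : ∀ j, Fibration (prod.lift (R' j).p (R' j).q))
    (hUR' : ∀ j, Fibration ((U' j).res (R' j) Set.Iio_subset_Iic_self)) (g : B ⟶ B')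
    (hgap : ∀ j {Q : C} {x : Q ⟶ (U' j).obj} {y : Q ⟶ (R j).obj},
      IsPullback x y ((U' j).res (R' j) Set.Iio_subset_Iic_self) ((R j).map (R' j) g) →
      ∀ s : (U j).obj ⟶ Q, s ≫ x = (U j).map (U' j) g →
        s ≫ y = (U j).res (R j) Set.Iio_subset_Iic_self → Fibration s) :
    IsReedyFibrationOfDiagrams (famDiagMap σ U hU U' hU' g) := by
  refine isReedyFibrationOfDiagrams_of_isLimit _ fun j => ?_
  let σ' : Set.Iio j ↪o T := (OrderEmbedding.subtype (· ∈ Set.Iio j)).trans σ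
  have hS (i : Set.Iio j) : Set.Iic (σ' i) ⊆ Set.Iio (σ j) :=
    Set.Iic_subset_Iio.2 (σ.lt_iff_lt.2 (lt_of_Iio i))
  have hσ' (z) (hz : z ∈ Set.Iio (σ j)) : ∃ i, σ' i = z := by
    obtain ⟨i, rfl⟩ := hσ j z hz
    exact ⟨⟨i, σ.lt_iff_lt.1 hz⟩, rfl⟩
  obtain ⟨hc⟩ := isLimit_famCone σ' (fun i => U i.1) (fun i => hU i.1) hS hσ' (R j) (hR j)
  obtain ⟨hc'⟩ := isLimit_famCone σ' (fun i => U' i.1) (fun i => hU' i.1) hS hσ' (R' j) (hR' j)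
  let a : FibOver.of _ (hU j) ⟶ FibOver.of _ (hR j) :=
    FibOver.homMk ((U j).res (R j) Set.Iio_subset_Iic_self) (FamRep.res_lift_p_q _ _ _)
  let b : FibOver.of _ (hU' j) ⟶ FibOver.of _ (hR' j) :=
    FibOver.homMk ((U' j).res (R' j) Set.Iio_subset_Iic_self) (FamRep.res_lift_p_q _ _ _)
  let ℓ : FibOver.of _ (hR j) ⟶ FibOver.of _ (hR' j) :=
    FibOver.homMk ((R j).map (R' j) g) (FamRep.map_lift_p_q _ _ _)
  let τ : FibOver.of _ (hU j) ⟶ FibOver.of _ (hU' j) :=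
    FibOver.homMk ((U j).map (U' j) g) (FamRep.map_lift_p_q _ _ _)
  have hb : Fibration b := ⟨hUR' j⟩
  obtain ⟨Q, x, y, hQ⟩ := FibOver.exists_isPullback ℓ hb
  have hQ' := FibOver.isPullback_of_left hQ
  have e : τ ≫ b = a ≫ ℓ := FibOver.hom_ext (FamRep.map_res _ _ _ _ _ _)
  have hx := hQ'.lift_fst τ a e
  have hy := hQ'.lift_snd τ a e
  exact ⟨famCone σ' (fun i => U i.1) (fun i => hU i.1) hS (R j) (hR j), hc,
    famCone σ' (fun i => U' i.1) (fun i => hU' i.1) hS (R' j) (hR' j), hc', a, b, ℓ, Q, x, y,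
    hQ'.lift τ a e, fun i => FibOver.hom_ext (FamRep.res_res _ _ _ _ _),
    fun i => FibOver.hom_ext (FamRep.res_res _ _ _ _ _),
    fun i => FibOver.hom_ext (FamRep.map_res _ _ _ _ _ _), hQ', hx, hy, hb,
    ⟨hgap j hQ _ (congrArg (·.hom.left) hx) (congrArg (·.hom.left) hy)⟩⟩

end Gluing

/-! ## Existence of representing objects and their homotopy invariance -/

section Stages

variable {C : Type u} [Category.{v} C] [CategoryWithFibrations C]
  [IsTypeTheoreticFibrationCategory C] {K : Type w} [PartialOrder K] {I : InverseCat C K}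
  {X Y : C} {T : Set K} (hT : IsLowerSet T) (A : PDiag I (fun z : T => z.1) X) {B B' : Diag I Y}
  (M : ∀ z, FamRep (I.repP z) B Set.univ) (M' : ∀ z, FamRep (I.repP z) B' Set.univ)

/-- Objects representing the families indexed by `{y | y < z}` and by `{y | y ≤ z}`, the latter
obtained from the former as a relative dependent product. -/
structure Stage (z : T) where
  R : FamRep A B (Set.Iio z)
  D : FamRep A B (Set.Iic z)
  fib : Fibration (prod.lift R.p R.q)
  isRelPi : IsRelPi (A.base z) R.p (R.toMatching hT (M z)) (M z).toM
    (D.res R Set.Iio_subset_Iic_self) (D.fam.app z Set.self_mem_Iic)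

/-- The gap map of `g` at `z` has the property `P`. -/
def HasGap (P : ∀ {E F : C}, (E ⟶ F) → Prop) (g : B ⟶ B') (z : K) : Prop :=
  ∃ (N : C) (t : N ⟶ B'.obj z) (n : N ⟶ (M z).obj) (k : B.obj z ⟶ N),
    IsPullback t n (M' z).toM ((M z).map (M' z) g) ∧ k ≫ n = (M z).toM ∧ k ≫ t = g.app z ∧ P k

variable {A M M'}

namespace Stage

variable {hT} {z : T}

lemma fibration_res (s : Stage hT A M z) (hM : Fibration (M z).toM) :
    Fibration (s.D.res s.R Set.Iio_subset_Iic_self) := s.isRelPi.fibration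

lemma fibration_D (s : Stage hT A M z) (hM : Fibration (M z).toM) :
    Fibration (prod.lift s.D.p s.D.q) := by
  rw [← FamRep.res_lift_p_q s.D s.R Set.Iio_subset_Iic_self]
  exact fibration_comp (s.fibration_res hM) s.fib

lemma map_toMatching (s : Stage hT A M z) (s' : Stage hT A M' z) (g : B ⟶ B') :
    pbMap (A.base z) (s.R.map s'.R g) (s.R.map_p s'.R g) ≫ s'.R.toMatching hT (M' z) =
      s.R.toMatching hT (M z) ≫ (M z).map (M' z) g := by
  refine (s'.R.pbMap_lift_toMatching hT (M' z) (s.R.fam.map g)).trans ?_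
  rw [FamRep.toMatching, FamRep.lift_map, ← Fam.map_matching]

lemma map_app (s : Stage hT A M z) (s' : Stage hT A M' z) (g : B ⟶ B') :
    pbMap (A.base z) (s.D.map s'.D g) (s.D.map_p s'.D g) ≫ s'.D.fam.app z Set.self_mem_Iic =
      s.D.fam.app z Set.self_mem_Iic ≫ g.app z.1 :=
  s'.D.lift_app (s.D.fam.map g) z Set.self_mem_Iic

/-- Both stages are relative dependent products of matching maps, and `g` induces a map between the
two situations; the gap map of the stages is then the relative dependent product of the gap map of
`g` at `z`. -/
lemma fibration_gap (s : Stage hT A M z) (s' : Stage hT A M' z) (g : B ⟶ B')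
    (hM' : Fibration (M' z).toM) (h : HasGap M M' (fun f => Fibration f) g z) {Q : C}
    {x : Q ⟶ s'.D.obj} {y : Q ⟶ s.R.obj}
    (hQ : IsPullback x y (s'.D.res s'.R Set.Iio_subset_Iic_self) (s.R.map s'.R g))
    (k : s.D.obj ⟶ Q) (hx : k ≫ x = s.D.map s'.D g)
    (hy : k ≫ y = s.D.res s.R Set.Iio_subset_Iic_self) : Fibration k := by
  obtain ⟨N, t, n, m, hN, hm, hm', hf⟩ := h
  exact s.isRelPi.fibration_gap (s.R.map_p s'.R g) hN (s.map_toMatching s' g) s'.isRelPi hm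
    (s.D.map_p s'.D g) (by rw [s.map_app, hm']) hf hQ hx hy

lemma isHomotopyEquiv_map (hfe : FunctionExtensionality C) (s : Stage hT A M z)
    (s' : Stage hT A M' z) (g : B ⟶ B') (hM : Fibration (M z).toM) (hM' : Fibration (M' z).toM)
    (h : HasGap M M' (fun f => IsHomotopyEquiv f) g z) (hR : IsHomotopyEquiv (s.R.map s'.R g)) :
    IsHomotopyEquiv (s.D.map s'.D g) := by
  obtain ⟨N, t, n, m, hN, hm, hm', hf⟩ := h
  exact s.isRelPi.isHomotopyEquiv_gap (s.R.map_p s'.R g) hN (s.map_toMatching s' g) s'.isRelPi hm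
    (s.D.map_res _ _ _ _ _) (s.D.map_p s'.D g) (by rw [s.map_app, hm']) hfe hf hR

end Stage

section

variable {J : Type w} [PartialOrder J] [WellFoundedLT J] (σ : J ↪o T)
  (hJ : HasReedyLimits J (FibOver (X ⨯ Y))) (hM : ∀ z, Fibration (M z).toM) {S : Set T}
  (hσS : ∀ z, z ∈ S ↔ ∃ j, σ j = z) (hS : IsLowerSet S)

include hσS hS in
omit [WellFoundedLT J] in
lemma exists_of_lt (j : J) (z : T) (hz : z < σ j) : ∃ i, σ i = z :=
  (hσS z).1 (hS hz.le ((hσS _).2 ⟨j, rfl⟩))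

include hσS hS in
omit [WellFoundedLT J] in
lemma Iic_subset_of_range (j : J) : Set.Iic (σ j) ⊆ S :=
  fun _ hz => hS (Set.mem_Iic.1 hz) ((hσS _).2 ⟨j, rfl⟩)

include hJ hM hσS hS in
lemma exists_rep_of_stages (s : ∀ j, Stage hT A M (σ j)) :
    ∃ R : FamRep A B S, Fibration (prod.lift R.p R.q) := by
  have hF := isReedyFibrantDiagram_famDiag σ (fun j => (s j).D) (fun j => (s j).fibration_D (hM _))
    (exists_of_lt σ hσS hS) (fun j => (s j).R) (fun j => (s j).fib)
    (fun j => (s j).fibration_res (hM _))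
  obtain ⟨_, -⟩ := hJ.hasLimit _ hF
  exact exists_rep_of_isLimit σ _ _ (Iic_subset_of_range σ hσS hS) (fun z hz => (hσS z).1 hz) hF
    (limit.isLimit _)

variable (s : ∀ j, Stage hT A M (σ j)) (s' : ∀ j, Stage hT A M' (σ j)) (g : B ⟶ B')
  (R : FamRep A B S) (R' : FamRep A B' S) (hR : Fibration (prod.lift R.p R.q))
  (hR' : Fibration (prod.lift R'.p R'.q)) (hM' : ∀ z, Fibration (M' z).toM)

include hJ hM hσS hS s s' hM' hR hR'

omit [WellFoundedLT J] in
lemma fibration_map_of_stages (hg : ∀ z ∈ T, HasGap M M' (fun f => Fibration f) g z) :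
    Fibration (R.map R' g) := by
  have hF := isReedyFibrantDiagram_famDiag σ (fun j => (s j).D) (fun j => (s j).fibration_D (hM _))
    (exists_of_lt σ hσS hS) (fun j => (s j).R) (fun j => (s j).fib)
    (fun j => (s j).fibration_res (hM _))
  have hF' := isReedyFibrantDiagram_famDiag σ (fun j => (s' j).D)
    (fun j => (s' j).fibration_D (hM' _)) (exists_of_lt σ hσS hS) (fun j => (s' j).R)
    (fun j => (s' j).fib) (fun j => (s' j).fibration_res (hM' _))
  have hf := isReedyFibrationOfDiagrams_famDiagMap σ (fun j => (s j).D)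
    (fun j => (s j).fibration_D (hM _)) (exists_of_lt σ hσS hS) (fun j => (s' j).D)
    (fun j => (s' j).fibration_D (hM' _)) (fun j => (s j).R) (fun j => (s j).fib)
    (fun j => (s' j).R) (fun j => (s' j).fib) (fun j => (s' j).fibration_res (hM' _)) g
    (fun j {Q x y} hQ k hx hy => (s j).fibration_gap (s' j) g (hM' _) (hg _ (σ j).2) hQ k hx hy)
  obtain ⟨hc⟩ := isLimit_famCone σ _ (fun j => (s j).fibration_D (hM _))
    (Iic_subset_of_range σ hσS hS) (fun z hz => (hσS z).1 hz) R hR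
  obtain ⟨hc'⟩ := isLimit_famCone σ _ (fun j => (s' j).fibration_D (hM' _))
    (Iic_subset_of_range σ hσS hS) (fun z hz => (hσS z).1 hz) R' hR'
  exact (hJ.fibration_of_isLimit _ hc hc' (m := FibOver.homMk (R.map R' g)
    (FamRep.map_lift_p_q _ _ _)) (fun j => FibOver.hom_ext (FamRep.map_res _ _ _ _ _ _))
    hF hF' hf).mem

omit [WellFoundedLT J] in
lemma isHomotopyEquiv_map_of_stages (hg : ∀ j, IsHomotopyEquiv ((s j).D.map (s' j).D g)) :
    IsHomotopyEquiv (R.map R' g) := by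
  have hF := isReedyFibrantDiagram_famDiag σ (fun j => (s j).D) (fun j => (s j).fibration_D (hM _))
    (exists_of_lt σ hσS hS) (fun j => (s j).R) (fun j => (s j).fib)
    (fun j => (s j).fibration_res (hM _))
  have hF' := isReedyFibrantDiagram_famDiag σ (fun j => (s' j).D)
    (fun j => (s' j).fibration_D (hM' _)) (exists_of_lt σ hσS hS) (fun j => (s' j).R)
    (fun j => (s' j).fib) (fun j => (s' j).fibration_res (hM' _))
  obtain ⟨hc⟩ := isLimit_famCone σ _ (fun j => (s j).fibration_D (hM _))
    (Iic_subset_of_range σ hσS hS) (fun z hz => (hσS z).1 hz) R hR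
  obtain ⟨hc'⟩ := isLimit_famCone σ _ (fun j => (s' j).fibration_D (hM' _))
    (Iic_subset_of_range σ hσS hS) (fun z hz => (hσS z).1 hz) R' hR'
  exact (FibOver.isHomotopyEquiv_iff _).1 (hJ.isHomotopyEquiv_of_isLimit
    (famDiagMap σ _ _ _ _ g) hc hc' (m := FibOver.homMk (R.map R' g)
    (FamRep.map_lift_p_q _ _ _)) (fun j => FibOver.hom_ext (FamRep.map_res _ _ _ _ _ _))
    hF hF' (fun j => (FibOver.isHomotopyEquiv_iff _).2 (hg j)))

end

variable (K C) in
/-- Every strict initial segment of `K` is isomorphic to a poset `J` such that the self-indexing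
has Reedy limits of shape `Jᵒᵖ`. -/
def Admissible : Prop :=
  ∀ z : K, ∃ (J : Type w) (_ : PartialOrder J) (σ : J ↪o K), (∀ y, y < z ↔ ∃ j, σ j = y) ∧
    ∀ Z : C, HasReedyLimits J (FibOver Z)

-- `T` is closed downwards, so strict segments of `T` and of `K` coincide. Describing them by an
-- auxiliary poset `J` avoids transporting Reedy limits between isomorphic subtypes.
include hT in
omit [IsTypeTheoreticFibrationCategory C] in
lemma Admissible.exists_embedding (hK : Admissible C K) (z : T) :
    ∃ (J : Type w) (_ : PartialOrder J) (σ : J ↪o T), (∀ y, y ∈ Set.Iio z ↔ ∃ j, σ j = y) ∧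
      ∀ Z : C, HasReedyLimits J (FibOver Z) := by
  obtain ⟨J, _, σ, hσ, hJ⟩ := hK z.1
  refine ⟨J, inferInstance, OrderEmbedding.ofMapLEIff
    (fun j => ⟨σ j, hT ((hσ _).2 ⟨j, rfl⟩).le z.2⟩) (fun i j => σ.le_iff_le), fun y => ?_, hJ⟩
  refine (hσ y.1).trans (exists_congr fun j => ?_)
  exact ⟨fun h => Subtype.ext h, fun h => congrArg Subtype.val h⟩

variable [WellFoundedLT K] (hK : Admissible C K) (hM : ∀ z, Fibration (M z).toM)
  (hM' : ∀ z, Fibration (M' z).toM)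

-- Induction on `z`: the stages below `z` form a Reedy fibrant diagram whose limit represents
-- families on `{y | y < z}`, and one relative dependent product then adds the object `z`.
include hK hM in
lemma exists_stage (z : T) : Nonempty (Stage hT A M z) := by
  induction z using (wellFounded_lt (α := T)).induction with
  | _ z ih =>
    obtain ⟨J, _, σ, hσ, hJ⟩ := hK.exists_embedding hT z
    have : WellFoundedLT J := σ.wellFoundedLT
    have s (j : J) : Nonempty (Stage hT A M (σ j)) := ih (σ j) ((hσ _).2 ⟨j, rfl⟩)
    obtain ⟨R, hR⟩ := exists_rep_of_stages hT σ (hJ _) hM hσ (isLowerSet_Iio z)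
      (fun j => (s j).some)
    have := hM z
    obtain ⟨P, π, r, ev, -, H⟩ := exists_isRelPi (A.base z) R.p (R.toMatching hT (M z)) (M z).toM
    obtain ⟨D, hD⟩ := R.exists_rep_of_isRelPi hT (M z) H
    exact ⟨⟨R, D, hR, hD⟩⟩

-- The same induction, for maps: a Reedy limit of the equivalences below `z` is an equivalence on
-- families over `{y | y < z}`, and the gap condition at `z` carries it to `{y | y ≤ z}`.
include hK hM hM' in
lemma Stage.isHomotopyEquiv (hfe : FunctionExtensionality C) (s : ∀ z, Stage hT A M z)
    (s' : ∀ z, Stage hT A M' z) (g : B ⟶ B')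
    (hg : ∀ z ∈ T, HasGap M M' (fun f => IsHomotopyEquiv f) g z) (z : T) :
    IsHomotopyEquiv ((s z).D.map (s' z).D g) := by
  induction z using (wellFounded_lt (α := T)).induction with
  | _ z ih =>
    obtain ⟨J, _, σ, hσ, hJ⟩ := hK.exists_embedding hT z
    have : WellFoundedLT J := σ.wellFoundedLT
    refine (s z).isHomotopyEquiv_map hfe (s' z) g (hM z) (hM' z) (hg _ z.2) ?_
    exact isHomotopyEquiv_map_of_stages hT σ (hJ _) hM hσ (isLowerSet_Iio z) (fun j => s (σ j))
      (fun j => s' (σ j)) g _ _ (s z).fib (s' z).fib hM' (fun j => ih (σ j) ((hσ _).2 ⟨j, rfl⟩))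

section

variable {J : Type w} [PartialOrder J] (σ : J ↪o T) (hσ : Function.Surjective σ)
  (hJ : HasReedyLimits J (FibOver (X ⨯ Y)))

include hT hK hM hσ hJ

/-- Representing objects for families exist. -/
lemma exists_famRep : ∃ R : FamRep A B Set.univ, Fibration (prod.lift R.p R.q) := by
  have : WellFoundedLT J := σ.wellFoundedLT
  have s := exists_stage (A := A) hT hK hM
  exact exists_rep_of_stages hT σ hJ hM (fun z => ⟨fun _ => hσ z, fun _ => Set.mem_univ z⟩)
    isLowerSet_univ (fun j => (s (σ j)).some)

lemma fibration_famRep (R : FamRep A B Set.univ) : Fibration (prod.lift R.p R.q) := by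
  obtain ⟨R', h⟩ := exists_famRep (A := A) hT hK hM σ hσ hJ
  exact R'.fibration_of_fibration R h

include hM'

/-- The maps of representing objects induced by Reedy fibrations are fibrations. -/
lemma fibration_famRep_map (g : B ⟶ B') (hg : ∀ z ∈ T, HasGap M M' (fun f => Fibration f) g z)
    (R : FamRep A B Set.univ) (R' : FamRep A B' Set.univ) : Fibration (R.map R' g) := by
  have : WellFoundedLT J := σ.wellFoundedLT
  have s := exists_stage (A := A) hT hK hM
  have s' := exists_stage (A := A) hT hK hM'
  exact fibration_map_of_stages hT σ hJ hM (fun z => ⟨fun _ => hσ z, fun _ => Set.mem_univ z⟩)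
    isLowerSet_univ (fun j => (s (σ j)).some) (fun j => (s' (σ j)).some) g R R'
    (fibration_famRep hT hK hM σ hσ hJ R) (fibration_famRep hT hK hM' σ hσ hJ R') hM' hg

lemma isHomotopyEquiv_famRep_map_of_gap (hfe : FunctionExtensionality C) (g : B ⟶ B')
    (hg : ∀ z ∈ T, HasGap M M' (fun f => IsHomotopyEquiv f) g z)
    (R : FamRep A B Set.univ) (R' : FamRep A B' Set.univ) : IsHomotopyEquiv (R.map R' g) := by
  have : WellFoundedLT J := σ.wellFoundedLT
  have s := exists_stage (A := A) hT hK hM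
  have s' := exists_stage (A := A) hT hK hM'
  exact isHomotopyEquiv_map_of_stages hT σ hJ hM (fun z => ⟨fun _ => hσ z, fun _ => Set.mem_univ z⟩)
    isLowerSet_univ (fun j => (s (σ j)).some) (fun j => (s' (σ j)).some) g R R'
    (fibration_famRep hT hK hM σ hσ hJ R) (fibration_famRep hT hK hM' σ hσ hJ R') hM'
    (fun j => Stage.isHomotopyEquiv hT hK hM hM' hfe (fun z => (s z).some) (fun z => (s' z).some)
      g hg (σ j))

end

-- The matching objects at `z` represent families on objects below `z`, where the gap condition
-- holds by induction, so `M_z B ⟶ M_z B'` is a homotopy equivalence. By right properness so is its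
-- pullback along `B'_z ⟶ M_z B'`, and two-out-of-three applied to `g_z` treats the gap map.
include hK hM hM' in
lemma hasGap_of_isHomotopyEquiv (hfe : FunctionExtensionality C) (g : B ⟶ B')
    (hg : ∀ z, IsHomotopyEquiv (g.app z)) (z : K) :
    HasGap M M' (fun f => IsHomotopyEquiv f) g z := by
  induction z using (wellFounded_lt (α := K)).induction with
  | _ z ih =>
    obtain ⟨J, _, σ, hσ, hJ⟩ := hK z
    let σ' : J ↪o Set.Iio z := OrderEmbedding.ofMapLEIff
      (fun j => ⟨σ j, Set.mem_Iio.2 ((hσ _).2 ⟨j, rfl⟩)⟩) (fun i j => σ.le_iff_le)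
    have hσ' : Function.Surjective σ' := fun y => by
      obtain ⟨j, hj⟩ := (hσ y.1).1 (lt_of_Iio y)
      exact ⟨j, Subtype.ext hj⟩
    have h := isHomotopyEquiv_famRep_map_of_gap (isLowerSet_Iio z) hK hM hM' σ' hσ' (hJ _) hfe g
      (fun y hy => ih y hy) (M z) (M' z)
    have := hM' z
    have hP := (IsPullback.of_hasPullback ((M z).map (M' z) g) (M' z).toM).flip
    have e : g.app z ≫ (M' z).toM = (M z).toM ≫ (M z).map (M' z) g :=
      ((M z).toM_map (M' z) g).symm
    refine ⟨_, _, _, hP.lift _ _ e, hP, hP.lift_snd _ _ e, hP.lift_fst _ _ e, ?_⟩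
    refine .of_comp_right (g := pullback.snd _ _) ?_ (h.pullback_of_fibration hP (hM' z))
    rw [hP.lift_fst]
    exact hg z

include hT hK hM hM' in
/-- The maps of representing objects induced by levelwise homotopy equivalences are homotopy
equivalences. -/
lemma isHomotopyEquiv_famRep_map {J : Type w} [PartialOrder J] (σ : J ↪o T)
    (hσ : Function.Surjective σ) (hJ : HasReedyLimits J (FibOver (X ⨯ Y)))
    (hfe : FunctionExtensionality C) (g : B ⟶ B') (hg : ∀ z, IsHomotopyEquiv (g.app z))
    (R : FamRep A B Set.univ) (R' : FamRep A B' Set.univ) : IsHomotopyEquiv (R.map R' g) :=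
  isHomotopyEquiv_famRep_map_of_gap hT hK hM hM' σ hσ hJ hfe g
    (fun z _ => hasGap_of_isHomotopyEquiv hK hM hM' hfe g hg z) R R'

end Stages

/-! ## Hom-objects as representing objects of families -/

section Conversion

variable {C : Type u} [Category.{v} C] [CategoryWithFibrations C] [HasFibrationPullbacks C]
  {K : Type w} [PartialOrder K] {I : InverseCat C K} {X Y : C} {T : Set K}

namespace Diag

section

variable {A : Diag I X} {B : Diag I Y} {W : C} {p : W ⟶ X} {q : W ⟶ Y}

lemma reindexLift_actOn (p : W ⟶ X) {y z : K} (h : y < z) {V : C} (w : V ⟶ W)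
    (a : V ⟶ A.obj z) (e : w ≫ p = a ≫ A.base z) (b : V ⟶ I.hom h)
    (e' : a ≫ A.anchor z = b ≫ I.src h) :
    A.reindexLift p w (A.actOn h a b e') (by rw [actOn_base, e]) =
      (A.reindex p).actOn h (A.reindexLift p w a e) b
        (by rw [reindex_anchor, ← Category.assoc, reindexLift_snd, e']) := by
  apply reindex_obj_ext
  · rw [reindexLift_base, actOn_base, reindexLift_base]
  · rw [reindexLift_snd, reindex_actOn_snd]
    exact A.actOn_congr _ _ (reindexLift_snd _ _ _ _ _).symm rfl

variable (φ : A.reindex p ⟶ B.reindex q)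

lemma app_snd_base (z : K) :
    (φ.app z ≫ B.reindexSnd q z) ≫ B.base z = (A.reindex p).base z ≫ q := by
  rw [Category.assoc, ← reindex_condition, ← Category.assoc, φ.app_base]

lemma app_snd_anchor (z : K) :
    (φ.app z ≫ B.reindexSnd q z) ≫ B.anchor z = A.reindexSnd p z ≫ A.anchor z := by
  rw [Category.assoc, ← reindex_anchor, φ.app_anchor, reindex_anchor]

lemma actOn_app_snd {y z : K} (h : y < z) {V : C} (w : V ⟶ W)
    (a : V ⟶ A.obj z) (e : w ≫ p = a ≫ A.base z) (b : V ⟶ I.hom h)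
    (e' : a ≫ A.anchor z = b ≫ I.src h) :
    A.reindexLift p w (A.actOn h a b e') (by rw [actOn_base, e]) ≫ φ.app y ≫ B.reindexSnd q y =
      B.actOn h (A.reindexLift p w a e ≫ φ.app z ≫ B.reindexSnd q z) b (by
        rw [Category.assoc, Category.assoc, ← reindex_anchor, φ.app_anchor, reindex_anchor,
          ← Category.assoc, reindexLift_snd, e']) := by
  rw [A.reindexLift_actOn, ← Category.assoc, actOn_app, reindex_actOn_snd]
  exact B.actOn_congr _ _ (Category.assoc _ _ _) rfl

/-- Maps between reindexed diagrams. -/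
noncomputable def reindexHomMk (ψ : ∀ z, (A.reindex p).obj z ⟶ B.obj z)
    (hb : ∀ z, ψ z ≫ B.base z = (A.reindex p).base z ≫ q)
    (ha : ∀ z, ψ z ≫ B.anchor z = A.reindexSnd p z ≫ A.anchor z)
    (hact : ∀ {y z : K} (h : y < z) {V : C} (w : V ⟶ W) (a : V ⟶ A.obj z)
      (e : w ≫ p = a ≫ A.base z) (b : V ⟶ I.hom h) (e' : a ≫ A.anchor z = b ≫ I.src h),
      A.reindexLift p w (A.actOn h a b e') (by rw [actOn_base, e]) ≫ ψ y =
        B.actOn h (A.reindexLift p w a e ≫ ψ z) b (by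
          rw [Category.assoc, ha, ← Category.assoc, reindexLift_snd, e'])) :
    A.reindex p ⟶ B.reindex q :=
  have h₂ : ∀ z, B.reindexLift q ((A.reindex p).base z) (ψ z) (hb z).symm ≫
      (B.reindex q).anchor z = (A.reindex p).anchor z := fun z => by
    rw [reindex_anchor, ← Category.assoc, reindexLift_snd, ha, reindex_anchor]
  { app := fun z => B.reindexLift q ((A.reindex p).base z) (ψ z) (hb z).symm
    app_base := fun z => reindexLift_base _ _ _ _ _
    app_anchor := h₂
    act_app := act_app_of_actOn _ h₂ (fun {z y} h V a b e => by
      apply reindex_obj_ext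
      · rw [Category.assoc, reindexLift_base, actOn_base, actOn_base,
          Category.assoc, reindexLift_base]
      · have e₁ : (a ≫ A.reindexSnd p z) ≫ A.anchor z = b ≫ I.src h := by
          rw [Category.assoc, ← reindex_anchor, e]
        have key := hact h (a ≫ (A.reindex p).base z) (a ≫ A.reindexSnd p z)
          (by rw [Category.assoc, reindex_condition, Category.assoc]) b e₁
        rw [Category.assoc, reindexLift_snd, reindex_actOn_snd]
        refine Eq.trans ?_ (key.trans (B.actOn_congr _ _ ?_ rfl))
        · congr 1
          apply reindex_obj_ext
          · rw [actOn_base, reindexLift_base]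
          · rw [reindex_actOn_snd, reindexLift_snd]
        · refine Eq.trans ?_ ((congrArg (a ≫ ·) (reindexLift_snd _ _ _ _ _).symm).trans
            (Category.assoc _ _ _).symm)
          congr 1
          apply reindex_obj_ext
          · rw [reindexLift_base]
          · rw [reindexLift_snd]) }

end

/-- The universal property of hom-objects. -/
noncomputable def HomObj.equiv {A : Diag I X} {B : Diag I Y} {H : Over (X ⨯ Y)} (r : HomObj A B H)
    (Z : Over (X ⨯ Y)) :
    (Z ⟶ H) ≃ (A.reindex (Z.hom ≫ prod.fst) ⟶ B.reindex (Z.hom ≫ prod.snd)) :=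
  r.homEquiv

lemma HomObj.equiv_eq {A : Diag I X} {B : Diag I Y} {H : Over (X ⨯ Y)} (r : HomObj A B H)
    {Z : Over (X ⨯ Y)} (f : Z ⟶ H) :
    r.equiv Z f = pull (r.equiv H (𝟙 H)) f.left (over_hom_comp f _) (over_hom_comp f _) :=
  r.homEquiv_eq f

end Diag

namespace Fam

variable {A : Diag (I.full T) X} {B B' : Diag I Y} {W W' : C} {p : W ⟶ X} {q : W ⟶ Y}
  {p' : W' ⟶ X} {q' : W' ⟶ Y}

/-- The family underlying a map of reindexed diagrams. -/
noncomputable def ofHom (φ : A.reindex p ⟶ (B.restrict T).reindex q) :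
    Fam A.fullToPDiag B Set.univ p q where
  app z _ := φ.app z ≫ (B.restrict T).reindexSnd q z
  app_base z _ := Diag.app_snd_base φ z
  app_anchor z _ := Diag.app_snd_anchor φ z
  app_act h _ _ _ w a e b e' := Diag.actOn_app_snd φ (fullLt h) w a e b e'

/-- The map of reindexed diagrams given by a family. -/
noncomputable def toHom (φ : Fam A.fullToPDiag B Set.univ p q) :
    A.reindex p ⟶ (B.restrict T).reindex q :=
  Diag.reindexHomMk (fun z => φ.app z (Set.mem_univ z)) (fun z => φ.app_base z (Set.mem_univ z))
    (fun z => φ.app_anchor z (Set.mem_univ z))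
    (fun {_ _} h _ w a e b e' =>
      φ.app_act h (Set.mem_univ _) (Set.mem_univ _) w a e b e')

lemma ofHom_toHom (φ : Fam A.fullToPDiag B Set.univ p q) : ofHom (toHom φ) = φ := by
  ext z hz
  exact Diag.reindexLift_snd _ _ _ _ _

lemma toHom_ofHom (φ : A.reindex p ⟶ (B.restrict T).reindex q) : toHom (ofHom φ) = φ :=
  Diag.reindex_hom_ext fun z => Diag.reindexLift_snd _ _ _ _ _

lemma ofHom_injective {φ ψ : A.reindex p ⟶ (B.restrict T).reindex q} (h : ofHom φ = ofHom ψ) :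
    φ = ψ := by
  rw [← toHom_ofHom φ, h, toHom_ofHom]

lemma ofHom_pull (φ : A.reindex p ⟶ (B.restrict T).reindex q) (f : W' ⟶ W) (hp : f ≫ p = p')
    (hq : f ≫ q = q') : ofHom (Diag.pull φ f hp.symm hq.symm) = (ofHom φ).pull f hp hq := by
  ext z hz
  exact Diag.pull_app_snd φ f hp.symm hq.symm z

lemma ofHom_comp (φ : A.reindex p ⟶ (B.restrict T).reindex q) (g : B ⟶ B') :
    ofHom (φ ≫ Diag.reindexMap q (Diag.restrictMap g T)) = (ofHom φ).map g := by
  ext z hz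
  refine (Category.assoc _ _ _).trans ((congrArg (φ.app z ≫ ·)
    (Diag.reindexLift_snd _ _ _ _ _)).trans (Category.assoc _ _ _).symm)

end Fam

namespace FamRep

variable {A : Diag (I.full T) X} {B B' : Diag I Y} {H H' : Over (X ⨯ Y)}

/-- A hom-object represents families. -/
noncomputable def ofHomObj (r : Diag.HomObj A (B.restrict T) H) :
    FamRep A.fullToPDiag B Set.univ where
  obj := H.left
  p := H.hom ≫ prod.fst
  q := H.hom ≫ prod.snd
  fam := Fam.ofHom (r.equiv H (𝟙 H))
  exists_lift {W p' q'} φ := by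
    -- `p'` and `prod.lift p' q' ≫ prod.fst` are equal but not definitionally so; pulling back along
    -- `𝟙 W` transports families between the two indexings.
    have hp : 𝟙 W ≫ p' = prod.lift p' q' ≫ prod.fst := by simp
    have hq : 𝟙 W ≫ q' = prod.lift p' q' ≫ prod.snd := by simp
    let f : Over.mk (prod.lift p' q') ⟶ H := (r.equiv _).symm (Fam.toHom (φ.pull (𝟙 W) hp hq))
    have hf : f.left ≫ H.hom = prod.lift p' q' := Over.w f
    have hfp : f.left ≫ H.hom ≫ prod.fst = prod.lift p' q' ≫ prod.fst := by
      rw [← Category.assoc, hf]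
    have hfq : f.left ≫ H.hom ≫ prod.snd = prod.lift p' q' ≫ prod.snd := by
      rw [← Category.assoc, hf]
    refine ⟨f.left, by rw [hfp, prod.lift_fst], by rw [hfq, prod.lift_snd], ?_⟩
    have key : Diag.pull (r.equiv H (𝟙 H)) f.left hfp.symm hfq.symm =
        Fam.toHom (φ.pull (𝟙 W) hp hq) :=
      (r.equiv_eq f).symm.trans ((r.equiv _).apply_symm_apply _)
    have h₁ : (Fam.ofHom (r.equiv H (𝟙 H))).pull f.left hfp hfq = φ.pull (𝟙 W) hp hq :=
      (Fam.ofHom_pull _ _ hfp hfq).symm.trans ((congrArg Fam.ofHom key).trans (Fam.ofHom_toHom _))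
    have h' := congrArg (fun ψ => ψ.pull (𝟙 W) ((Category.id_comp _).trans (prod.lift_fst p' q'))
      ((Category.id_comp _).trans (prod.lift_snd p' q'))) h₁
    refine (Fam.pull_congr _ (Category.id_comp _).symm _ _).trans
      ((Fam.pull_pull _ _ _ _ _ _ _).symm.trans (h'.trans
        ((Fam.pull_pull _ _ _ _ _ _ _).trans (φ.pull_id (Category.id_comp _) _ _))))
  hom_ext {W f f' p' q'} hp hq hp' hq' h := by
    have hf : f' ≫ H.hom = f ≫ H.hom := by
      apply Limits.prod.hom_ext
      · rw [Category.assoc, Category.assoc, hp, hp']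
      · rw [Category.assoc, Category.assoc, hq, hq']
    let k : Over.mk (f ≫ H.hom) ⟶ H := Over.homMk f
    let k' : Over.mk (f ≫ H.hom) ⟶ H := Over.homMk f' hf
    suffices k = k' from congrArg (·.left) this
    apply (r.equiv _).injective
    refine (r.equiv_eq k).trans (Eq.trans ?_ (r.equiv_eq k').symm)
    refine Fam.ofHom_injective ?_
    refine (Fam.ofHom_pull _ _ (over_hom_comp k _).symm (over_hom_comp k _).symm).trans
      (Eq.trans ?_ (Fam.ofHom_pull _ _ (over_hom_comp k' _).symm (over_hom_comp k' _).symm).symm)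
    have h' := congrArg (fun ψ => ψ.pull (𝟙 W) (p' := (f ≫ H.hom) ≫ prod.fst)
      (q' := (f ≫ H.hom) ≫ prod.snd) (by rw [Category.id_comp, Category.assoc, hp])
      (by rw [Category.id_comp, Category.assoc, hq])) h
    exact (Fam.pull_congr _ (Category.id_comp _).symm _ _).trans
      ((Fam.pull_pull _ _ _ _ _ _ _).symm.trans (h'.trans ((Fam.pull_pull _ _ _ _ _ _ _).trans
        (Fam.pull_congr _ (Category.id_comp _) _ _))))

lemma equiv_symm_left (r : Diag.HomObj A (B.restrict T) H) {Z : Over (X ⨯ Y)}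
    (φ : A.reindex (Z.hom ≫ prod.fst) ⟶ (B.restrict T).reindex (Z.hom ≫ prod.snd)) :
    ((r.equiv Z).symm φ).left = (ofHomObj r).lift (Fam.ofHom φ) := by
  let f : Z ⟶ H := (r.equiv Z).symm φ
  have hp : f.left ≫ H.hom ≫ prod.fst = Z.hom ≫ prod.fst := (over_hom_comp f _).symm
  have hq : f.left ≫ H.hom ≫ prod.snd = Z.hom ≫ prod.snd := (over_hom_comp f _).symm
  refine (ofHomObj r).eq_lift _ hp hq ?_
  refine (Fam.ofHom_pull _ _ hp hq).symm.trans (congrArg Fam.ofHom ?_)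
  exact (r.equiv_eq f).symm.trans ((r.equiv Z).apply_symm_apply φ)

lemma homObjMap_left (r : Diag.HomObj A (B.restrict T) H) (r' : Diag.HomObj A (B'.restrict T) H')
    (g : B ⟶ B') : (Diag.homObjMap (Diag.restrictMap g T) r r').left =
      (ofHomObj r).map (ofHomObj r') g :=
  (equiv_symm_left r' _).trans (congrArg (ofHomObj r').lift (Fam.ofHom_comp _ _))

/-- The universal property of a representing object of families, in terms of maps of diagrams. -/
noncomputable def homEquiv (R : FamRep A.fullToPDiag B Set.univ) (Z : Over (X ⨯ Y)) :
    (Z ⟶ Over.mk (prod.lift R.p R.q)) ≃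
      (A.reindex (Z.hom ≫ prod.fst) ⟶ (B.restrict T).reindex (Z.hom ≫ prod.snd)) where
  toFun f := Fam.toHom (R.fam.pull f.left (p' := Z.hom ≫ prod.fst)
    (q' := Z.hom ≫ prod.snd) (by rw [over_hom_comp f]; simp) (by rw [over_hom_comp f]; simp))
  invFun φ := Over.homMk (R.lift (Fam.ofHom φ)) (by
    apply Limits.prod.hom_ext <;> simp)
  left_inv f := by
    refine Over.OverMorphism.ext ?_
    refine Eq.symm (R.eq_lift _ ?_ ?_ ?_)
    · rw [over_hom_comp f]; simp
    · rw [over_hom_comp f]; simp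
    · rw [Fam.ofHom_toHom]
  right_inv φ := by
    refine Fam.ofHom_injective ?_
    rw [Fam.ofHom_toHom]
    exact R.pull_lift _

lemma ofHom_homEquiv (R : FamRep A.fullToPDiag B Set.univ) {Z : Over (X ⨯ Y)}
    (f : Z ⟶ Over.mk (prod.lift R.p R.q)) : Fam.ofHom (R.homEquiv Z f) =
      R.fam.pull f.left (by rw [over_hom_comp f]; simp) (by rw [over_hom_comp f]; simp) :=
  Fam.ofHom_toHom _

/-- An object representing families is a hom-object. -/
noncomputable def toHomObj (R : FamRep A.fullToPDiag B Set.univ) :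
    Diag.HomObj A (B.restrict T) (Over.mk (prod.lift R.p R.q)) where
  homEquiv {Z} := R.homEquiv Z
  homEquiv_comp {Z Z'} f g := by
    have h : Fam.ofHom (R.homEquiv Z (f ≫ g)) = Fam.ofHom (Diag.pull (R.homEquiv Z' g) f.left
        (over_hom_comp f _) (over_hom_comp f _)) := by
      rw [Fam.ofHom_pull _ _ (over_hom_comp f _).symm (over_hom_comp f _).symm, ofHom_homEquiv,
        ofHom_homEquiv, Fam.pull_pull]
      rfl
    exact Fam.ofHom_injective h

end FamRep

end Conversion

/-! ## Reedy fibrant diagrams and Reedy fibrations in terms of families -/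

section ReedyFamilies

variable {C : Type u} [Category.{v} C] [CategoryWithFibrations C] [HasFibrationPullbacks C]
  {K : Type w} [PartialOrder K] {I : InverseCat C K} {X Y : C}

namespace Diag

section Univ

variable {A : Diag I X} {B B' : Diag I Y} {W W' : C} {p : W ⟶ X} {q : W ⟶ Y} {p' : W' ⟶ X}
  {q' : W' ⟶ Y}

/-- Maps of diagrams are the same as maps of their restrictions to all objects. -/
noncomputable def restrictUniv : (A.reindex p ⟶ B.reindex q) ≃
    ((A.restrict Set.univ).reindex p ⟶ (B.restrict Set.univ).reindex q) where
  toFun φ := restrictMap φ Set.univ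
  invFun φ :=
    { app := fun x => φ.app ⟨x, Set.mem_univ x⟩
      app_base := fun x => φ.app_base ⟨x, Set.mem_univ x⟩
      app_anchor := fun x => φ.app_anchor ⟨x, Set.mem_univ x⟩
      act_app := fun {x y} h => φ.act_app (x := ⟨x, Set.mem_univ x⟩) (y := ⟨y, Set.mem_univ y⟩) h }
  left_inv _ := rfl
  right_inv _ := rfl

variable {H H' : Over (X ⨯ Y)}

/-- A hom-object of diagrams is a hom-object of their restrictions to all objects. -/
noncomputable def HomObj.toUniv (r : HomObj A B H) :
    HomObj (A.restrict Set.univ) (B.restrict Set.univ) H where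
  homEquiv {Z} := (r.equiv Z).trans restrictUniv
  homEquiv_comp f g := congrArg restrictUniv (r.homEquiv_comp f g)

/-- A hom-object of the restrictions of diagrams to all objects is a hom-object. -/
noncomputable def HomObj.ofUniv (r : HomObj (A.restrict Set.univ) (B.restrict Set.univ) H) :
    HomObj A B H where
  homEquiv {Z} := (r.equiv Z).trans restrictUniv.symm
  homEquiv_comp f g := congrArg restrictUniv.symm (r.homEquiv_comp f g)

lemma homObjMap_toUniv (r : HomObj A B H) (r' : HomObj A B' H') (g : B ⟶ B') :
    homObjMap g r r' = homObjMap (restrictMap g Set.univ) r.toUniv r'.toUniv := rfl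

lemma homObjMap_left (r : HomObj A B H) (r' : HomObj A B' H') (g : B ⟶ B') :
    (homObjMap g r r').left =
      (FamRep.ofHomObj r.toUniv).map (FamRep.ofHomObj r'.toUniv) g :=
  (congrArg (·.left) (homObjMap_toUniv r r' g)).trans (FamRep.homObjMap_left _ _ g)

end Univ

end Diag

lemma FamRep.lift_pull_id {T : Type*} {ι : T → K} {A : PDiag I ι X} {B : Diag I Y} {S : Set T}
    (R : FamRep A B S) {W : C} {p p' : W ⟶ X} {q q' : W ⟶ Y} (φ : Fam A B S p q)
    (hp : 𝟙 W ≫ p = p') (hq : 𝟙 W ≫ q = q') : R.lift (φ.pull (𝟙 W) hp hq) = R.lift φ := by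
  rw [← R.comp_lift, Category.id_comp]

/-- Matching objects represent families on `I(x, -)`. -/
noncomputable def Diag.MatchingObj.famRep {B : Diag I Y} {x : K} {N : Over (I.obj x ⨯ Y)}
    (r : B.MatchingObj x N) : FamRep (I.repP x) B Set.univ :=
  FamRep.ofHomObj r

/-- Objects representing families on `I(x, -)` are matching objects. -/
noncomputable def FamRep.matchingObj {B : Diag I Y} {x : K} (M : FamRep (I.repP x) B Set.univ) :
    B.MatchingObj x (Over.mk (prod.lift M.p M.q)) :=
  FamRep.toHomObj (A := I.rep x) M

namespace Diag

variable {B B' : Diag I Y} {x : K} {N N' : Over (I.obj x ⨯ Y)}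

lemma toMatching_eq_toM (r : B.MatchingObj x N) :
    B.toMatching x r = (MatchingObj.famRep r).toM := by
  refine (FamRep.equiv_symm_left r (Z := Over.mk (prod.lift (B.anchor x) (B.base x))) _).trans ?_
  refine (FamRep.lift_pull_id _ _ ((Category.id_comp _).trans (prod.lift_fst _ _))
    ((Category.id_comp _).trans (prod.lift_snd _ _))).symm.trans ?_
  refine congrArg (FamRep.lift _) ?_
  ext y hy
  refine (congrArg (fun t => _ ≫ t) (reindexLift_snd _ _ _ _ _)).trans ?_
  refine (B.comp_actOn _ _ _ _ _).trans (B.actOn_congr _ _ ?_ ?_)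
  · exact pbMap_fst (I.src (lt_of_Iio y)) _ _
  · exact pbMap_snd (I.src (lt_of_Iio y)) _ _

lemma matchingMap_eq_map (f : B ⟶ B') (r : B.MatchingObj x N) (s : B'.MatchingObj x N') :
    matchingMap f x r s = (MatchingObj.famRep r).map (MatchingObj.famRep s) f :=
  FamRep.homObjMap_left r s f

end Diag

namespace FamRep

variable {B B' : Diag I Y} {x : K} (M M₁ : FamRep (I.repP x) B Set.univ)
  (M' M₁' : FamRep (I.repP x) B' Set.univ)

lemma toM_uniqueIso : M.toM ≫ (M.uniqueIso M₁).hom = M₁.toM := by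
  have h : M.fam = M.fam.map (𝟙 B) := by
    ext y hy
    simp
  refine (congrArg (M.toM ≫ M₁.lift ·) h).trans ((M.toM_map M₁ (𝟙 B)).trans ?_)
  simp

lemma map_uniqueIso (f : B ⟶ B') :
    M.map M' f ≫ (M'.uniqueIso M₁').hom = (M.uniqueIso M₁).hom ≫ M₁.map M₁' f := by
  refine (M₁'.comp_lift _ _ (M'.lift_p _) (M'.lift_q _)).trans ?_
  refine Eq.trans ?_ (M₁.lift_map M₁' M.fam f).symm
  congr 1
  exact M'.pull_lift _

lemma fibration_toM_of_fibration (h : Fibration M.toM) : Fibration M₁.toM := by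
  rw [← M.toM_uniqueIso M₁]
  exact fibration_comp h (fibration_of_iso _)

end FamRep

namespace Diag

lemma isReedyFibrant_iff {B : Diag I Y} : B.IsReedyFibrant ↔
    ∀ x, ∃ M : FamRep (I.repP x) B Set.univ, Fibration M.toM := by
  refine forall_congr' fun x => ⟨fun ⟨N, r, h⟩ => ⟨MatchingObj.famRep r, ?_⟩,
    fun ⟨M, h⟩ => ⟨_, M.matchingObj, ?_⟩⟩
  · rwa [toMatching_eq_toM] at h
  · rw [toMatching_eq_toM]
    exact M.fibration_toM_of_fibration _ h

end Diag

end ReedyFamilies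

/-! ### Reedy fibrations as a condition on gap maps. -/

section ReedyGap

variable {C : Type u} [Category.{v} C] [CategoryWithFibrations C]
  [IsTypeTheoreticFibrationCategory C] {K : Type w} [PartialOrder K] {I : InverseCat C K}
  {Y : C} {B B' : Diag I Y}

lemma HasGap.congr {M M₁ : ∀ z, FamRep (I.repP z) B Set.univ}
    {M' M₁' : ∀ z, FamRep (I.repP z) B' Set.univ} {P : ∀ {E F : C}, (E ⟶ F) → Prop} {f : B ⟶ B'}
    {z : K} (h : HasGap M M' P f z) : HasGap M₁ M₁' P f z := by
  obtain ⟨N, t, n, k, hP, hn, ht, hk⟩ := h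
  refine ⟨N, t, n ≫ ((M z).uniqueIso (M₁ z)).hom, k, ?_, ?_, ht, hk⟩
  · refine IsPullback.of_iso hP (Iso.refl _) (Iso.refl _) ((M z).uniqueIso (M₁ z))
      ((M' z).uniqueIso (M₁' z)) ?_ ?_ ?_ ?_
    · simp
    · simp
    · simp [FamRep.toM_uniqueIso]
    · exact (M z).map_uniqueIso _ _ _ _
  · rw [← Category.assoc, hn, FamRep.toM_uniqueIso]

namespace Diag

lemma IsReedyFibration.hasGap {f : B ⟶ B'} (h : IsReedyFibration f)
    (M : ∀ z, FamRep (I.repP z) B Set.univ) (M' : ∀ z, FamRep (I.repP z) B' Set.univ) (z : K) :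
    HasGap M M' (fun f => Fibration f) f z := by
  choose N N' r s h using h
  obtain ⟨P, l, t, hP, k, hl, ht, hk⟩ := h z
  rw [matchingMap_eq_map, toMatching_eq_toM] at hP
  rw [toMatching_eq_toM] at hl
  exact HasGap.congr (M := fun z => MatchingObj.famRep (r z))
    (M' := fun z => MatchingObj.famRep (s z)) ⟨P, t, l, k, hP.flip, hl, ht, hk⟩

lemma IsReedyFibration.of_hasGap {f : B ⟶ B'} {M : ∀ z, FamRep (I.repP z) B Set.univ}
    {M' : ∀ z, FamRep (I.repP z) B' Set.univ}
    (h : ∀ z, HasGap M M' (fun f => Fibration f) f z) : IsReedyFibration f := fun z => by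
  obtain ⟨P, t, n, k, hP, hn, ht, hk⟩ := HasGap.congr
    (M₁ := fun z => MatchingObj.famRep (M z).matchingObj)
    (M₁' := fun z => MatchingObj.famRep (M' z).matchingObj) (h z)
  refine ⟨_, _, (M z).matchingObj, (M' z).matchingObj, P, n, t, ?_, k, ?_, ht, hk⟩
  · rw [matchingMap_eq_map, toMatching_eq_toM]
    exact hP.flip
  · rw [toMatching_eq_toM]
    exact hn

end Diag

end ReedyGap

/-! ## Cofree diagrams -/

section Cofree

variable {C : Type u} [Category.{v} C] [CategoryWithFibrations C] [HasFibrationPullbacks C]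
  {K : Type w} [PartialOrder K] {I : InverseCat C K} {X Y : C}

lemma PDiag.actOn_pullback_lift (A : PDiag I (fun z : K => z) X) {y z : K} (h : y < z) {V : C}
    (a : V ⟶ A.obj z) (b : V ⟶ I.hom h) (e : a ≫ A.anchor z = b ≫ I.src h) :
    pullback.lift a b e ≫ A.actOn h (pullback.fst (A.anchor z) (I.src h)) (pullback.snd _ _)
      pullback.condition = A.actOn h a b e :=
  (A.comp_actOn _ _ _ _ _).trans
    (A.actOn_congr _ _ (pullback.lift_fst _ _ _) (pullback.lift_snd _ _ _))

/-- A diagram from its actions on generalized elements. -/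
noncomputable def PDiag.toDiag (A : PDiag I (fun z : K => z) X) : Diag I X where
  obj := A.obj
  base := A.base
  anchor := A.anchor
  fib_base := A.fib_base
  act h := A.actOn h (pullback.fst _ _) (pullback.snd _ _) pullback.condition
  act_base _ := A.actOn_base _ _ _ _
  act_anchor _ := A.actOn_anchor _ _ _ _
  act_assoc h k _ a b c e₁ e₂ :=
    (A.actOn_pullback_lift k _ c _).trans
      ((A.actOn_congr k _ (A.actOn_pullback_lift h a b e₁) rfl).trans
        ((A.actOn_actOn h k a b c e₁ e₂).trans (A.actOn_pullback_lift (k.trans h) a _ _).symm))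

lemma PDiag.toDiag_actOn (A : PDiag I (fun z : K => z) X) {y z : K} (h : y < z) {V : C}
    (a : V ⟶ A.obj z) (b : V ⟶ I.hom h) (e : a ≫ A.anchor z = b ≫ I.src h) :
    A.toDiag.actOn h a b e = A.actOn h a b e :=
  A.actOn_pullback_lift h a b e

/-- The relation `x ≤ y`, with the two cases `x = y` and `x < y` distinguished. -/
inductive Below (x : K) : K → Type w
  | refl : Below x x
  | lt {y : K} (h : x < y) : Below x y

namespace Below

variable {x y z t : K}

lemma lt_trans (k : y < z) : Below x y → x < z
  | refl => k
  | lt h => h.trans k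

/-- Irreflexivity excludes having both the identity and proper arrows. There is thus at most one
object of arrows from `y` to `x`, and a cofree value is a single relative dependent product. -/
lemma eq_of_below (h h' : Below x y) : h = h' := by
  cases h with
  | refl => cases h' with
    | refl => rfl
    | lt k => exact absurd k (lt_irrefl _)
  | lt h => cases h' with
    | refl => exact absurd h (lt_irrefl _)
    | lt k => rfl

variable (I)

/-- The object of arrows from `y` to `x`, including the identities. -/
def arr : ∀ {y : K}, Below x y → C
  | _, refl => I.obj x
  | _, lt h => I.hom h

/-- The source of arrows. -/
def src : ∀ {y : K} (k : Below x y), k.arr I ⟶ I.obj y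
  | _, refl => 𝟙 (I.obj x)
  | _, lt h => I.src h

/-- The target of arrows. -/
def tgt : ∀ {y : K} (k : Below x y), k.arr I ⟶ I.obj x
  | _, refl => 𝟙 (I.obj x)
  | _, lt h => I.tgt h

instance fibration_src : ∀ {y : K} (h : Below x y), Fibration (h.src I)
  | _, refl => fibration_of_iso (𝟙 (I.obj x))
  | _, lt h => I.fib_src h

variable {I} {V V' : C}

/-- Composition of arrows, on generalized elements. -/
noncomputable def compOn (k : y < z) : ∀ (h : Below x y) (b : V ⟶ I.hom k) (c : V ⟶ h.arr I),
    b ≫ I.tgt k = c ≫ h.src I → (V ⟶ I.hom (h.lt_trans k))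
  | refl, b, _, _ => b
  | lt h, b, c, e => pullback.lift b c e ≫ I.comp k h

lemma comp_compOn (k : y < z) (h : Below x y) (b : V ⟶ I.hom k) (c : V ⟶ h.arr I)
    (e : b ≫ I.tgt k = c ≫ h.src I) (f : V' ⟶ V) : f ≫ h.compOn k b c e =
      h.compOn k (f ≫ b) (f ≫ c) (by rw [Category.assoc, e, Category.assoc]) := by
  cases h with
  | refl => rfl
  | lt h =>
    refine (Category.assoc _ _ _).symm.trans (congrArg (· ≫ I.comp k h) ?_)
    apply pullback.hom_ext <;> simp

lemma compOn_src (k : y < z) (h : Below x y) (b : V ⟶ I.hom k) (c : V ⟶ h.arr I)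
    (e : b ≫ I.tgt k = c ≫ h.src I) : h.compOn k b c e ≫ I.src (h.lt_trans k) = b ≫ I.src k := by
  cases h with
  | refl => rfl
  | lt h =>
    exact (Category.assoc _ _ _).trans ((congrArg (_ ≫ ·) (I.comp_src k h)).trans
      (pullback.lift_fst_assoc _ _ _ _))

lemma compOn_tgt (k : y < z) (h : Below x y) (b : V ⟶ I.hom k) (c : V ⟶ h.arr I)
    (e : b ≫ I.tgt k = c ≫ h.src I) : h.compOn k b c e ≫ I.tgt (h.lt_trans k) = c ≫ h.tgt I := by
  cases h with
  | refl => exact e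
  | lt h =>
    exact (Category.assoc _ _ _).trans ((congrArg (_ ≫ ·) (I.comp_tgt k h)).trans
      (pullback.lift_snd_assoc _ _ _ _))

lemma compOn_compOn (k : z < t) (l : y < z) (h : Below x y) (b : V ⟶ I.hom k) (c : V ⟶ I.hom l)
    (d : V ⟶ h.arr I) (e : b ≫ I.tgt k = c ≫ I.src l) (e' : c ≫ I.tgt l = d ≫ h.src I) :
    (lt (h.lt_trans l)).compOn k b (h.compOn l c d e') (e.trans (h.compOn_src l c d e').symm) =
      h.compOn (l.trans k) (pullback.lift b c e ≫ I.comp k l) d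
        (by rw [Category.assoc, I.comp_tgt, pullback.lift_snd_assoc, e']) := by
  cases h with
  | refl => rfl
  | lt h => exact (I.assoc k l h b c d e e').symm

lemma compOn_congr (k : y < z) (h : Below x y) {b b' : V ⟶ I.hom k} {c c' : V ⟶ h.arr I}
    (e : b ≫ I.tgt k = c ≫ h.src I) (hb : b = b') (hc : c = c') :
    h.compOn k b c e = h.compOn k b' c' (by rw [← hb, ← hc, e]) := by
  subst hb hc; rfl

/-- The action of arrows, including the identities, on generalized elements. -/
noncomputable def actOn (B : Diag I Y) : ∀ {z : K} (h : Below x z) (b : V ⟶ B.obj z)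
    (c : V ⟶ h.arr I), b ≫ B.anchor z = c ≫ h.src I → (V ⟶ B.obj x)
  | _, refl, b, _, _ => b
  | _, lt h, b, c, e => B.actOn h b c e

variable (B : Diag I Y)

lemma comp_actOn (h : Below x z) (b : V ⟶ B.obj z) (c : V ⟶ h.arr I)
    (e : b ≫ B.anchor z = c ≫ h.src I) (f : V' ⟶ V) : f ≫ h.actOn B b c e =
      h.actOn B (f ≫ b) (f ≫ c) (by rw [Category.assoc, e, Category.assoc]) := by
  cases h with
  | refl => rfl
  | lt h => exact B.comp_actOn _ _ _ _ _

lemma actOn_base (h : Below x z) (b : V ⟶ B.obj z) (c : V ⟶ h.arr I)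
    (e : b ≫ B.anchor z = c ≫ h.src I) : h.actOn B b c e ≫ B.base x = b ≫ B.base z := by
  cases h with
  | refl => rfl
  | lt h => exact B.actOn_base _ _ _ _

lemma actOn_anchor (h : Below x z) (b : V ⟶ B.obj z) (c : V ⟶ h.arr I)
    (e : b ≫ B.anchor z = c ≫ h.src I) : h.actOn B b c e ≫ B.anchor x = c ≫ h.tgt I := by
  cases h with
  | refl => exact e
  | lt h => exact B.actOn_anchor _ _ _ _

lemma actOn_actOn (k : y < z) (h : Below x y) (a : V ⟶ B.obj z) (b : V ⟶ I.hom k)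
    (c : V ⟶ h.arr I) (e : a ≫ B.anchor z = b ≫ I.src k) (e' : b ≫ I.tgt k = c ≫ h.src I) :
    h.actOn B (B.actOn k a b e) c (by rw [Diag.actOn_anchor, e']) =
      B.actOn (h.lt_trans k) a (h.compOn k b c e') (by rw [compOn_src, e]) := by
  cases h with
  | refl => rfl
  | lt h => exact B.act_assoc k h a b c e e'

lemma actOn_congr (h : Below x z) {b b' : V ⟶ B.obj z} {c c' : V ⟶ h.arr I}
    (e : b ≫ B.anchor z = c ≫ h.src I) (hb : b = b') (hc : c = c') :
    h.actOn B b c e = h.actOn B b' c' (by rw [← hb, ← hc, e]) := by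
  subst hb hc; rfl

lemma actOn_app {B B' : Diag I Y} (g : B ⟶ B') (h : Below x z) (b : V ⟶ B.obj z) (c : V ⟶ h.arr I)
    (e : b ≫ B.anchor z = c ≫ h.src I) : h.actOn B b c e ≫ g.app x =
      h.actOn B' (b ≫ g.app z) c (by rw [Category.assoc, g.app_anchor, e]) := by
  cases h with
  | refl => rfl
  | lt h => exact Diag.actOn_app g _ _ _ _

end Below

/-- The family of elements of `I(x) × Y` parametrized by the arrows from `z` to `x`. -/
noncomputable def cofreeBase {x z : K} (Y : C) (h : Below x z) :
    pullback (prod.fst : I.obj z ⨯ Y ⟶ I.obj z) (h.src I) ⟶ I.obj x ⨯ Y :=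
  prod.lift (pullback.snd _ _ ≫ h.tgt I) (pullback.fst _ _ ≫ prod.snd)

/-- The value at `z` of the cofree diagram on `e : E ⟶ I(x) × Y`: the dependent product of `E`
over the arrows from `z` to `x`. -/
structure CofreeObj {x : K} {E : C} (e : E ⟶ I.obj x ⨯ Y) (z : K) where
  obj : C
  π : obj ⟶ I.obj z ⨯ Y
  ev : ∀ h : Below x z, pullback (π ≫ prod.fst) (h.src I) ⟶ E
  isRelPi : ∀ h : Below x z, IsRelPi (h.src I) prod.fst (cofreeBase Y h) e π (ev h)
  -- With no arrows from `z` to `x`, the product is empty and only the base `I(z) × Y` remains.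
  isIso_of_isEmpty : IsEmpty (Below x z) → IsIso π
  fib : Fibration π

namespace CofreeObj

variable {x z : K} {E : C} {e : E ⟶ I.obj x ⨯ Y} (P : CofreeObj e z) {V V' : C}

/-- Evaluation at an arrow, on generalized elements. -/
noncomputable def evOn (s : V ⟶ P.obj) (h : Below x z) (c : V ⟶ h.arr I)
    (hs : s ≫ P.π ≫ prod.fst = c ≫ h.src I) : V ⟶ E := pullback.lift s c hs ≫ P.ev h

lemma evOn_congr {s s' : V ⟶ P.obj} (h : Below x z) {c c' : V ⟶ h.arr I}
    (hs : s ≫ P.π ≫ prod.fst = c ≫ h.src I) (hs' : s = s') (hc : c = c') :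
    P.evOn s h c hs = P.evOn s' h c' (by rw [← hs', ← hc, hs]) := by
  subst hs' hc; rfl

lemma comp_evOn (s : V ⟶ P.obj) (h : Below x z) (c : V ⟶ h.arr I)
    (hs : s ≫ P.π ≫ prod.fst = c ≫ h.src I) (f : V' ⟶ V) :
    f ≫ P.evOn s h c hs = P.evOn (f ≫ s) h (f ≫ c)
      (by rw [Category.assoc, hs, Category.assoc]) := by
  rw [evOn, evOn, ← Category.assoc]
  congr 1
  apply pullback.hom_ext <;> simp

lemma evOn_comp (s : V ⟶ P.obj) (h : Below x z) (c : V ⟶ h.arr I)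
    (hs : s ≫ P.π ≫ prod.fst = c ≫ h.src I) :
    P.evOn s h c hs ≫ e = prod.lift (c ≫ h.tgt I) (s ≫ P.π ≫ prod.snd) := by
  rw [evOn, Category.assoc, (P.isRelPi h).w]
  apply Limits.prod.hom_ext <;> simp [cofreeBase]

lemma ext {s s' : V ⟶ P.obj} (hπ : s ≫ P.π = s' ≫ P.π)
    (H : ∀ (h : Below x z) {U : C} (f : U ⟶ V) (c : U ⟶ h.arr I)
      (hs : (f ≫ s) ≫ P.π ≫ prod.fst = c ≫ h.src I)
      (hs' : (f ≫ s') ≫ P.π ≫ prod.fst = c ≫ h.src I),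
      P.evOn (f ≫ s) h c hs = P.evOn (f ≫ s') h c hs') : s = s' := by
  by_cases hx : IsEmpty (Below x z)
  · have := P.isIso_of_isEmpty hx
    exact (cancel_mono P.π).1 hπ
  · obtain ⟨h⟩ := not_isEmpty_iff.1 hx
    have h₁ : s ≫ P.π ≫ prod.fst = s' ≫ P.π ≫ prod.fst := by
      rw [← Category.assoc, hπ, Category.assoc]
    refine (P.isRelPi h).hom_ext h₁ rfl hπ ?_
    exact H h (pullback.fst (s' ≫ P.π ≫ prod.fst) (h.src I)) (pullback.snd _ _) _ _

lemma exists_lift (w : V ⟶ I.obj z ⨯ Y)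
    (m : ∀ h : Below x z, pullback (w ≫ prod.fst) (h.src I) ⟶ E)
    (hm : ∀ h, m h ≫ e = prod.lift (pullback.snd _ _ ≫ h.tgt I)
      (pullback.fst _ _ ≫ w ≫ prod.snd)) :
    ∃ s : V ⟶ P.obj, s ≫ P.π = w ∧ ∀ (h : Below x z) {U : C} (f : U ⟶ V) (c : U ⟶ h.arr I)
      (hs : (f ≫ s) ≫ P.π ≫ prod.fst = c ≫ h.src I) (hw : f ≫ w ≫ prod.fst = c ≫ h.src I),
      P.evOn (f ≫ s) h c hs = pullback.lift f c hw ≫ m h := by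
  by_cases hx : IsEmpty (Below x z)
  · have := P.isIso_of_isEmpty hx
    exact ⟨w ≫ inv P.π, by simp, fun h => (hx.false h).elim⟩
  · obtain ⟨h⟩ := not_isEmpty_iff.1 hx
    obtain ⟨s, hs, hs'⟩ := (P.isRelPi h).exists_lift w rfl (m h) (by
      rw [hm, cofreeBase]
      apply Limits.prod.hom_ext <;> simp)
    refine ⟨s, hs, fun h' U f c hs₁ hw => ?_⟩
    obtain rfl := h.eq_of_below h'
    rw [← hs', ← Category.assoc, evOn]
    congr 1
    apply pullback.hom_ext <;> simp

end CofreeObj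

section

variable {x : K} {E F : C} {e : E ⟶ I.obj x ⨯ Y} {e' : F ⟶ I.obj x ⨯ Y}
  (S : ∀ z, CofreeObj e z) (S' : ∀ z, CofreeObj e' z) {y z : K} {V V' : C}

/-- An element of the cofree diagram at `z` is a function `a` on arrows from `z` to `x`. An arrow
`b` from `z` to `y` sends it to `c ↦ a (c ∘ b)`, a function on arrows from `y` to `x`; `compOn` is
this composition. -/
lemma exists_cofreeAct (k : y < z) (a : V ⟶ (S z).obj) (b : V ⟶ I.hom k)
    (d : a ≫ (S z).π ≫ prod.fst = b ≫ I.src k) : ∃ s : V ⟶ (S y).obj,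
    s ≫ (S y).π = prod.lift (b ≫ I.tgt k) (a ≫ (S z).π ≫ prod.snd) ∧
    ∀ (h : Below x y) {U : C} (f : U ⟶ V) (c : U ⟶ h.arr I)
      (hs : (f ≫ s) ≫ (S y).π ≫ prod.fst = c ≫ h.src I) (hw : (f ≫ b) ≫ I.tgt k = c ≫ h.src I),
      (S y).evOn (f ≫ s) h c hs = (S z).evOn (f ≫ a) (.lt (h.lt_trans k))
        (h.compOn k (f ≫ b) c hw) (by
          refine Eq.trans ?_ (h.compOn_src k (f ≫ b) c hw).symm
          rw [Category.assoc, d, Category.assoc]) := by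
  let w : V ⟶ I.obj y ⨯ Y := prod.lift (b ≫ I.tgt k) (a ≫ (S z).π ≫ prod.snd)
  have hw (h : Below x y) : (pullback.fst (w ≫ prod.fst) (h.src I) ≫ b) ≫ I.tgt k =
      pullback.snd (w ≫ prod.fst) (h.src I) ≫ h.src I := by
    rw [← pullback.condition]
    simp [w]
  have hd (h : Below x y) : (pullback.fst (w ≫ prod.fst) (h.src I) ≫ a) ≫ (S z).π ≫ prod.fst =
      h.compOn k (pullback.fst (w ≫ prod.fst) (h.src I) ≫ b) (pullback.snd _ _) (hw h) ≫
        I.src (h.lt_trans k) := by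
    rw [Below.compOn_src, Category.assoc, d, Category.assoc]
  obtain ⟨s, hs, H⟩ := (S y).exists_lift w (fun h => (S z).evOn (pullback.fst _ _ ≫ a)
    (.lt (h.lt_trans k)) (h.compOn k (pullback.fst _ _ ≫ b) (pullback.snd _ _) (hw h)) (hd h))
    (fun h => by
      refine ((S z).evOn_comp _ _ _ _).trans ?_
      apply Limits.prod.hom_ext
      · refine (prod.lift_fst _ _).trans (Eq.trans ?_ (prod.lift_fst _ _).symm)
        exact Below.compOn_tgt _ _ _ _ _
      · simp [w])
  refine ⟨s, hs, fun h U f c hs₁ hw₁ => ?_⟩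
  refine (H h f c hs₁ (by rw [← hw₁]; simp [w])).trans (((S z).comp_evOn _ _ _ _ _).trans
    ((S z).evOn_congr _ _ (by simp) ?_))
  refine (h.comp_compOn _ _ _ _ _).trans (h.compOn_congr _ _ (by simp) (by simp))

/-- The action on the cofree diagram. -/
noncomputable def cofreeAct (k : y < z) (a : V ⟶ (S z).obj) (b : V ⟶ I.hom k)
    (d : a ≫ (S z).π ≫ prod.fst = b ≫ I.src k) : V ⟶ (S y).obj :=
  (exists_cofreeAct S k a b d).choose

lemma cofreeAct_π (k : y < z) (a : V ⟶ (S z).obj) (b : V ⟶ I.hom k)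
    (d : a ≫ (S z).π ≫ prod.fst = b ≫ I.src k) :
    cofreeAct S k a b d ≫ (S y).π = prod.lift (b ≫ I.tgt k) (a ≫ (S z).π ≫ prod.snd) :=
  (exists_cofreeAct S k a b d).choose_spec.1

lemma cofreeAct_fst (k : y < z) (a : V ⟶ (S z).obj) (b : V ⟶ I.hom k)
    (d : a ≫ (S z).π ≫ prod.fst = b ≫ I.src k) :
    cofreeAct S k a b d ≫ (S y).π ≫ prod.fst = b ≫ I.tgt k := by
  rw [← Category.assoc, cofreeAct_π, prod.lift_fst]

lemma cofreeAct_snd (k : y < z) (a : V ⟶ (S z).obj) (b : V ⟶ I.hom k)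
    (d : a ≫ (S z).π ≫ prod.fst = b ≫ I.src k) :
    cofreeAct S k a b d ≫ (S y).π ≫ prod.snd = a ≫ (S z).π ≫ prod.snd := by
  rw [← Category.assoc, cofreeAct_π, prod.lift_snd]

lemma evOn_comp_cofreeAct (k : y < z) (a : V ⟶ (S z).obj) (b : V ⟶ I.hom k)
    (d : a ≫ (S z).π ≫ prod.fst = b ≫ I.src k) (h : Below x y) {U : C} (f : U ⟶ V)
    (c : U ⟶ h.arr I) (hs : (f ≫ cofreeAct S k a b d) ≫ (S y).π ≫ prod.fst = c ≫ h.src I)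
    (hw : (f ≫ b) ≫ I.tgt k = c ≫ h.src I) (hs' : (f ≫ a) ≫ (S z).π ≫ prod.fst =
      h.compOn k (f ≫ b) c hw ≫ I.src (h.lt_trans k)) :
    (S y).evOn (f ≫ cofreeAct S k a b d) h c hs =
      (S z).evOn (f ≫ a) (.lt (h.lt_trans k)) (h.compOn k (f ≫ b) c hw) hs' :=
  (exists_cofreeAct S k a b d).choose_spec.2 h f c hs hw

lemma comp_cofreeAct (k : y < z) (a : V ⟶ (S z).obj) (b : V ⟶ I.hom k)
    (d : a ≫ (S z).π ≫ prod.fst = b ≫ I.src k) (f : V' ⟶ V) :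
    f ≫ cofreeAct S k a b d = cofreeAct S k (f ≫ a) (f ≫ b)
      (by rw [Category.assoc, d, Category.assoc]) := by
  refine (S y).ext ?_ fun h U g c hs hs' => ?_
  · rw [Category.assoc, cofreeAct_π, cofreeAct_π]
    apply Limits.prod.hom_ext <;> simp
  · have hw : (g ≫ f ≫ b) ≫ I.tgt k = c ≫ h.src I := by
      rw [← hs', Category.assoc g (cofreeAct _ _ _ _ _), cofreeAct_fst, Category.assoc]
    have hw' : ((g ≫ f) ≫ b) ≫ I.tgt k = c ≫ h.src I := by rw [← hw]; simp
    have hd : (g ≫ f ≫ a) ≫ (S z).π ≫ prod.fst =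
        h.compOn k (g ≫ f ≫ b) c hw ≫ I.src (h.lt_trans k) := by
      rw [Below.compOn_src]; simp [d]
    refine Eq.trans ?_ (evOn_comp_cofreeAct S k _ _ _ h g c hs' hw hd).symm
    refine ((S y).evOn_congr h hs (Category.assoc _ _ _).symm rfl).trans
      ((evOn_comp_cofreeAct S k a b d h (g ≫ f) c _ hw' ?_).trans
      ((S z).evOn_congr _ _ (Category.assoc _ _ _)
        (h.compOn_congr _ _ (Category.assoc _ _ _) rfl)))
    rw [Below.compOn_src]; simp [d]

/-- After evaluation at an arrow to `x`, this becomes associativity of composition,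
`Below.compOn_compOn`. -/
lemma cofreeAct_cofreeAct {t : K} (k : z < t) (l : y < z) (a : V ⟶ (S t).obj) (b : V ⟶ I.hom k)
    (c : V ⟶ I.hom l) (d : a ≫ (S t).π ≫ prod.fst = b ≫ I.src k)
    (d' : b ≫ I.tgt k = c ≫ I.src l)
    (d₁ : cofreeAct S k a b d ≫ (S z).π ≫ prod.fst = c ≫ I.src l)
    (d₂ : a ≫ (S t).π ≫ prod.fst = (pullback.lift b c d' ≫ I.comp k l) ≫ I.src (l.trans k)) :
    cofreeAct S l (cofreeAct S k a b d) c d₁ =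
      cofreeAct S (l.trans k) a (pullback.lift b c d' ≫ I.comp k l) d₂ := by
  refine (S y).ext ?_ fun h U g m hs hs' => ?_
  · rw [cofreeAct_π, cofreeAct_π, ← Category.assoc (cofreeAct S k a b d), cofreeAct_π]
    apply Limits.prod.hom_ext
    · simp [I.comp_tgt]
    · simp
  · have hw : (g ≫ c) ≫ I.tgt l = m ≫ h.src I := by
      rw [← hs, Category.assoc g (cofreeAct _ _ _ _ _), cofreeAct_fst, Category.assoc]
    have e₁ : (g ≫ b) ≫ I.tgt k = (g ≫ c) ≫ I.src l := by
      rw [Category.assoc, d', Category.assoc]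
    have e₂ : g ≫ pullback.lift b c d' ≫ I.comp k l =
        pullback.lift (g ≫ b) (g ≫ c) e₁ ≫ I.comp k l := by
      rw [← Category.assoc]
      congr 1
      apply pullback.hom_ext <;> simp
    have hw' : (g ≫ pullback.lift b c d' ≫ I.comp k l) ≫ I.tgt (l.trans k) = m ≫ h.src I := by
      rw [e₂, Category.assoc, I.comp_tgt, pullback.lift_snd_assoc, hw]
    have hd : (g ≫ cofreeAct S k a b d) ≫ (S z).π ≫ prod.fst =
        h.compOn l (g ≫ c) m hw ≫ I.src (h.lt_trans l) := by
      rw [Below.compOn_src, Category.assoc, d₁, Category.assoc]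
    have hd₁ : (g ≫ b) ≫ I.tgt k = h.compOn l (g ≫ c) m hw ≫ I.src (h.lt_trans l) := by
      rw [Below.compOn_src, e₁]
    have hd₂ : (g ≫ a) ≫ (S t).π ≫ prod.fst = (Below.lt (h.lt_trans l)).compOn k (g ≫ b)
        (h.compOn l (g ≫ c) m hw) hd₁ ≫ I.src ((h.lt_trans l).trans k) := by
      refine Eq.trans ?_ (Below.compOn_src _ (.lt (h.lt_trans l)) _ _ _).symm
      rw [Category.assoc, d, Category.assoc]
    have hd₃ : (g ≫ a) ≫ (S t).π ≫ prod.fst = h.compOn (l.trans k)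
        (g ≫ pullback.lift b c d' ≫ I.comp k l) m hw' ≫ I.src (h.lt_trans (l.trans k)) := by
      rw [Below.compOn_src, Category.assoc, d₂, ← Category.assoc g]
    refine (evOn_comp_cofreeAct S l _ c d₁ h g m hs hw hd).trans
      ((evOn_comp_cofreeAct S k a b d (.lt (h.lt_trans l)) g _ hd hd₁ hd₂).trans
        (Eq.trans ?_ (evOn_comp_cofreeAct S (l.trans k) a _ d₂ h g m hs' hw' hd₃).symm))
    refine (S t).evOn_congr _ _ rfl ?_
    refine (Below.compOn_compOn k l h (g ≫ b) (g ≫ c) m e₁ hw).trans ?_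
    exact h.compOn_congr _ _ e₂.symm rfl

/-- The cofree diagram, with its actions on generalized elements. -/
noncomputable def cofreeP : PDiag I (fun z : K => z) Y where
  obj z := (S z).obj
  base z := (S z).π ≫ prod.snd
  anchor z := (S z).π ≫ prod.fst
  fib_base z := fibration_comp (S z).fib (fibration_prod_snd _ _)
  actOn k _ a b d := cofreeAct S k a b d
  comp_actOn k _ _ f a b d := comp_cofreeAct S k a b d f
  actOn_base k _ a b d := cofreeAct_snd S k a b d
  actOn_anchor k _ a b d := cofreeAct_fst S k a b d
  actOn_actOn k l _ a b c d d' := cofreeAct_cofreeAct S k l a b c d d' _ _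

/-- The cofree diagram on an object over `I(x) × Y`. -/
noncomputable def cofree : Diag I Y := (cofreeP S).toDiag

lemma cofree_actOn (k : y < z) (a : V ⟶ (S z).obj) (b : V ⟶ I.hom k)
    (d : a ≫ (S z).π ≫ prod.fst = b ≫ I.src k) :
    (cofree S).actOn k a b d = cofreeAct S k a b d :=
  (cofreeP S).toDiag_actOn k a b d

/-- Evaluation at the identity arrow. -/
noncomputable def cofreeCounit : (S x).obj ⟶ E :=
  (S x).evOn (𝟙 _) .refl ((S x).π ≫ prod.fst)
    ((Category.id_comp _).trans (Category.comp_id _).symm)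

lemma cofreeCounit_comp : cofreeCounit S ≫ e = (S x).π := by
  refine ((S x).evOn_comp _ _ _ _).trans ?_
  apply Limits.prod.hom_ext
  · exact (prod.lift_fst _ _).trans (Category.comp_id _)
  · exact (prod.lift_snd _ _).trans (Category.id_comp _)

lemma comp_cofreeCounit (s : V ⟶ (S x).obj) (c : V ⟶ I.obj x)
    (hs : s ≫ (S x).π ≫ prod.fst = c ≫ 𝟙 _) :
    s ≫ cofreeCounit S = (S x).evOn s .refl c hs :=
  ((S x).comp_evOn _ _ _ _ _).trans
    ((S x).evOn_congr _ _ (Category.comp_id _) (hs.trans (Category.comp_id _)))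

/-- Acting by an arrow and then evaluating at the identity is evaluating at that arrow. All
evaluations are thus determined by the action and the counit, which gives uniqueness in the
adjunction (`cofree_hom_ext`). -/
lemma actOn_cofreeCounit (h : Below x z) (s : V ⟶ (S z).obj) (c : V ⟶ h.arr I)
    (hs : s ≫ (S z).π ≫ prod.fst = c ≫ h.src I) :
    h.actOn (cofree S) s c hs ≫ cofreeCounit S = (S z).evOn s h c hs := by
  cases h with
  | refl => exact comp_cofreeCounit S s c hs
  | lt h =>
    have hw : (𝟙 V ≫ c) ≫ I.tgt h = (c ≫ I.tgt h) ≫ (Below.refl (x := x)).src I :=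
      (congrArg (· ≫ I.tgt h) (Category.id_comp c)).trans (Category.comp_id _).symm
    have h₁ : cofreeAct S h s c hs ≫ (S x).π ≫ prod.fst = (c ≫ I.tgt h) ≫ 𝟙 _ :=
      (cofreeAct_fst S h s c hs).trans (Category.comp_id _).symm
    have h₂ : (𝟙 V ≫ cofreeAct S h s c hs) ≫ (S x).π ≫ prod.fst =
        (c ≫ I.tgt h) ≫ (Below.refl (x := x)).src I :=
      (congrArg (· ≫ _) (Category.id_comp _)).trans h₁
    have h₃ : (𝟙 V ≫ s) ≫ (S z).π ≫ prod.fst = (𝟙 V ≫ c) ≫ I.src h := by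
      rw [Category.id_comp, Category.id_comp]
      exact hs
    refine (congrArg (· ≫ cofreeCounit S) (cofree_actOn S h s c hs)).trans
      ((comp_cofreeCounit S _ _ h₁).trans (((S x).evOn_congr _ _ (Category.id_comp _).symm rfl).trans
        ((evOn_comp_cofreeAct S h s c hs .refl (𝟙 V) (c ≫ I.tgt h) h₂ hw h₃).trans ?_)))
    exact (S z).evOn_congr _ _ (Category.id_comp _) (Category.id_comp _)

variable {B : Diag I Y}

/-- The transpose of `u` sends an element `f` of `B_z` to the function taking an arrow `c` from `z`
to `x` to `u` applied to `c` acting on `f`. -/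
lemma exists_cofreeLiftApp (u : B.obj x ⟶ E) (hu : u ≫ e = prod.lift (B.anchor x) (B.base x))
    (z : K) : ∃ s : B.obj z ⟶ (S z).obj, s ≫ (S z).π = prod.lift (B.anchor z) (B.base z) ∧
      ∀ (h : Below x z) {U : C} (f : U ⟶ B.obj z) (c : U ⟶ h.arr I)
        (hs : (f ≫ s) ≫ (S z).π ≫ prod.fst = c ≫ h.src I) (hc : f ≫ B.anchor z = c ≫ h.src I),
        (S z).evOn (f ≫ s) h c hs = h.actOn B f c hc ≫ u := by
  have hw (h : Below x z) : pullback.fst (prod.lift (B.anchor z) (B.base z) ≫ prod.fst) (h.src I) ≫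
      B.anchor z = pullback.snd _ _ ≫ h.src I := by
    rw [← pullback.condition]
    exact congrArg (_ ≫ ·) (prod.lift_fst _ _).symm
  obtain ⟨s, hs, H⟩ := (S z).exists_lift (prod.lift (B.anchor z) (B.base z))
    (fun h => h.actOn B (pullback.fst _ _) (pullback.snd _ _) (hw h) ≫ u) (fun h => by
      rw [Category.assoc, hu, prod.comp_lift, Below.actOn_anchor, Below.actOn_base, prod.lift_snd])
  refine ⟨s, hs, fun h U f c hs₁ hc => (H h f c hs₁ (by rw [prod.lift_fst, hc])).trans ?_⟩
  rw [← Category.assoc, Below.comp_actOn]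
  congr 1
  exact h.actOn_congr B _ (pullback.lift_fst _ _ _) (pullback.lift_snd _ _ _)

/-- Maps to the cofree diagram. -/
lemma exists_cofreeLift (u : B.obj x ⟶ E) (hu : u ≫ e = prod.lift (B.anchor x) (B.base x)) :
    ∃ φ : B ⟶ cofree S, φ.app x ≫ cofreeCounit S = u := by
  choose s hs H using exists_cofreeLiftApp S u hu
  have hb (z : K) : s z ≫ (S z).π ≫ prod.snd = B.base z := by
    rw [← Category.assoc, hs, prod.lift_snd]
  have ha (z : K) : s z ≫ (S z).π ≫ prod.fst = B.anchor z := by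
    rw [← Category.assoc, hs, prod.lift_fst]
  have hact {z y : K} (k : y < z) {V : C} (a : V ⟶ B.obj z) (b : V ⟶ I.hom k)
      (d : a ≫ B.anchor z = b ≫ I.src k) (d' : (a ≫ s z) ≫ (S z).π ≫ prod.fst = b ≫ I.src k) :
      B.actOn k a b d ≫ s y = cofreeAct S k (a ≫ s z) b d' := by
    refine (S y).ext ?_ fun h U f c hc hc' => ?_
    · rw [Category.assoc, hs, prod.comp_lift, B.actOn_anchor, B.actOn_base, cofreeAct_π,
        Category.assoc, hb]
    · have e₁ : (f ≫ a) ≫ B.anchor z = (f ≫ b) ≫ I.src k := by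
        rw [Category.assoc, d, Category.assoc]
      have e₂ : (f ≫ b) ≫ I.tgt k = c ≫ h.src I := by
        rw [← hc', Category.assoc f (cofreeAct _ _ _ _ _), cofreeAct_fst, Category.assoc]
      have e₃ : (f ≫ B.actOn k a b d) ≫ B.anchor y = c ≫ h.src I := by
        rw [Category.assoc, B.actOn_anchor, ← Category.assoc, e₂]
      have e₄ : (f ≫ a ≫ s z) ≫ (S z).π ≫ prod.fst =
          h.compOn k (f ≫ b) c e₂ ≫ I.src (h.lt_trans k) := by
        rw [Below.compOn_src, Category.assoc, d', Category.assoc]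
      have e₅ : (f ≫ a) ≫ B.anchor z = h.compOn k (f ≫ b) c e₂ ≫ I.src (h.lt_trans k) := by
        rw [Below.compOn_src, e₁]
      have e₆ : ((f ≫ a) ≫ s z) ≫ (S z).π ≫ prod.fst =
          h.compOn k (f ≫ b) c e₂ ≫ I.src (h.lt_trans k) := by
        rw [Category.assoc f, e₄]
      have e₇ : ((f ≫ B.actOn k a b d) ≫ s y) ≫ (S y).π ≫ prod.fst = c ≫ h.src I := by
        rw [Category.assoc f, hc]
      refine ((S y).evOn_congr h hc (Category.assoc _ _ _).symm rfl).trans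
        ((H y h (f ≫ B.actOn k a b d) c e₇ e₃).trans (Eq.trans ?_
        ((evOn_comp_cofreeAct S k (a ≫ s z) b d' h f c hc' e₂ e₄).trans
          (((S z).evOn_congr _ e₄ (Category.assoc _ _ _).symm rfl).trans
            (H z (.lt (h.lt_trans k)) (f ≫ a) (h.compOn k (f ≫ b) c e₂) e₆ e₅))).symm))
      refine congrArg (· ≫ u) ?_
      exact (h.actOn_congr B e₃ (B.comp_actOn _ _ _ _ _) rfl).trans
        (h.actOn_actOn B k (f ≫ a) (f ≫ b) c e₁ e₂)
  let φ : B ⟶ cofree S := Diag.Hom.mk s hb ha (fun k => Diag.act_app_of_actOn (B := cofree S) s ha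
    (fun k _ a b d => (hact k a b d ((Category.assoc _ _ _).trans
      ((congrArg (fun t => a ≫ t) (ha _)).trans d))).trans (cofree_actOn S k (a ≫ s _) b _).symm) k)
  refine ⟨φ, ?_⟩
  refine (comp_cofreeCounit S (s x) (B.anchor x) ((ha x).trans (Category.comp_id _).symm)).trans ?_
  have e₀ : (𝟙 _ ≫ s x) ≫ (S x).π ≫ prod.fst = B.anchor x ≫ (Below.refl (x := x)).src I := by
    rw [Category.id_comp]
    exact (ha x).trans (Category.comp_id _).symm
  refine ((S x).evOn_congr _ _ (Category.id_comp _).symm rfl).trans ((H x .refl (𝟙 _) (B.anchor x) e₀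
    ((Category.id_comp _).trans (Category.comp_id _).symm)).trans ?_)
  exact Category.id_comp _

lemma cofree_hom_ext {φ ψ : B ⟶ cofree S}
    (h : φ.app x ≫ cofreeCounit S = ψ.app x ≫ cofreeCounit S) : φ = ψ := by
  have hp (φ : B ⟶ cofree S) (z : K) : φ.app z ≫ (S z).π = prod.lift (B.anchor z) (B.base z) := by
    apply Limits.prod.hom_ext
    · exact (Category.assoc _ _ _).trans ((φ.app_anchor z).trans (prod.lift_fst _ _).symm)
    · exact (Category.assoc _ _ _).trans ((φ.app_base z).trans (prod.lift_snd _ _).symm)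
  have he (φ : B ⟶ cofree S) {z : K} (h : Below x z) {U : C} (f : U ⟶ B.obj z) (c : U ⟶ h.arr I)
      (hc : f ≫ B.anchor z = c ≫ h.src I) (hs : (f ≫ φ.app z) ≫ (S z).π ≫ prod.fst = c ≫ h.src I) :
      (S z).evOn (f ≫ φ.app z) h c hs = h.actOn B f c hc ≫ φ.app x ≫ cofreeCounit S :=
    (actOn_cofreeCounit S h (f ≫ φ.app z) c hs).symm.trans
      ((congrArg (· ≫ cofreeCounit S) (h.actOn_app φ f c hc).symm).trans (Category.assoc _ _ _))
  refine Diag.hom_ext fun z => (S z).ext ((hp φ z).trans (hp ψ z).symm) fun k U f c hs hs' => ?_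
  have hc : f ≫ B.anchor z = c ≫ k.src I := by
    rw [← hs]
    exact (congrArg (f ≫ ·) (φ.app_anchor z)).symm.trans (Category.assoc _ _ _).symm
  exact (he φ k f c hc hs).trans ((congrArg (k.actOn B f c hc ≫ ·) h).trans (he ψ k f c hc hs').symm)

/-- Functoriality of cofree diagrams. -/
lemma exists_cofreeMap (v : E ⟶ F) (hv : v ≫ e' = e) :
    ∃ φ : cofree S ⟶ cofree S', φ.app x ≫ cofreeCounit S' =
      (cofreeCounit S ≫ v : (S x).obj ⟶ F) := by
  refine exists_cofreeLift S' (B := cofree S) (cofreeCounit S ≫ v : (S x).obj ⟶ F) ?_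
  refine (Category.assoc _ _ _).trans ((congrArg (cofreeCounit S ≫ ·) hv).trans
    ((cofreeCounit_comp S).trans ?_))
  apply Limits.prod.hom_ext
  · exact (prod.lift_fst _ _).symm
  · exact (prod.lift_snd _ _).symm

end

end Cofree

/-! ## Cofree diagrams are Reedy fibrant -/

section CofreeReedy

variable {C : Type u} [Category.{v} C] [CategoryWithFibrations C]
  [IsTypeTheoreticFibrationCategory C] {K : Type w} [PartialOrder K] {I : InverseCat C K} {Y : C}
  {x z : K} {E F : C} {e : E ⟶ I.obj x ⨯ Y} {e' : F ⟶ I.obj x ⨯ Y}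

lemma exists_cofreeObj (e : E ⟶ I.obj x ⨯ Y) [Fibration e] (z : K) : Nonempty (CofreeObj e z) := by
  by_cases hx : IsEmpty (Below x z)
  · exact ⟨⟨_, 𝟙 _, fun h => (hx.false h).elim, fun h => (hx.false h).elim,
      fun _ => inferInstance, fibration_of_iso _⟩⟩
  · obtain ⟨h⟩ := not_isEmpty_iff.1 hx
    obtain ⟨P, π, r, ev, hπ, H⟩ := exists_isRelPi (h.src I) prod.fst (cofreeBase Y h) e
    obtain rfl := H.comm
    refine ⟨⟨P, π, fun h' => h.eq_of_below h' ▸ ev, fun h' => ?_, fun h' => (h'.false h).elim, hπ⟩⟩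
    obtain rfl := h.eq_of_below h'
    exact H

variable (S : ∀ z, CofreeObj e z) (S' : ∀ z, CofreeObj e' z)

lemma cofree_hom_π {B : Diag I Y} (φ : B ⟶ cofree S) (z : K) :
    φ.app z ≫ (S z).π = prod.lift (B.anchor z) (B.base z) := by
  apply Limits.prod.hom_ext
  · exact (Category.assoc _ _ _).trans ((φ.app_anchor z).trans (prod.lift_fst _ _).symm)
  · exact (Category.assoc _ _ _).trans ((φ.app_base z).trans (prod.lift_snd _ _).symm)

/-- If there are arrows from `z` to `x`, the component at `z` is a relative dependent product of `v`
by `IsRelPi.of_comp`; otherwise it is an isomorphism between two copies of `I(z) × Y`. -/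
lemma fibration_cofreeMap (v : E ⟶ F) [Fibration v] (hv : v ≫ e' = e) (φ : cofree S ⟶ cofree S')
    (hφ : φ.app x ≫ cofreeCounit S' = (cofreeCounit S ≫ v : (S x).obj ⟶ F)) (z : K) :
    Fibration (φ.app z) := by
  let t : (S z).obj ⟶ (S' z).obj := φ.app z
  have ht : t ≫ (S' z).π = (S z).π := by
    refine (cofree_hom_π S' φ z).trans ?_
    apply Limits.prod.hom_ext
    · exact prod.lift_fst _ _
    · exact prod.lift_snd _ _
  change Fibration t
  by_cases hx : IsEmpty (Below x z)
  · have := (S z).isIso_of_isEmpty hx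
    have := (S' z).isIso_of_isEmpty hx
    have : IsIso (t ≫ (S' z).π) := by rw [ht]; infer_instance
    have := IsIso.of_isIso_comp_right t (S' z).π
    exact fibration_of_iso t
  · obtain ⟨h⟩ := not_isEmpty_iff.1 hx
    have hr : t ≫ (S' z).π ≫ prod.fst = (S z).π ≫ prod.fst := by rw [← Category.assoc, ht]
    refine (((S z).isRelPi h).of_comp hv ((S' z).isRelPi h) ht hr ?_).fibration
    let f := pullback.fst ((S z).π ≫ prod.fst) (h.src I)
    let c := pullback.snd ((S z).π ≫ prod.fst) (h.src I)
    have hf : f ≫ (S z).π ≫ prod.fst = c ≫ h.src I := pullback.condition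
    have hf' : (f ≫ t) ≫ (S' z).π ≫ prod.fst = c ≫ h.src I := by rw [Category.assoc, hr, hf]
    have e₁ : (S z).ev h = (S z).evOn f h c hf := by
      refine (Category.id_comp _).symm.trans (congrArg (· ≫ (S z).ev h) ?_)
      apply pullback.hom_ext <;> simp [f, c]
    have e₂ : h.actOn (cofree S') (f ≫ t) c hf' = h.actOn (cofree S) f c hf ≫ φ.app x :=
      (h.actOn_app φ f c hf).symm
    refine (?_ : _ = (S' z).evOn (f ≫ t) h c hf').trans ?_
    · rfl
    · rw [e₁, ← actOn_cofreeCounit S' h (f ≫ t) c hf', ← actOn_cofreeCounit S h f c hf]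
      refine (congrArg (· ≫ cofreeCounit S') e₂).trans ((Category.assoc _ _ _).trans
        ((congrArg (fun t => h.actOn (cofree S) f c hf ≫ t) hφ).trans (Category.assoc _ _ _).symm))

lemma Below.actOn_fam {B : Diag I Y} {W V : C} {p : W ⟶ I.obj z} {q : W ⟶ Y}
    (φ : Fam (I.repP z) B Set.univ p q) {y : K} (hy : y < z) (k : Below x y) (w : V ⟶ W)
    (a : V ⟶ I.hom hy) (d : w ≫ p = a ≫ I.src hy) (c : V ⟶ k.arr I)
    (d₁ : (pullback.lift w a d ≫ φ.app ⟨y, Set.mem_Iio.2 hy⟩ (Set.mem_univ _)) ≫ B.anchor y =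
      c ≫ k.src I) (d₂ : a ≫ I.tgt hy = c ≫ k.src I)
    (d₃ : w ≫ p = k.compOn hy a c d₂ ≫ I.src (k.lt_trans hy)) :
    k.actOn B (pullback.lift w a d ≫ φ.app ⟨y, Set.mem_Iio.2 hy⟩ (Set.mem_univ _)) c d₁ =
      pullback.lift w (k.compOn hy a c d₂) d₃ ≫
        φ.app ⟨x, Set.mem_Iio.2 (k.lt_trans hy)⟩ (Set.mem_univ _) := by
  cases k with
  | refl => rfl
  | lt k => exact (φ.app_act (y := ⟨x, Set.mem_Iio.2 (k.trans hy)⟩) (z := ⟨y, Set.mem_Iio.2 hy⟩) k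
      (Set.mem_univ _) (Set.mem_univ _) w a d c d₂).symm

/-- If each family on `I(z, -)` is the action on a unique element of `B_z`, then `B_z` is itself a
matching object. -/
lemma exists_isIso_toM {B : Diag I Y}
    (hex : ∀ {W : C} {p : W ⟶ I.obj z} {q : W ⟶ Y} (φ : Fam (I.repP z) B Set.univ p q),
      ∃ (s : W ⟶ B.obj z) (hp : s ≫ B.anchor z = p) (hq : s ≫ B.base z = q),
        B.actFam z s hp hq = φ)
    (huniq : ∀ {W : C} {p : W ⟶ I.obj z} {q : W ⟶ Y} {s s' : W ⟶ B.obj z}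
      (hp : s ≫ B.anchor z = p) (hq : s ≫ B.base z = q) (hp' : s' ≫ B.anchor z = p)
      (hq' : s' ≫ B.base z = q), B.actFam z s hp hq = B.actFam z s' hp' hq' → s = s') :
    ∃ M : FamRep (I.repP z) B Set.univ, IsIso M.toM := by
  have key {W : C} {p : W ⟶ I.obj z} {q : W ⟶ Y} (s : W ⟶ B.obj z) (hp : s ≫ B.anchor z = p)
      (hq : s ≫ B.base z = q) : (B.actFam z (𝟙 (B.obj z)) (Category.id_comp _)
        (Category.id_comp _)).pull s hp hq = B.actFam z s hp hq := by
    rw [B.actFam_pull]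
    ext y hy
    exact B.actOn_congr _ _ (by rw [Category.comp_id]) rfl
  let M : FamRep (I.repP z) B Set.univ :=
    { obj := B.obj z
      p := B.anchor z
      q := B.base z
      fam := B.actFam z (𝟙 _) (Category.id_comp _) (Category.id_comp _)
      exists_lift := fun φ => by
        obtain ⟨s, hp, hq, h⟩ := hex φ
        exact ⟨s, hp, hq, (key s hp hq).trans h⟩
      hom_ext := fun {W s s' p q} hp hq hp' hq' h => by
        rw [key, key] at h
        exact huniq hp hq hp' hq' h }
  refine ⟨M, ?_⟩
  have : M.toM = 𝟙 _ := M.lift_fam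
  rw [this]
  exact IsIso.id _

/-- Matching objects of cofree diagrams at `z` with `x < z`. -/
lemma exists_isIso_toM_cofree (h : x < z) :
    ∃ M : FamRep (I.repP z) (cofree S) Set.univ, IsIso M.toM := by
  have hπ {W : C} {p : W ⟶ I.obj z} {q : W ⟶ Y} {s : W ⟶ (S z).obj}
      (hp : s ≫ (cofree S).anchor z = p) (hq : s ≫ (cofree S).base z = q) :
      s ≫ (S z).π = prod.lift p q := by
    apply Limits.prod.hom_ext
    · exact (Category.assoc _ _ _).trans (hp.trans (prod.lift_fst _ _).symm)
    · exact (Category.assoc _ _ _).trans (hq.trans (prod.lift_snd _ _).symm)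
  refine exists_isIso_toM (fun {W p q} φ => ?_) (fun {W p q s s'} hp hq hp' hq' hs => ?_)
  -- Among the objects below `z` is `x`. The component of `φ` there, followed by the counit, is an
  -- `E`-valued function on arrows from `z` to `x`, hence an element `t` of the cofree diagram at
  -- `z`. Its action agrees with `φ` because both are determined by evaluations at arrows to `x`.
  · let x' : Set.Iio z := ⟨x, Set.mem_Iio.2 h⟩
    let ψ : pullback p (I.src h) ⟶ (S x).obj := φ.app x' (Set.mem_univ x')
    have hψ : ψ ≫ (S x).π = prod.lift (pullback.snd _ _ ≫ I.tgt h) (pullback.fst _ _ ≫ q) := by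
      apply Limits.prod.hom_ext
      · exact (Category.assoc _ _ _).trans ((φ.app_anchor x' _).trans (prod.lift_fst _ _).symm)
      · exact (Category.assoc _ _ _).trans ((φ.app_base x' _).trans (prod.lift_snd _ _).symm)
    obtain ⟨t, ht, ht'⟩ := ((S z).isRelPi (.lt h)).exists_lift (prod.lift p q) (q := p)
      (prod.lift_fst _ _) (ψ ≫ cofreeCounit S) (by
        refine (Category.assoc _ _ _).trans ((congrArg (ψ ≫ ·) (cofreeCounit_comp S)).trans
          (hψ.trans ?_))
        apply Limits.prod.hom_ext
        · simp only [cofreeBase, prod.comp_lift, prod.lift_fst, pbMap_snd_assoc]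
          exact (prod.lift_fst _ _).symm
        · simp only [cofreeBase, prod.comp_lift, prod.lift_snd, pbMap_fst_assoc]
          exact (prod.lift_snd _ _).symm)
    have hp : t ≫ (S z).π ≫ prod.fst = p := by rw [← Category.assoc, ht, prod.lift_fst]
    have hq : t ≫ (S z).π ≫ prod.snd = q := by rw [← Category.assoc, ht, prod.lift_snd]
    have hev {U : C} (f : U ⟶ W) (c : U ⟶ I.hom h)
        (hs : (f ≫ t) ≫ (S z).π ≫ prod.fst = c ≫ I.src h) (hs' : f ≫ p = c ≫ I.src h) :
        (S z).evOn (f ≫ t) (.lt h) c hs = (pullback.lift f c hs' ≫ ψ) ≫ cofreeCounit S := by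
      refine Eq.trans ?_ (Category.assoc _ _ _).symm
      refine Eq.trans ?_ (congrArg (fun t => pullback.lift f c hs' ≫ t) ht')
      refine Eq.trans ?_ (Category.assoc _ _ _)
      refine congrArg (· ≫ (S z).ev (.lt h)) ?_
      have hb := pbMap_fst (I.src h) t hp
      have hb' := pbMap_snd (I.src h) t hp
      refine pullback.hom_ext ?_ ?_
      · exact (pullback.lift_fst _ _ _).trans (((Category.assoc _ _ _).trans ((congrArg (fun t =>
          pullback.lift f c hs' ≫ t) hb).trans (pullback.lift_fst_assoc _ _ _ _))).symm)
      · exact (pullback.lift_snd _ _ _).trans (((Category.assoc _ _ _).trans ((congrArg (fun t =>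
          pullback.lift f c hs' ≫ t) hb').trans (pullback.lift_snd _ _ _))).symm)
    refine ⟨t, hp, hq, ?_⟩
    ext ⟨y, hy'⟩ hu
    have hy : y < z := hy'
    let f := pullback.fst p (I.src hy)
    let b := pullback.snd p (I.src hy)
    have d : (f ≫ t) ≫ (S z).π ≫ prod.fst = b ≫ I.src hy := by
      rw [Category.assoc, hp, pullback.condition]
    refine (cofree_actOn S hy (f ≫ t) b d).trans ?_
    let χ : pullback p (I.src hy) ⟶ (S y).obj := φ.app ⟨y, hy'⟩ hu
    change _ = χ
    have hχ₁ : χ ≫ (S y).π ≫ prod.fst = b ≫ I.tgt hy := φ.app_anchor ⟨y, hy'⟩ hu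
    have hχ₂ : χ ≫ (S y).π ≫ prod.snd = f ≫ q := φ.app_base ⟨y, hy'⟩ hu
    refine (S y).ext ?_ fun k U g c hs hs' => ?_
    · apply Limits.prod.hom_ext
      · rw [cofreeAct_π, prod.lift_fst, Category.assoc, hχ₁]
      · rw [cofreeAct_π, prod.lift_snd, Category.assoc, Category.assoc, hχ₂, hq]
    · have e₁ : (g ≫ b) ≫ I.tgt hy = c ≫ k.src I := by
        rw [← hs', Category.assoc, Category.assoc, hχ₁]
      have e₂ : (g ≫ f ≫ t) ≫ (S z).π ≫ prod.fst =
          k.compOn hy (g ≫ b) c e₁ ≫ I.src (k.lt_trans hy) := by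
        rw [Below.compOn_src, Category.assoc, d, Category.assoc]
      have e₃ : (g ≫ f) ≫ p = (g ≫ b) ≫ I.src hy := by
        rw [Category.assoc, pullback.condition, Category.assoc]
      have e₄ : (g ≫ f) ≫ p = k.compOn hy (g ≫ b) c e₁ ≫ I.src (k.lt_trans hy) := by
        rw [Below.compOn_src, e₃]
      have e₅ : ((g ≫ f) ≫ t) ≫ (S z).π ≫ prod.fst =
          k.compOn hy (g ≫ b) c e₁ ≫ I.src (k.lt_trans hy) := by
        rw [Category.assoc g, e₂]
      have e₆ : pullback.lift (g ≫ f) (g ≫ b) e₃ ≫ χ = g ≫ χ := by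
        congr 1
        apply pullback.hom_ext <;> simp [f, b]
      have e₇ : (pullback.lift (g ≫ f) (g ≫ b) e₃ ≫ χ) ≫ (S y).π ≫ prod.fst = c ≫ k.src I := by
        rw [e₆, hs']
      refine (evOn_comp_cofreeAct S hy (f ≫ t) b d k g c hs e₁ e₂).trans
        (((S z).evOn_congr _ e₂ (Category.assoc _ _ _).symm rfl).trans
          ((hev (g ≫ f) (k.compOn hy (g ≫ b) c e₁) e₅ e₄).trans (Eq.trans ?_
            (actOn_cofreeCounit S k (g ≫ χ) c hs'))))
      refine congrArg (· ≫ cofreeCounit S) ?_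
      refine (Below.actOn_fam φ hy k (g ≫ f) (g ≫ b) e₃ c e₇ e₁ e₄).symm.trans ?_
      exact k.actOn_congr (cofree S) _ e₆ rfl
  · let t : W ⟶ (S z).obj := s
    let t' : W ⟶ (S z).obj := s'
    change t = t'
    refine (S z).ext ((hπ hp hq).trans (hπ hp' hq').symm) fun k U g c hc hc' => ?_
    obtain rfl := (Below.lt h).eq_of_below k
    have hpc : g ≫ p = c ≫ I.src h := by
      rw [← hp]
      exact (Category.assoc _ _ _).symm.trans hc
    let x' : Set.Iio z := ⟨x, Set.mem_Iio.2 h⟩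
    have e₁ := (cofree S).actFam_app_lift z s hp hq x' g c hpc
    have e₂ := (cofree S).actFam_app_lift z s' hp' hq' x' g c hpc
    rw [← hs] at e₂
    refine (actOn_cofreeCounit S (.lt h) (g ≫ t) c hc).symm.trans (Eq.trans ?_
      (actOn_cofreeCounit S (.lt h) (g ≫ t') c hc'))
    exact congrArg (· ≫ cofreeCounit S) (e₁.symm.trans e₂)

/-- If `x` is not below `z`, no `y < z` has arrows to `x`, so the diagram below `z` is `y ↦ I(y) ×
Y`. A family into it is unique over given indices, the matching object is `I(z) × Y`, and the
matching map is the fibration `π`. -/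
lemma exists_toM_cofree_of_not_lt (h : ¬ x < z) :
    ∃ M : FamRep (I.repP z) (cofree S) Set.univ, Fibration M.toM ∧ IsIso (prod.lift M.p M.q) := by
  have hy (y : Set.Iio z) : IsEmpty (Below x y.1) := ⟨fun k => h (k.lt_trans (lt_of_Iio y))⟩
  have hi (y : Set.Iio z) : IsIso (S y.1).π := (S y.1).isIso_of_isEmpty (hy y)
  have hext {y : Set.Iio z} {V : C} {s s' : V ⟶ (cofree S).obj y.1}
      (h₁ : s ≫ (cofree S).anchor y.1 = s' ≫ (cofree S).anchor y.1)
      (h₂ : s ≫ (cofree S).base y.1 = s' ≫ (cofree S).base y.1) : s = s' := by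
    have := hi y
    let t : V ⟶ (S y.1).obj := s
    let t' : V ⟶ (S y.1).obj := s'
    change t = t'
    refine (cancel_mono (S y.1).π).1 ?_
    apply Limits.prod.hom_ext
    · exact (Category.assoc _ _ _).trans (h₁.trans (Category.assoc _ _ _).symm)
    · exact (Category.assoc _ _ _).trans (h₂.trans (Category.assoc _ _ _).symm)
  let w (y : Set.Iio z) : pullback (prod.fst : I.obj z ⨯ Y ⟶ I.obj z) (I.src (lt_of_Iio y)) ⟶
      (cofree S).obj y.1 :=
    (prod.lift (pullback.snd _ _ ≫ I.tgt (lt_of_Iio y)) (pullback.fst _ _ ≫ prod.snd) ≫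
      inv (S y.1).π : _ ⟶ (S y.1).obj)
  have hw₁ (y : Set.Iio z) : w y ≫ (cofree S).anchor y.1 =
      pullback.snd _ _ ≫ I.tgt (lt_of_Iio y) := by
    refine (Category.assoc _ _ ((S y.1).π ≫ prod.fst)).trans ?_
    rw [IsIso.inv_hom_id_assoc, prod.lift_fst]
  have hw₂ (y : Set.Iio z) : w y ≫ (cofree S).base y.1 = pullback.fst _ _ ≫ prod.snd := by
    refine (Category.assoc _ _ ((S y.1).π ≫ prod.snd)).trans ?_
    rw [IsIso.inv_hom_id_assoc, prod.lift_snd]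
  let M : FamRep (I.repP z) (cofree S) Set.univ :=
    { obj := I.obj z ⨯ Y
      p := prod.fst
      q := prod.snd
      fam :=
        { app := fun y _ => w y
          app_base := fun y _ => hw₂ y
          app_anchor := fun y _ => hw₁ y
          app_act := fun {y y'} k _ _ V f a d b d' => by
            apply hext
            · rw [Diag.actOn_anchor, Category.assoc, hw₁, pullback.lift_snd_assoc,
                (I.repP z).actOn_anchor]
            · rw [Diag.actOn_base, Category.assoc _ _ ((cofree S).base y.1),
                Category.assoc _ _ ((cofree S).base y'.1), hw₂, hw₂, pullback.lift_fst_assoc,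
                pullback.lift_fst_assoc] }
      exists_lift := fun {W p q} φ => by
        refine ⟨prod.lift p q, prod.lift_fst _ _, prod.lift_snd _ _, ?_⟩
        ext y hu
        apply hext
        · rw [Fam.app_anchor, Fam.app_anchor]
        · rw [Fam.app_base, Fam.app_base]
      hom_ext := fun {W f f' p q} hp hq hp' hq' _ => by
        apply Limits.prod.hom_ext
        · rw [hp, hp']
        · rw [hq, hq'] }
  refine ⟨M, ?_, ?_⟩
  · have : M.toM = (S z).π := by
      apply Limits.prod.hom_ext
      · exact M.toM_p
      · exact M.toM_q
    rw [this]
    exact (S z).fib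
  · have : prod.lift M.p M.q = 𝟙 (I.obj z ⨯ Y) := by
      apply Limits.prod.hom_ext
      · rw [prod.lift_fst, Category.id_comp]
      · rw [prod.lift_snd, Category.id_comp]
    rw [this]
    exact IsIso.id _

lemma isReedyFibrant_cofree : (cofree S).IsReedyFibrant := Diag.isReedyFibrant_iff.2 fun z => by
  by_cases h : x < z
  · obtain ⟨M, hM⟩ := exists_isIso_toM_cofree S h
    exact ⟨M, fibration_of_iso _⟩
  · obtain ⟨M, hM, -⟩ := exists_toM_cofree_of_not_lt S h
    exact ⟨M, hM⟩

/-- If `x < z`, both matching maps are isomorphisms and the gap map may be taken to be an identity.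
Otherwise the map of matching objects is an isomorphism and the gap map is the component of `φ` at
`z`, a fibration by `fibration_cofreeMap`. -/
lemma isReedyFibration_cofreeMap (v : E ⟶ F) [Fibration v] (hv : v ≫ e' = e)
    (φ : cofree S ⟶ cofree S')
    (hφ : φ.app x ≫ cofreeCounit S' = (cofreeCounit S ≫ v : (S x).obj ⟶ F)) :
    Diag.IsReedyFibration φ := by
  have key {e : E ⟶ I.obj x ⨯ Y} (S : ∀ z, CofreeObj e z) (z : K) :
      ∃ M : FamRep (I.repP z) (cofree S) Set.univ,
      (x < z → IsIso M.toM) ∧ (¬ x < z → IsIso (prod.lift M.p M.q)) := by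
    by_cases h : x < z
    · obtain ⟨M, hM⟩ := exists_isIso_toM_cofree S h
      exact ⟨M, fun _ => hM, fun h' => (h' h).elim⟩
    · obtain ⟨M, -, hM⟩ := exists_toM_cofree_of_not_lt S h
      exact ⟨M, fun h' => (h h').elim, fun _ => hM⟩
  choose M hM₁ hM₂ using key S
  have key' (z : K) : ∃ M : FamRep (I.repP z) (cofree S') Set.univ,
      (x < z → IsIso M.toM) ∧ (¬ x < z → IsIso (prod.lift M.p M.q)) := by
    by_cases h : x < z
    · obtain ⟨M, hM⟩ := exists_isIso_toM_cofree S' h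
      exact ⟨M, fun _ => hM, fun h' => (h' h).elim⟩
    · obtain ⟨M, -, hM⟩ := exists_toM_cofree_of_not_lt S' h
      exact ⟨M, fun h' => (h h').elim, fun _ => hM⟩
  choose M' hM₁' hM₂' using key'
  refine Diag.IsReedyFibration.of_hasGap (M := M) (M' := M') fun z => ?_
  by_cases h : x < z
  · have := hM₁ z h
    have := hM₁' z h
    exact ⟨(cofree S).obj z, φ.app z, (M z).toM, 𝟙 _,
      IsPullback.of_vert_isIso ⟨((M z).toM_map (M' z) φ).symm⟩, Category.id_comp _,
      Category.id_comp _, fibration_of_iso (𝟙 _)⟩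
  · have := hM₂ z h
    have := hM₂' z h
    have h₁ : (M z).map (M' z) φ ≫ prod.lift (M' z).p (M' z).q = prod.lift (M z).p (M z).q := by
      apply Limits.prod.hom_ext <;> simp
    have : IsIso ((M z).map (M' z) φ ≫ prod.lift (M' z).p (M' z).q) := by rw [h₁]; infer_instance
    have := IsIso.of_isIso_comp_right ((M z).map (M' z) φ) (prod.lift (M' z).p (M' z).q)
    refine ⟨(cofree S').obj z, 𝟙 _, (M' z).toM ≫ inv ((M z).map (M' z) φ), φ.app z,
      IsPullback.of_horiz_isIso ⟨by simp⟩, ?_, Category.comp_id _,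
      fibration_cofreeMap S S' v hv φ hφ z⟩
    rw [← Category.assoc, ← (M z).toM_map (M' z) φ, Category.assoc, IsIso.hom_inv_id,
      Category.comp_id]

end CofreeReedy

/-! ## Homotopy equivalences of Reedy fibrant diagrams are levelwise homotopy equivalences -/

section Levelwise

variable {C : Type u} [Category.{v} C] [CategoryWithFibrations C]
  [IsTypeTheoreticFibrationCategory C] {K : Type w} [PartialOrder K] {I : InverseCat C K} {Y : C}

lemma exists_matching_famRep (B : ReedyFib I Y) :
    ∃ M : ∀ z, FamRep (I.repP z) B.obj Set.univ, ∀ z, Fibration (M z).toM := by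
  choose M hM using Diag.isReedyFibrant_iff.1 B.property
  exact ⟨M, hM⟩

omit [IsTypeTheoreticFibrationCategory C] in
lemma Admissible.exists_embedding_Iio (hK : Admissible C K) (z : K) :
    ∃ (J : Type w) (_ : PartialOrder J) (σ : J ↪o Set.Iio z), Function.Surjective σ ∧
      ∀ Z, HasReedyLimits J (FibOver (C := C) Z) := by
  obtain ⟨J, _, σ, hσ, hJ⟩ := hK z
  refine ⟨J, _, OrderEmbedding.ofMapLEIff
    (fun j => ⟨σ j, Set.mem_Iio.2 ((hσ _).2 ⟨j, rfl⟩)⟩) (fun i j => σ.le_iff_le), fun y => ?_, hJ⟩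
  obtain ⟨j, hj⟩ := (hσ y.1).1 (lt_of_Iio y)
  exact ⟨j, Subtype.ext hj⟩

variable [WellFoundedLT K] (hK : Admissible C K)

include hK

/-- The map is the composite `B_x ⟶ M_x B ⟶ I(x) × Y`, whose second factor is a fibration because
the matching object represents families into a Reedy fibrant diagram. -/
lemma fibration_anchor_base (B : ReedyFib I Y) (x : K) :
    Fibration (prod.lift (B.obj.anchor x) (B.obj.base x)) := by
  obtain ⟨M, hM⟩ := exists_matching_famRep B
  obtain ⟨J, _, σ, hσ, hJ⟩ := hK.exists_embedding_Iio x
  have h := fibration_famRep (isLowerSet_Iio x) hK hM σ hσ (hJ _) (M x)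
  have : prod.lift (B.obj.anchor x) (B.obj.base x) = (M x).toM ≫ prod.lift (M x).p (M x).q := by
    rw [prod.comp_lift, (M x).toM_p, (M x).toM_q]
  rw [this]
  exact fibration_comp (hM x) h

/-- Acyclic cofibrations of Reedy fibrant diagrams are levelwise acyclic cofibrations. -/
lemma isAcyclicCofibration_app {B D : ReedyFib I Y} {i : B ⟶ D} (hi : IsAcyclicCofibration i)
    (x : K) : IsAcyclicCofibration (i.hom.app x) := by
  refine .of_exists_lift fun {E' F'} p hp f g hfg => ?_
  have hD := fibration_anchor_base hK D x
  -- Cofree diagrams are formed over `I(x) × Y`, so `p` is first pulled back along `g` to a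
  -- fibration over `D_x`; since `D_x` is fibred over `I(x) × Y`, the dependent products exist.
  have hv : Fibration (pullback.fst g p) := inferInstance
  have he := fibration_comp hv hD
  have S := fun z => (exists_cofreeObj (pullback.fst g p ≫
    prod.lift (D.obj.anchor x) (D.obj.base x)) z).some
  have S' := fun z => (exists_cofreeObj (prod.lift (D.obj.anchor x) (D.obj.base x)) z).some
  obtain ⟨φ, hφ⟩ := exists_cofreeMap S S' (pullback.fst g p) rfl
  obtain ⟨β, hβ⟩ := exists_cofreeLift S (B := B.obj) (pullback.lift (i.hom.app x) f hfg.symm) (by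
    rw [pullback.lift_fst_assoc, prod.comp_lift, i.hom.app_anchor, i.hom.app_base])
  obtain ⟨δ, hδ⟩ := exists_cofreeLift S' (B := D.obj) (𝟙 _) (Category.id_comp _)
  have hsq : β ≫ φ = i.hom ≫ δ := by
    refine cofree_hom_ext S' ?_
    have h₁ : (β ≫ φ).app x ≫ cofreeCounit S' = i.hom.app x :=
      (Category.assoc _ _ _).trans ((congrArg (β.app x ≫ ·) hφ).trans
        ((Category.assoc _ _ _).symm.trans ((congrArg (· ≫ pullback.fst g p) hβ).trans
          (pullback.lift_fst _ _ _))))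
    have h₂ : (i.hom ≫ δ).app x ≫ cofreeCounit S' = i.hom.app x :=
      (Category.assoc _ _ _).trans ((congrArg (i.hom.app x ≫ ·) hδ).trans (Category.comp_id _))
    exact h₁.trans h₂.symm
  let RE : ReedyFib I Y := ⟨cofree S, isReedyFibrant_cofree S⟩
  let RF : ReedyFib I Y := ⟨cofree S', isReedyFibrant_cofree S'⟩
  let Φ : RE ⟶ RF := ObjectProperty.homMk φ
  have hΦ : Fibration Φ := ⟨isReedyFibration_cofreeMap S S' (pullback.fst g p) rfl φ hφ⟩
  -- The square against `p` at `x` has been transposed to a square of diagrams against the Reedy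
  -- fibration `Φ`; transposing `l` back through the counit solves the original problem.
  obtain ⟨l, hl, hl'⟩ := hi.exists_lift hΦ (ObjectProperty.homMk β) (ObjectProperty.homMk δ)
    (by ext1; exact hsq)
  have k₁ : i.hom.app x ≫ l.hom.app x = β.app x :=
    congrArg (fun t => t.hom.app x) hl
  have k₂ : l.hom.app x ≫ φ.app x = δ.app x :=
    congrArg (fun t => t.hom.app x) hl'
  have k₃ : (l.hom.app x ≫ cofreeCounit S) ≫ pullback.fst g p = 𝟙 _ :=
    (Category.assoc _ _ _).trans ((congrArg (l.hom.app x ≫ ·) hφ).symm.trans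
      ((Category.assoc _ _ _).symm.trans ((congrArg (· ≫ cofreeCounit S') k₂).trans hδ)))
  have k₄ : i.hom.app x ≫ l.hom.app x ≫ cofreeCounit S =
      pullback.lift (i.hom.app x) f hfg.symm :=
    (Category.assoc _ _ _).symm.trans ((congrArg (· ≫ cofreeCounit S) k₁).trans hβ)
  refine ⟨(l.hom.app x ≫ cofreeCounit S) ≫ pullback.snd g p, ?_, ?_⟩
  · refine (Category.assoc _ _ _).symm.trans ((congrArg (· ≫ pullback.snd g p) k₄).trans ?_)
    exact pullback.lift_snd _ _ _
  · rw [Category.assoc, ← pullback.condition, ← Category.assoc, k₃, Category.id_comp]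

/-- The component of a path object at `x` need not be checked to be a path object: its `refl` is an
acyclic cofibration on which source and target agree, and that suffices. -/
lemma homotopic_app {B D : ReedyFib I Y} {f g : B ⟶ D} (h : Homotopic f g) (x : K) :
    Homotopic (f.hom.app x) (g.hom.app x) := by
  obtain ⟨P, H, rfl, rfl⟩ := h
  have hr := isAcyclicCofibration_app hK P.acyclic x
  have e : P.refl.hom.app x ≫ P.src.hom.app x = P.refl.hom.app x ≫ P.tgt.hom.app x :=
    congrArg (fun t => t.hom.app x) (P.refl_src.trans P.refl_tgt.symm)
  exact (hr.homotopic e).precomp (H.hom.app x)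

/-- Homotopy equivalences of Reedy fibrant diagrams are levelwise homotopy equivalences. -/
lemma isHomotopyEquiv_app {B D : ReedyFib I Y} {g : B ⟶ D} (h : IsHomotopyEquiv g) (x : K) :
    IsHomotopyEquiv (g.hom.app x) := by
  obtain ⟨g', h₁, h₂⟩ := h
  exact ⟨g'.hom.app x, homotopic_app hK h₁ x, homotopic_app hK h₂ x⟩

end Levelwise

/-! ## Pullbacks of Reedy fibrations -/

section LevelwisePullback

variable {C : Type u} [Category.{v} C] [CategoryWithFibrations C]
  [HasFibrationPullbacks C] {K : Type w} [PartialOrder K] {I : InverseCat C K} {X Y : C}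
  {E A B : Diag I Y} (p : E ⟶ B) (f : A ⟶ B) (hp : ∀ z, Fibration (p.app z))

/-- The levelwise pullback, with its actions on generalized elements. -/
noncomputable def pullbackP : PDiag I (fun z : K => z) Y where
  obj z := pullback (p.app z) (f.app z)
  base z := pullback.snd _ _ ≫ A.base z
  anchor z := pullback.snd _ _ ≫ A.anchor z
  fib_base z := fibration_comp (fibration_of_isPullback (IsPullback.of_hasPullback _ _) (hp z))
    (A.fib_base z)
  actOn {y z} h V a b d := pullback.lift
    (E.actOn h (a ≫ pullback.fst _ _) b (by
      rw [Category.assoc, ← p.app_anchor, pullback.condition_assoc, f.app_anchor, d]))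
    (A.actOn h (a ≫ pullback.snd _ _) b (by rw [Category.assoc, d]))
    (by
      rw [Diag.actOn_app, Diag.actOn_app]
      exact B.actOn_congr _ _ (by rw [Category.assoc, pullback.condition, Category.assoc]) rfl)
  comp_actOn h _ _ g a b d := by
    apply pullback.hom_ext
    · rw [Category.assoc, pullback.lift_fst, pullback.lift_fst, Diag.comp_actOn]
      exact E.actOn_congr _ _ (Category.assoc _ _ _).symm rfl
    · rw [Category.assoc, pullback.lift_snd, pullback.lift_snd, Diag.comp_actOn]
      exact A.actOn_congr _ _ (Category.assoc _ _ _).symm rfl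
  actOn_base h _ a b d := by
    rw [pullback.lift_snd_assoc, Diag.actOn_base, Category.assoc]
  actOn_anchor h _ a b d := by
    rw [pullback.lift_snd_assoc, Diag.actOn_anchor]
  actOn_actOn {x y z} h k V a b c d d' := by
    apply pullback.hom_ext
    · refine (pullback.lift_fst _ _ _).trans (Eq.trans ?_ (pullback.lift_fst _ _ _).symm)
      exact (E.actOn_congr _ _ (pullback.lift_fst _ _ _) rfl).trans (E.act_assoc h k _ b c _ d')
    · refine (pullback.lift_snd _ _ _).trans (Eq.trans ?_ (pullback.lift_snd _ _ _).symm)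
      exact (A.actOn_congr _ _ (pullback.lift_snd _ _ _) rfl).trans (A.act_assoc h k _ b c _ d')

/-- The levelwise pullback. -/
noncomputable def pullbackDiag : Diag I Y := (pullbackP p f hp).toDiag

lemma pullbackDiag_actOn {y z : K} (h : y < z) {V : C} (a : V ⟶ pullback (p.app z) (f.app z))
    (b : V ⟶ I.hom h) (d : a ≫ pullback.snd (p.app z) (f.app z) ≫ A.anchor z = b ≫ I.src h) :
    (pullbackDiag p f hp).actOn h a b d = (pullbackP p f hp).actOn h a b d :=
  (pullbackP p f hp).toDiag_actOn h a b d

/-- The first projection of the levelwise pullback. -/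
noncomputable def pullbackDiagFst : pullbackDiag p f hp ⟶ E :=
  have hb (z : K) : pullback.fst (p.app z) (f.app z) ≫ E.base z =
      pullback.snd _ _ ≫ A.base z := by
    rw [← p.app_base, pullback.condition_assoc, f.app_base]
  have ha (z : K) : pullback.fst (p.app z) (f.app z) ≫ E.anchor z =
      pullback.snd _ _ ≫ A.anchor z := by
    rw [← p.app_anchor, pullback.condition_assoc, f.app_anchor]
  Diag.Hom.mk (fun z => pullback.fst (p.app z) (f.app z))
    hb ha
    (fun h => Diag.act_app_of_actOn (A := pullbackDiag p f hp) _ ha (fun h _ a b d =>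
      (congrArg (· ≫ pullback.fst _ _) (pullbackDiag_actOn p f hp h a b d)).trans
        (pullback.lift_fst _ _ _)) h)

/-- The second projection of the levelwise pullback. -/
noncomputable def pullbackDiagSnd : pullbackDiag p f hp ⟶ A :=
  Diag.Hom.mk (fun z => pullback.snd (p.app z) (f.app z)) (fun _ => rfl) (fun _ => rfl)
    (fun h => Diag.act_app_of_actOn (A := pullbackDiag p f hp) _ (fun _ => rfl) (fun h _ a b d =>
      (congrArg (· ≫ pullback.snd _ _) (pullbackDiag_actOn p f hp h a b d)).trans
        (pullback.lift_snd _ _ _)) h)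

lemma pullbackDiag_condition : pullbackDiagFst p f hp ≫ p = pullbackDiagSnd p f hp ≫ f :=
  Diag.hom_ext fun _ => pullback.condition

lemma isPullback_pullbackDiag (z : K) : IsPullback ((pullbackDiagFst p f hp).app z)
    ((pullbackDiagSnd p f hp).app z) (p.app z) (f.app z) :=
  IsPullback.of_hasPullback (p.app z) (f.app z)

end LevelwisePullback

/-! ### Functoriality of representing objects. -/

section MapMap

variable {C : Type u} [Category.{v} C] [CategoryWithFibrations C]
  [HasFibrationPullbacks C] {K : Type w} [PartialOrder K] {I : InverseCat C K} {X Y : C}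
  {B B' B'' : Diag I Y} {T : Type*} {ι : T → K} {G : PDiag I ι X} {S : Set T}
  (R : FamRep G B S) (R' : FamRep G B' S) (R'' : FamRep G B'' S)

lemma Fam.map_map {W : C} {u : W ⟶ X} {v : W ⟶ Y} (φ : Fam G B S u v) (g : B ⟶ B')
    (h : B' ⟶ B'') : (φ.map g).map h = φ.map (g ≫ h) := by
  ext z hz
  exact Category.assoc _ _ _

lemma FamRep.map_map (g : B ⟶ B') (h : B' ⟶ B'') :
    R.map R' g ≫ R'.map R'' h = R.map R'' (g ≫ h) :=
  (R'.lift_map R'' _ h).trans (congrArg R''.lift (R.fam.map_map g h))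

lemma FamRep.map_id : R.map R (𝟙 B) = 𝟙 R.obj := by
  refine Eq.trans (congrArg R.lift ?_) R.lift_fam
  ext z hz
  exact Category.comp_id _

lemma FamRep.pull_fam_map {W : C} (s : W ⟶ R.obj) {u : W ⟶ X} {v : W ⟶ Y} (hu : s ≫ R.p = u)
    (hv : s ≫ R.q = v) (g : B ⟶ B') : (R.fam.pull s hu hv).map g =
      R'.fam.pull (s ≫ R.map R' g) (by rw [Category.assoc, R.map_p, hu])
        (by rw [Category.assoc, R.map_q, hv]) := by
  rw [← Fam.map_pull, ← Fam.pull_pull _ _ (R.map_p R' g) (R.map_q R' g) _ hu hv]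
  exact congrArg (fun φ => Fam.pull φ s hu hv) (R'.pull_lift _).symm

end MapMap

/-! ### Families of maps into levelwise pullbacks. -/

section LevelwiseIsPullback

variable {C : Type u} [Category.{v} C] [CategoryWithFibrations C]
  [HasFibrationPullbacks C] {K : Type w} [PartialOrder K] {I : InverseCat C K} {X Y : C}
  {Q E A B : Diag I Y} {t : Q ⟶ E} {l : Q ⟶ A} {p : E ⟶ B} {f : A ⟶ B}
  (w : t ≫ p = l ≫ f) (hQ : ∀ z, IsPullback (t.app z) (l.app z) (p.app z) (f.app z))

include w hQ

lemma isPullback_of_app : IsPullback t l p f := by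
  refine isPullback_of_exists_lift w (fun {D} a b e => ?_) (fun {D} s s' h₁ h₂ => ?_)
  · have e' (z : K) : a.app z ≫ p.app z = b.app z ≫ f.app z := congrArg (·.app z) e
    have ha (z : K) : (hQ z).lift _ _ (e' z) ≫ Q.anchor z = D.anchor z := by
      rw [← l.app_anchor, (hQ z).lift_snd_assoc, b.app_anchor]
    let s : D ⟶ Q := Diag.Hom.mk (fun z => (hQ z).lift _ _ (e' z))
      (fun z => by rw [← l.app_base, (hQ z).lift_snd_assoc, b.app_base]) ha
      (Diag.act_app_of_actOn _ ha (fun {x y} h V c d k => by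
        apply (hQ y).hom_ext
        · rw [Category.assoc, (hQ y).lift_fst, Diag.actOn_app, Diag.actOn_app]
          exact E.actOn_congr _ _ (by rw [Category.assoc, (hQ x).lift_fst]) rfl
        · rw [Category.assoc, (hQ y).lift_snd, Diag.actOn_app, Diag.actOn_app]
          exact A.actOn_congr _ _ (by rw [Category.assoc, (hQ x).lift_snd]) rfl))
    exact ⟨s, Diag.hom_ext fun z => (hQ z).lift_fst _ _ _,
      Diag.hom_ext fun z => (hQ z).lift_snd _ _ _⟩
  · exact Diag.hom_ext fun z => (hQ z).hom_ext (congrArg (·.app z) h₁) (congrArg (·.app z) h₂)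

variable {T : Type*} {ι : T → K} {G : PDiag I ι X} {S : Set T}

omit w in
lemma Fam.hom_ext_of_isPullback {W : C} {u : W ⟶ X} {v : W ⟶ Y} {φ ψ : Fam G Q S u v}
    (h₁ : φ.map t = ψ.map t) (h₂ : φ.map l = ψ.map l) : φ = ψ := by
  ext z hz
  exact (hQ (ι z)).hom_ext (congrArg (·.app z hz) h₁) (congrArg (·.app z hz) h₂)

omit w in
lemma Fam.exists_of_isPullback {W : C} {u : W ⟶ X} {v : W ⟶ Y} (φ : Fam G E S u v)
    (ψ : Fam G A S u v) (h : φ.map p = ψ.map f) :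
    ∃ χ : Fam G Q S u v, χ.map t = φ ∧ χ.map l = ψ := by
  have e (z : T) (hz : z ∈ S) : φ.app z hz ≫ p.app (ι z) = ψ.app z hz ≫ f.app (ι z) :=
    congrArg (·.app z hz) h
  let χ : Fam G Q S u v :=
    { app := fun z hz => (hQ (ι z)).lift _ _ (e z hz)
      app_base := fun z hz => by
        rw [← l.app_base, (hQ (ι z)).lift_snd_assoc, ψ.app_base]
      app_anchor := fun z hz => by
        rw [← l.app_anchor, (hQ (ι z)).lift_snd_assoc, ψ.app_anchor]
      app_act := fun {y z} k hy hz V c a d b d' => by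
        apply (hQ (ι y)).hom_ext
        · rw [Category.assoc, (hQ (ι y)).lift_fst, Diag.actOn_app, φ.app_act k hy hz c a d b d']
          exact E.actOn_congr _ _ (by rw [Category.assoc, (hQ (ι z)).lift_fst]) rfl
        · rw [Category.assoc, (hQ (ι y)).lift_snd, Diag.actOn_app, ψ.app_act k hy hz c a d b d']
          exact A.actOn_congr _ _ (by rw [Category.assoc, (hQ (ι z)).lift_snd]) rfl }
  refine ⟨χ, ?_, ?_⟩
  · ext z hz
    exact (hQ (ι z)).lift_fst _ _ _
  · ext z hz
    exact (hQ (ι z)).lift_snd _ _ _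

/-- Representing objects for families preserve levelwise pullbacks. -/
lemma FamRep.isPullback_map (RQ : FamRep G Q S) (RE : FamRep G E S) (RA : FamRep G A S)
    (RB : FamRep G B S) :
    IsPullback (RQ.map RE t) (RQ.map RA l) (RE.map RB p) (RA.map RB f) := by
  refine isPullback_of_exists_lift ?_ (fun {W} a b e => ?_) (fun {W} s s' h₁ h₂ => ?_)
  · rw [map_map, map_map, w]
  · have hu : b ≫ RA.p = a ≫ RE.p := by
      rw [← RE.map_p RB p, ← Category.assoc, e, Category.assoc, map_p]
    have hv : b ≫ RA.q = a ≫ RE.q := by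
      rw [← RE.map_q RB p, ← Category.assoc, e, Category.assoc, map_q]
    obtain ⟨χ, h₁, h₂⟩ := Fam.exists_of_isPullback hQ (RE.fam.pull a rfl rfl)
      (RA.fam.pull b hu hv) (by
        rw [RE.pull_fam_map RB, RA.pull_fam_map RB]
        exact Fam.pull_congr _ e _ _)
    refine ⟨RQ.lift χ, ?_, ?_⟩
    · rw [lift_map, h₁]
      exact (RE.eq_lift _ rfl rfl rfl).symm
    · rw [lift_map, h₂]
      exact (RA.eq_lift _ hu hv rfl).symm
  · have hu : s' ≫ RQ.p = s ≫ RQ.p := by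
      rw [← RQ.map_p RE t, ← Category.assoc, ← h₁, Category.assoc]
    have hv : s' ≫ RQ.q = s ≫ RQ.q := by
      rw [← RQ.map_q RE t, ← Category.assoc, ← h₁, Category.assoc]
    refine RQ.hom_ext rfl rfl hu hv (Fam.hom_ext_of_isPullback hQ ?_ ?_)
    · rw [RQ.pull_fam_map RE, RQ.pull_fam_map RE]
      exact Fam.pull_congr _ h₁ _ _
    · rw [RQ.pull_fam_map RA, RQ.pull_fam_map RA]
      exact Fam.pull_congr _ h₂ _ _

/-- A family into a levelwise pullback is a compatible pair of families, so the pullback of the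
representing objects represents it. This provides matching objects for the levelwise pullback before
its Reedy fibrancy is known. -/
lemma FamRep.exists_of_isPullback (RE : FamRep G E S) (RA : FamRep G A S)
    (RB : FamRep G B S) [HasPullback (RE.map RB p) (RA.map RB f)] : Nonempty (FamRep G Q S) := by
  let a := pullback.fst (RE.map RB p) (RA.map RB f)
  let b := pullback.snd (RE.map RB p) (RA.map RB f)
  have e : a ≫ RE.map RB p = b ≫ RA.map RB f := pullback.condition
  have hu : b ≫ RA.p = a ≫ RE.p := by
    rw [← RE.map_p RB p, ← Category.assoc, e, Category.assoc, map_p]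
  have hv : b ≫ RA.q = a ≫ RE.q := by
    rw [← RE.map_q RB p, ← Category.assoc, e, Category.assoc, map_q]
  obtain ⟨χ, h₁, h₂⟩ := Fam.exists_of_isPullback hQ (RE.fam.pull a rfl rfl)
    (RA.fam.pull b hu hv) (by
      rw [RE.pull_fam_map RB, RA.pull_fam_map RB]
      exact Fam.pull_congr _ e _ _)
  refine ⟨⟨pullback (RE.map RB p) (RA.map RB f), a ≫ RE.p, a ≫ RE.q, χ, ?_, ?_⟩⟩
  · intro W u v ψ
    have e' : RE.lift (ψ.map t) ≫ RE.map RB p = RA.lift (ψ.map l) ≫ RA.map RB f := by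
      rw [lift_map, lift_map, Fam.map_map, Fam.map_map, w]
    have ea : pullback.lift _ _ e' ≫ a = RE.lift (ψ.map t) := pullback.lift_fst _ _ _
    have eb : pullback.lift _ _ e' ≫ b = RA.lift (ψ.map l) := pullback.lift_snd _ _ _
    have hu' : pullback.lift _ _ e' ≫ a ≫ RE.p = u := by rw [← Category.assoc, ea, lift_p]
    have hv' : pullback.lift _ _ e' ≫ a ≫ RE.q = v := by rw [← Category.assoc, ea, lift_q]
    refine ⟨pullback.lift _ _ e', hu', hv', Fam.hom_ext_of_isPullback hQ ?_ ?_⟩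
    · rw [← Fam.map_pull, h₁, Fam.pull_pull]
      exact (Fam.pull_congr _ ea _ _).trans (RE.pull_lift _)
    · rw [← Fam.map_pull, h₂, Fam.pull_pull]
      exact (Fam.pull_congr _ eb _ _).trans (RA.pull_lift _)
  · intro W s s' u v hu₁ hv₁ hu₂ hv₂ h
    apply pullback.hom_ext
    · refine RE.hom_ext (p' := u) (q' := v) ((Category.assoc _ _ _).trans hu₁)
        ((Category.assoc _ _ _).trans hv₁) ((Category.assoc _ _ _).trans hu₂)
        ((Category.assoc _ _ _).trans hv₂) ?_
      have := congrArg (fun φ => φ.map t) h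
      rw [← Fam.map_pull, ← Fam.map_pull, h₁, Fam.pull_pull, Fam.pull_pull] at this
      exact this
    · refine RA.hom_ext (p' := u) (q' := v) ?_ ?_ ?_ ?_ ?_
      · rw [Category.assoc]; exact (congrArg (s ≫ ·) hu).trans hu₁
      · rw [Category.assoc]; exact (congrArg (s ≫ ·) hv).trans hv₁
      · rw [Category.assoc]; exact (congrArg (s' ≫ ·) hu).trans hu₂
      · rw [Category.assoc]; exact (congrArg (s' ≫ ·) hv).trans hv₂
      have := congrArg (fun φ => φ.map l) h
      rw [← Fam.map_pull, ← Fam.map_pull, h₂, Fam.pull_pull, Fam.pull_pull] at this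
      exact this

end LevelwiseIsPullback

/-! ## Pullbacks and terminal objects in the category of Reedy fibrant diagrams -/

section ReedyPullback

variable {C : Type u} [Category.{v} C] [CategoryWithFibrations C]
  [IsTypeTheoreticFibrationCategory C] {K : Type w} [PartialOrder K] {I : InverseCat C K} {Y : C}

section

variable [WellFoundedLT K] (hK : Admissible C K) {E A B : ReedyFib I Y} {p : E ⟶ B}
  (hp : Fibration p)

include hK hp

lemma fibration_matching_map (ME : ∀ z, FamRep (I.repP z) E.obj Set.univ)
    (MB : ∀ z, FamRep (I.repP z) B.obj Set.univ) (hE : ∀ z, Fibration (ME z).toM)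
    (hB : ∀ z, Fibration (MB z).toM) (z : K) : Fibration ((ME z).map (MB z) p.hom) := by
  obtain ⟨J, _, σ, hσ, hJ⟩ := hK.exists_embedding_Iio z
  exact fibration_famRep_map (isLowerSet_Iio z) hK hE hB σ hσ (hJ _) p.hom
    (fun z _ => Diag.IsReedyFibration.hasGap hp.mem ME MB z) (ME z) (MB z)

/-- Reedy fibrations between Reedy fibrant diagrams are levelwise fibrations. -/
lemma fibration_app (z : K) : Fibration (p.hom.app z) := by
  obtain ⟨ME, hE⟩ := exists_matching_famRep E
  obtain ⟨MB, hB⟩ := exists_matching_famRep B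
  obtain ⟨N, t, n, k, hN, -, hk, hkf⟩ := Diag.IsReedyFibration.hasGap hp.mem ME MB z
  rw [← hk]
  exact fibration_comp hkf
    (fibration_of_isPullback hN.flip (fibration_matching_map hK hp ME MB hE hB z))

/-- `Q_z ⟶ M_z Q` factors through `M_z Q ×_{M_z A} A_z`. The first factor is a base change of the
gap map of `p` at `z`, the second a base change of `A_z ⟶ M_z A`. -/
lemma isReedyFibrant_of_isPullback {Q : Diag I Y} {t : Q ⟶ E.obj} {l : Q ⟶ A.obj} {f : A ⟶ B}
    (w : t ≫ p.hom = l ≫ f.hom)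
    (hQ : ∀ z, IsPullback (t.app z) (l.app z) (p.hom.app z) (f.hom.app z)) :
    Q.IsReedyFibrant := by
  obtain ⟨ME, hE⟩ := exists_matching_famRep E
  obtain ⟨MA, hA⟩ := exists_matching_famRep A
  obtain ⟨MB, hB⟩ := exists_matching_famRep B
  refine Diag.isReedyFibrant_iff.2 fun z => ?_
  have hm := fibration_matching_map hK hp ME MB hE hB z
  obtain ⟨MQ⟩ := FamRep.exists_of_isPullback w hQ (ME z) (MA z) (MB z)
  have hMQ := FamRep.isPullback_map w hQ MQ (ME z) (MA z) (MB z)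
  refine ⟨MQ, ?_⟩
  obtain ⟨N, tN, n, k, hN, hkn, hkt, hkf⟩ := Diag.IsReedyFibration.hasGap hp.mem ME MB z
  have hAz := hA z
  -- the pullback of `A_z ⟶ M_z A` along `M_z Q ⟶ M_z A`
  have hN' := IsPullback.of_hasPullback (MQ.map (MA z) l) (MA z).toM
  let a := pullback.fst (MQ.map (MA z) l) (MA z).toM
  let b := pullback.snd (MQ.map (MA z) l) (MA z).toM
  have hab : a ≫ MQ.map (MA z) l = b ≫ (MA z).toM := pullback.condition
  have hc : (b ≫ f.hom.app z) ≫ (MB z).toM = (a ≫ MQ.map (ME z) t) ≫ (ME z).map (MB z) p.hom := by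
    rw [Category.assoc, ← (MA z).toM_map (MB z) f.hom, ← Category.assoc b, ← hab, Category.assoc,
      Category.assoc, hMQ.w]
  let c := hN.lift _ _ hc
  have hct : c ≫ tN = b ≫ f.hom.app z := hN.lift_fst _ _ _
  have hcn : c ≫ n = a ≫ MQ.map (ME z) t := hN.lift_snd _ _ _
  have h₁ : IsPullback (c ≫ n) b ((ME z).map (MB z) p.hom) (f.hom.app z ≫ (MB z).toM) := by
    rw [hcn, ← (MA z).toM_map (MB z) f.hom]
    exact (hN'.flip.paste_vert hMQ.flip).flip
  have h₂ : IsPullback c b tN (f.hom.app z) := IsPullback.of_right h₁ hct hN.flip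
  let d := pullback.lift MQ.toM (l.app z) (MQ.toM_map (MA z) l)
  have hda : d ≫ a = MQ.toM := pullback.lift_fst _ _ _
  have hdb : d ≫ b = l.app z := pullback.lift_snd _ _ _
  have hdc : t.app z ≫ k = d ≫ c := by
    apply hN.hom_ext
    · rw [Category.assoc, Category.assoc, hkt, hct, ← Category.assoc d, hdb, (hQ z).w]
    · rw [Category.assoc, Category.assoc, hkn, hcn, ← Category.assoc d, hda,
        MQ.toM_map (ME z) t]
  have h₃ : IsPullback (t.app z) d k c :=
    IsPullback.of_bot (by rw [hdb, hkt]; exact hQ z) hdc h₂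
  rw [← hda]
  exact fibration_comp (fibration_of_isPullback h₃ hkf) (fibration_of_isPullback hN'.flip (hA z))

/-- Pullbacks of Reedy fibrations are levelwise pullbacks. -/
lemma isPullback_app {Q : ReedyFib I Y} {t : Q ⟶ E} {l : Q ⟶ A} {f : A ⟶ B}
    (h : IsPullback t l p f) (z : K) :
    IsPullback (t.hom.app z) (l.hom.app z) (p.hom.app z) (f.hom.app z) := by
  have hp' := fibration_app hK hp
  have hQ := isPullback_pullbackDiag p.hom f.hom hp'
  have w : pullbackDiagFst p.hom f.hom hp' ≫ p.hom = pullbackDiagSnd p.hom f.hom hp' ≫ f.hom :=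
    pullbackDiag_condition p.hom f.hom hp'
  -- The levelwise pullback is Reedy fibrant, hence a pullback also in the full subcategory; the
  -- given pullback is isomorphic to it.
  let Q' : ReedyFib I Y := ⟨pullbackDiag p.hom f.hom hp', isReedyFibrant_of_isPullback hK hp w hQ⟩
  let t' : Q' ⟶ E := ObjectProperty.homMk (pullbackDiagFst p.hom f.hom hp')
  let l' : Q' ⟶ A := ObjectProperty.homMk (pullbackDiagSnd p.hom f.hom hp')
  have h' : IsPullback t' l' p f :=
    IsPullback.of_map (ObjectProperty.ι (fun A : Diag I Y => A.IsReedyFibrant)) (ObjectProperty.hom_ext _ w) (isPullback_of_app w hQ)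
  let e := h.isoIsPullback _ _ h'
  have he₁ : e.hom ≫ t' = t := h.isoIsPullback_hom_fst _ _ h'
  have he₂ : e.hom ≫ l' = l := h.isoIsPullback_hom_snd _ _ h'
  let e' : Q.obj.obj z ≅ Q'.obj.obj z :=
    { hom := e.hom.hom.app z
      inv := e.inv.hom.app z
      hom_inv_id := congrArg (fun t => t.hom.app z) e.hom_inv_id
      inv_hom_id := congrArg (fun t => t.hom.app z) e.inv_hom_id }
  refine IsPullback.of_iso (hQ z) e'.symm (Iso.refl _) (Iso.refl _) (Iso.refl _) ?_ ?_ ?_ ?_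
  · refine (Category.comp_id _).trans (e'.eq_inv_comp.2 ?_)
    exact congrArg (fun t => t.hom.app z) he₁
  · refine (Category.comp_id _).trans (e'.eq_inv_comp.2 ?_)
    exact congrArg (fun t => t.hom.app z) he₂
  · exact (Category.comp_id _).trans (Category.id_comp _).symm
  · exact (Category.comp_id _).trans (Category.id_comp _).symm

end

end ReedyPullback

/-! ### The terminal diagram. -/

section Terminal

variable {C : Type u} [Category.{v} C] [CategoryWithFibrations C]
  [HasFibrationPullbacks C] {K : Type w} [PartialOrder K] (I : InverseCat C K) (Y : C)

/-- The terminal diagram, with its actions on generalized elements. -/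
noncomputable def topP : PDiag I (fun z : K => z) Y where
  obj z := I.obj z ⨯ Y
  base _ := prod.snd
  anchor _ := prod.fst
  actOn h _ a b _ := prod.lift (b ≫ I.tgt h) (a ≫ prod.snd)
  comp_actOn h _ _ f a b e := by simp [prod.comp_lift]
  actOn_base h _ a b e := by simp
  actOn_anchor h _ a b e := by simp
  actOn_actOn h k _ a b c e e' := by simp [I.comp_tgt]

/-- The terminal diagram. -/
noncomputable def topDiag : Diag I Y := (topP I Y).toDiag

variable {I Y}

lemma topDiag_hom_ext {z : K} {V : C} {f g : V ⟶ (topDiag I Y).obj z}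
    (h₁ : f ≫ (topDiag I Y).anchor z = g ≫ (topDiag I Y).anchor z)
    (h₂ : f ≫ (topDiag I Y).base z = g ≫ (topDiag I Y).base z) : f = g :=
  Limits.prod.hom_ext h₁ h₂

/-- A map to a component of the terminal diagram. -/
noncomputable def topLift {z : K} {V : C} (a : V ⟶ I.obj z) (b : V ⟶ Y) :
    V ⟶ (topDiag I Y).obj z := prod.lift a b

lemma topLift_anchor {z : K} {V : C} (a : V ⟶ I.obj z) (b : V ⟶ Y) :
    topLift a b ≫ (topDiag I Y).anchor z = a := prod.lift_fst _ _

lemma topLift_base {z : K} {V : C} (a : V ⟶ I.obj z) (b : V ⟶ Y) :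
    topLift a b ≫ (topDiag I Y).base z = b := prod.lift_snd _ _

/-- The map from a diagram to the terminal diagram. -/
noncomputable def toTopDiag (B : Diag I Y) : B ⟶ topDiag I Y :=
  Diag.Hom.mk (fun z => topLift (B.anchor z) (B.base z)) (fun _ => topLift_base _ _)
    (fun _ => topLift_anchor _ _)
    (Diag.act_app_of_actOn _ (fun _ => topLift_anchor _ _) (fun {x y} h V a b e => by
      apply topDiag_hom_ext
      · rw [Category.assoc, topLift_anchor, Diag.actOn_anchor, Diag.actOn_anchor]
      · rw [Category.assoc, topLift_base, Diag.actOn_base, Diag.actOn_base, Category.assoc,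
          topLift_base]))

lemma eq_toTopDiag {B : Diag I Y} (f : B ⟶ topDiag I Y) : f = toTopDiag B :=
  Diag.hom_ext fun z => topDiag_hom_ext
    ((f.app_anchor z).trans ((toTopDiag B).app_anchor z).symm)
    ((f.app_base z).trans ((toTopDiag B).app_base z).symm)

variable {X : C} {T : Type*} {ι : T → K} {G : PDiag I ι X} {S : Set T}

lemma Fam.topDiag_ext {W : C} {u : W ⟶ X} {v : W ⟶ Y} (φ ψ : Fam G (topDiag I Y) S u v) :
    φ = ψ := by
  ext z hz
  apply topDiag_hom_ext
  · rw [φ.app_anchor, ψ.app_anchor]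
  · rw [φ.app_base, ψ.app_base]

/-- The unique family of maps to the terminal diagram. -/
noncomputable def Fam.top (G : PDiag I ι X) (S : Set T) {W : C} (u : W ⟶ X) (v : W ⟶ Y) :
    Fam G (topDiag I Y) S u v where
  app z _ := topLift (pullback.snd u (G.base z) ≫ G.anchor z) (pullback.fst _ _ ≫ v)
  app_base z _ := topLift_base _ _
  app_anchor z _ := topLift_anchor _ _
  app_act {y z} h _ _ V w a e b e' := by
    apply topDiag_hom_ext
    · rw [Category.assoc, topLift_anchor, Diag.actOn_anchor, pullback.lift_snd_assoc,
        G.actOn_anchor]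
    · rw [Category.assoc, topLift_base, Diag.actOn_base, Category.assoc, topLift_base,
        pullback.lift_fst_assoc, pullback.lift_fst_assoc]

/-- The product of the indexing objects represents families of maps to the terminal diagram. -/
noncomputable def FamRep.top (G : PDiag I ι X) (S : Set T) : FamRep G (topDiag I Y) S where
  obj := X ⨯ Y
  p := prod.fst
  q := prod.snd
  fam := .top G S _ _
  exists_lift {_ u v} _ := ⟨prod.lift u v, prod.lift_fst _ _, prod.lift_snd _ _, Fam.topDiag_ext _ _⟩
  hom_ext hp hq hp' hq' _ :=
    Limits.prod.hom_ext (hp.trans hp'.symm) (hq.trans hq'.symm)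

lemma isReedyFibrant_topDiag : (topDiag I Y).IsReedyFibrant :=
  Diag.isReedyFibrant_iff.2 fun x => ⟨.top _ _, by
    have : (FamRep.top (Y := Y) (I.repP x) Set.univ).toM = 𝟙 (I.obj x ⨯ Y) :=
      Limits.prod.hom_ext ((FamRep.toM_p _).trans (Category.id_comp _).symm)
        ((FamRep.toM_q _).trans (Category.id_comp _).symm)
    rw [this]
    exact fibration_of_iso (𝟙 (I.obj x ⨯ Y))⟩

variable (I Y) in
/-- The terminal Reedy fibrant diagram. -/
noncomputable def ReedyFib.top : ReedyFib I Y := ⟨topDiag I Y, isReedyFibrant_topDiag⟩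

variable (I Y) in
/-- The terminal Reedy fibrant diagram is terminal. -/
noncomputable def ReedyFib.isTerminalTop : IsTerminal (ReedyFib.top I Y) :=
  IsTerminal.ofUniqueHom (fun B => ObjectProperty.homMk (toTopDiag B.obj))
    (fun _ f => ObjectProperty.hom_ext _ (eq_toTopDiag f.hom))

end Terminal

/-! ## Hom-objects of Reedy fibrant diagrams and matching functors -/

section HomObjects

variable {C : Type u} [Category.{v} C] [CategoryWithFibrations C]
  [IsTypeTheoreticFibrationCategory C] {K : Type w} [PartialOrder K] {I : InverseCat C K} {X Y : C}

lemma InverseCat.IsAdmissible.admissible (hadm : I.IsAdmissible) : Admissible C K := fun z =>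
  ⟨Set.Iio z, inferInstance, OrderEmbedding.subtype _,
    fun y => ⟨fun h => ⟨⟨y, h⟩, rfl⟩, by rintro ⟨j, rfl⟩; exact lt_of_Iio j⟩, hadm z⟩

lemma InverseCat.IsAdmissible.admissible_Iio (hadm : I.IsAdmissible) (x : K) :
    Admissible C (Set.Iio x) := fun z =>
  ⟨Set.Iio z.1, inferInstance,
    OrderEmbedding.ofMapLEIff (fun j => ⟨j.1, Set.mem_Iio.2 ((lt_of_Iio j).trans (lt_of_Iio z))⟩)
      (fun _ _ => Iff.rfl),
    fun y => ⟨fun h => ⟨⟨y.1, Set.mem_Iio.2 h⟩, rfl⟩, by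
      rintro ⟨j, rfl⟩; exact fullLt (lt_of_Iio j)⟩, hadm z.1⟩

namespace Diag

section Functoriality

variable {A : Diag I X} {B B' B'' : Diag I Y} {H H' H'' : Over (X ⨯ Y)} (r : HomObj A B H)
  (r' : HomObj A B' H') (r'' : HomObj A B'' H'')

lemma homObjMap_id : homObjMap (𝟙 B) r r = 𝟙 H :=
  Over.OverMorphism.ext ((homObjMap_left r r (𝟙 B)).trans (FamRep.map_id _))

lemma homObjMap_comp (g : B ⟶ B') (h : B' ⟶ B'') :
    homObjMap (g ≫ h) r r'' = homObjMap g r r' ≫ homObjMap h r' r'' := by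
  refine Over.OverMorphism.ext ?_
  rw [Over.comp_left, homObjMap_left, homObjMap_left, homObjMap_left]
  exact (FamRep.map_map _ _ _ g h).symm

lemma isPullback_homObjMap {E : Diag I Y} {HE : Over (X ⨯ Y)} (rE : HomObj A E HE) {t : B ⟶ E}
    {l : B ⟶ B'} {p : E ⟶ B''} {f : B' ⟶ B''}
    (h : ∀ z, IsPullback (t.app z) (l.app z) (p.app z) (f.app z)) :
    IsPullback (homObjMap t r rE).left (homObjMap l r r').left (homObjMap p rE r'').left
      (homObjMap f r' r'').left := by
  rw [homObjMap_left, homObjMap_left, homObjMap_left, homObjMap_left]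
  have w : t ≫ p = l ≫ f := Diag.hom_ext fun z => (h z).w
  exact FamRep.isPullback_map w h _ _ _ _

omit r in
-- Over given indices there is exactly one family of maps to the terminal diagram, so `X ⨯ Y` itself
-- represents such families.
lemma isIso_hom_of_topDiag {H : Over (X ⨯ Y)} (r : HomObj A (topDiag I Y) H) : IsIso H.hom := by
  let R := FamRep.ofHomObj r.toUniv
  have h : H.hom = (R.uniqueIso (.top _ _)).hom := by
    apply Limits.prod.hom_ext
    · exact ((FamRep.top _ _).lift_p R.fam).symm
    · exact ((FamRep.top _ _).lift_q R.fam).symm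
  rw [h]
  exact Iso.isIso_hom (R.uniqueIso _)

end Functoriality

variable [WellFoundedLT K] (hK : Admissible C K) (hL : HasReedyLimits K (FibOver (X ⨯ Y)))
  (A : Diag I X) {B B' : ReedyFib I Y} {H H' : Over (X ⨯ Y)}

include hK hL

variable (B) in
/-- Hom-objects to Reedy fibrant diagrams exist. -/
lemma exists_homObj : ∃ H : Over (X ⨯ Y), Nonempty (HomObj A B.obj H) := by
  obtain ⟨M, hM⟩ := exists_matching_famRep B
  -- Families are indexed by a set of objects: here it is the set of all objects, parametrized by
  -- `K` itself.
  obtain ⟨R, -⟩ := exists_famRep (A := (A.restrict Set.univ).fullToPDiag) isLowerSet_univ hK hM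
    OrderIso.Set.univ.symm.toOrderEmbedding OrderIso.Set.univ.symm.surjective hL
  exact ⟨_, ⟨(R.toHomObj).ofUniv⟩⟩

variable {A} (r : HomObj A B.obj H) (r' : HomObj A B'.obj H')

include r in
/-- Hom-objects to Reedy fibrant diagrams are fibrations. -/
lemma fibration_homObj : Fibration H.hom := by
  obtain ⟨M, hM⟩ := exists_matching_famRep B
  let R := FamRep.ofHomObj r.toUniv
  have h := fibration_famRep isLowerSet_univ hK hM
    OrderIso.Set.univ.symm.toOrderEmbedding OrderIso.Set.univ.symm.surjective hL R
  have e : prod.lift R.p R.q = H.hom := by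
    apply Limits.prod.hom_ext
    · exact prod.lift_fst _ _
    · exact prod.lift_snd _ _
  rwa [e] at h

/-- Reedy fibrations induce fibrations of hom-objects. -/
lemma fibration_homObjMap {g : B ⟶ B'} (hg : Fibration g) :
    Fibration (homObjMap g.hom r r').left := by
  obtain ⟨M, hM⟩ := exists_matching_famRep B
  obtain ⟨M', hM'⟩ := exists_matching_famRep B'
  rw [homObjMap_left]
  exact fibration_famRep_map isLowerSet_univ hK hM hM'
    OrderIso.Set.univ.symm.toOrderEmbedding OrderIso.Set.univ.symm.surjective hL g.hom
    (fun z _ => IsReedyFibration.hasGap hg.mem M M' z) _ _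

/-- Levelwise homotopy equivalences induce homotopy equivalences of hom-objects. -/
lemma isHomotopyEquiv_homObjMap (hfe : FunctionExtensionality C) {g : B ⟶ B'}
    (hg : ∀ z, IsHomotopyEquiv (g.hom.app z)) :
    IsHomotopyEquiv (homObjMap g.hom r r').left := by
  obtain ⟨M, hM⟩ := exists_matching_famRep B
  obtain ⟨M', hM'⟩ := exists_matching_famRep B'
  rw [homObjMap_left]
  exact isHomotopyEquiv_famRep_map isLowerSet_univ hK hM hM'
    OrderIso.Set.univ.symm.toOrderEmbedding OrderIso.Set.univ.symm.surjective hL hfe g.hom hg _ _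

end Diag

end HomObjects

namespace FibOver

variable {C : Type u} [Category.{v} C] [CategoryWithFibrations C]
  [IsTypeTheoreticFibrationCategory C] {Z : C}

/-- An isomorphism onto the base is a terminal object. -/
noncomputable def isTerminalOfIsIso (A : FibOver Z) [IsIso A.obj.hom] : IsTerminal A :=
  IsTerminal.ofUniqueHom (fun B => homMk (B.obj.hom ≫ inv A.obj.hom) (by simp))
    (fun B f => hom_ext ((IsIso.eq_comp_inv _).2 (w f)))

end FibOver

/-! ### Matching functors and the properties they preserve. -/

section MatchingFunctor

variable {C : Type u} [Category.{v} C] [CategoryWithFibrations C]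
  [IsTypeTheoreticFibrationCategory C] {K : Type w} [PartialOrder K] [WellFoundedLT K]
  {I : InverseCat C K} (hadm : I.IsAdmissible) (x : K)

include hadm

/-- The matching functor exists. -/
lemma InverseCat.exists_isMatchingFunctor :
    ∃ M : ReedyFib (I.below x) (⊤_ C) ⥤ FibOver (I.obj x ⨯ ⊤_ C), I.IsMatchingFunctor x M := by
  -- Admissibility is used twice: segments of `{y | y < x}` are segments of `I₀`, which drives the
  -- induction, and the segment below `x` itself gives the final limit over `I(x) × 1`.
  have hK := hadm.admissible_Iio x
  have hL := hadm x (I.obj x ⨯ ⊤_ C)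
  choose H hH using fun B : ReedyFib (I.below x) (⊤_ C) =>
    Diag.exists_homObj hK hL (I.rep x) B
  have r (B) := (hH B).some
  let M : ReedyFib (I.below x) (⊤_ C) ⥤ FibOver (I.obj x ⨯ ⊤_ C) :=
    { obj := fun B => ⟨H B, (Diag.fibration_homObj hK hL (r B)).mem⟩
      map := fun {B B'} g => ObjectProperty.homMk (Diag.homObjMap g.hom (r B) (r B'))
      map_id := fun B => ObjectProperty.hom_ext _ (Diag.homObjMap_id (r B))
      map_comp := fun {B B' B''} g h => ObjectProperty.hom_ext _
        (Diag.homObjMap_comp (r B) (r B') (r B'') g.hom h.hom) }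
  exact ⟨M, r, fun _ => rfl⟩

variable {x} {M : ReedyFib (I.below x) (⊤_ C) ⥤ FibOver (I.obj x ⨯ ⊤_ C)}
  (hM : I.IsMatchingFunctor x M)

include hM

namespace InverseCat.IsMatchingFunctor

lemma fibration_map {A B : ReedyFib (I.below x) (⊤_ C)} {f : A ⟶ B} (hf : Fibration f) :
    Fibration (M.map f).hom.left := by
  obtain ⟨r, hr⟩ := hM
  rw [hr]
  exact Diag.fibration_homObjMap (hadm.admissible_Iio x) (hadm x _) (r A) (r B) hf

lemma isHomotopyEquiv_map (hfe : FunctionExtensionality C) {A B : ReedyFib (I.below x) (⊤_ C)}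
    {f : A ⟶ B} (hf : IsHomotopyEquiv f) : IsHomotopyEquiv (M.map f).hom.left := by
  obtain ⟨r, hr⟩ := hM
  rw [hr]
  have hK := hadm.admissible_Iio x
  exact Diag.isHomotopyEquiv_homObjMap hK (hadm x _) (r A) (r B) hfe (isHomotopyEquiv_app hK hf)

lemma isPullback_map {P A B E : ReedyFib (I.below x) (⊤_ C)} {t : P ⟶ E} {l : P ⟶ A}
    {p : E ⟶ B} {f : A ⟶ B} (hp : Fibration p) (h : IsPullback t l p f) :
    IsPullback (M.map t).hom.left (M.map l).hom.left (M.map p).hom.left (M.map f).hom.left := by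
  obtain ⟨r, hr⟩ := hM
  rw [hr, hr, hr, hr]
  exact Diag.isPullback_homObjMap (r P) (r A) (r B) (r E)
    (isPullback_app (hadm.admissible_Iio x) hp h)

-- The explicit terminal diagram is sent to an isomorphism onto the base, which is terminal in
-- `FibOver`; every other terminal diagram is isomorphic to it.
omit hadm [WellFoundedLT K] in
lemma nonempty_isTerminal {T : ReedyFib (I.below x) (⊤_ C)} (hT : IsTerminal T) :
    Nonempty (IsTerminal (M.obj T)) := by
  obtain ⟨r, -⟩ := hM
  have : IsIso (M.obj (ReedyFib.top (I.below x) (⊤_ C))).obj.hom :=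
    Diag.isIso_hom_of_topDiag (r (ReedyFib.top (I.below x) (⊤_ C)))
  exact ⟨(FibOver.isTerminalOfIsIso _).ofIso
    (M.mapIso ((ReedyFib.isTerminalTop _ _).uniqueUpToIso hT))⟩

lemma isStrongFibrationFunctor (hfe : FunctionExtensionality C) : IsStrongFibrationFunctor M where
  fibration _ hf := ⟨fibration_map hadm hM hf⟩
  pullback hp h := FibOver.isPullback_of_left (isPullback_map hadm hM hp h)
  homotopyEquiv _ hf := (FibOver.isHomotopyEquiv_iff _).2 (isHomotopyEquiv_map hadm hM hfe hf)
  terminal _ := fun ⟨hT⟩ => nonempty_isTerminal hM hT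

lemma preservesFibrationStructure_total (hfe : FunctionExtensionality C) :
    PreservesFibrationStructure (M ⋙ FibOver.total (I.obj x ⨯ ⊤_ C)) where
  fibration _ hf := fibration_map hadm hM hf
  pullback hp h := isPullback_map hadm hM hp h
  homotopyEquiv _ hf := isHomotopyEquiv_map hadm hM hfe hf

end InverseCat.IsMatchingFunctor

end MatchingFunctor

theorem mainTheorem10 {C : Type u} [Category.{v} C] [CategoryWithFibrations C]
    [IsTypeTheoreticFibrationCategory C] (hfunext : FunctionExtensionality C)
    {I₀ : Type w} [PartialOrder I₀] [WellFoundedLT I₀] (I : InverseCat C I₀)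
    (hI : I.IsFibrant) (hadm : I.IsAdmissible) :
    (∀ (X Y : C), HasReedyLimits I₀ (FibOver (X ⨯ Y)) →
      ∀ (A : ReedyFib I X) (B B' : ReedyFib I Y) (g : B ⟶ B'),
        (IsHomotopyEquiv g ∨ ∀ x : I₀, IsHomotopyEquiv (g.hom.app x)) →
          (Diag.homPresheaf A.obj B.obj).IsRepresentable ∧
          (Diag.homPresheaf A.obj B'.obj).IsRepresentable ∧
          ∀ (H H' : Over (X ⨯ Y)) (r : Diag.HomObj A.obj B.obj H)
            (r' : Diag.HomObj A.obj B'.obj H'),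
            ∃ (hH : fibrations C H.hom) (hH' : fibrations C H'.hom),
              IsHomotopyEquiv (ObjectProperty.homMk (Diag.homObjMap g.hom r r') :
                (⟨H, hH⟩ : FibOver (X ⨯ Y)) ⟶ ⟨H', hH'⟩) ∧
              IsHomotopyEquiv (Diag.homObjMap g.hom r r').left) ∧
    (∀ x : I₀,
      (∃ M : ReedyFib (I.below x) (⊤_ C) ⥤ FibOver (I.obj x ⨯ ⊤_ C),
        I.IsMatchingFunctor x M) ∧
      ∀ M : ReedyFib (I.below x) (⊤_ C) ⥤ FibOver (I.obj x ⨯ ⊤_ C),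
        I.IsMatchingFunctor x M →
          IsStrongFibrationFunctor M ∧
          PreservesFibrationStructure (M ⋙ FibOver.total (I.obj x ⨯ ⊤_ C))) := by
  have hadm' := hadm.admissible
  refine ⟨fun X Y hL A B B' g hg => ?_, fun x => ⟨InverseCat.exists_isMatchingFunctor hadm x, fun M hM =>
    ⟨hM.isStrongFibrationFunctor hadm hfunext, hM.preservesFibrationStructure_total hadm hfunext⟩⟩⟩
  -- Both alternatives for `g` reduce to the levelwise one, through preservation of acyclic
  -- cofibrations by evaluation.
  have hg' (x : I₀) : IsHomotopyEquiv (g.hom.app x) :=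
    hg.elim (fun h => isHomotopyEquiv_app hadm' h x) (fun h => h x)
  refine ⟨⟨Diag.exists_homObj hadm' hL A.obj B⟩,
    ⟨Diag.exists_homObj hadm' hL A.obj B'⟩, fun H H' r r' => ?_⟩
  have h := Diag.isHomotopyEquiv_homObjMap hadm' hL r r' hfunext hg'
  exact ⟨(Diag.fibration_homObj hadm' hL r).mem, (Diag.fibration_homObj hadm' hL r').mem,
    (FibOver.isHomotopyEquiv_iff _).2 h, h⟩
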